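/- Let $\mathbb K=\mathbb R$ or $\mathbb C$ and fix a class $C^n$ of functions with values in $\mathbb K$: continuous, $C^k$ or smooth, or analytic (over $\mathbb C$ differentiability is complex differentiability). A supermanifold $S=(M,\mathcal O_S)$ of dimension $m|q$ is a $C^n$ manifold $M$ modelled on $\mathbb K^m$ with a sheaf $\mathcal O_S$ of supercommutative $\mathbb K$-algebras which is locally isomorphic to the sheaf of $C^n$ sections of $\bigwedge^\bullet(\mathbb K^q)^\vee$. For a $C^n$ vector bundle $V$ on $M$, $S(M,V)$ denotes $M$ with the sheaf of $C^n$ sections of $\bigwedge^\bullet V^\vee$. Let $J\subset\mathcal O_S$ be the ideal sheaf generated by the odd functions and, for $i\ge 0$, $S^{(i)}=(M,\mathcal O_S/J^{i+1})$; thus $\mathcal O_S/J=\mathcal O_M$. We say that $S$ (resp. $S^{(i)}$) is split if it is isomorphic to $S(M,V)$ (resp. $S(M,V)^{(i)}$) for some vector bundle $V$, and that $S$ (resp. $S^{(i)}$) is projected if the quotient map from its structure sheaf onto $\mathcal O_M$ has a right inverse which is a morphism of sheaves of superalgebras. A finite covering $\tilde S\to S$ of supermanifolds consists of a surjective covering map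 $f:\tilde M\to M$ of the reduced spaces with finite fibres, which is a local isomorphism of $C^n$ manifolds, together with an isomorphism $\mathcal O_{\tilde S}\cong f^{-1}\mathcal O_S$. For a supermanifold $S$ choose a vector bundle $V$ and an isomorphism of sheaves of graded algebras $\rho:\bigoplus_k J^k/J^{k+1}\cong\bigwedge^\bullet V^\vee$ that is induced by local isomorphisms $\phi_\alpha$ of $S$ with $S(M,V)$ on an open covering $(U_\alpha)$ of $M$. The automorphisms $g_{\alpha\beta}=\phi_\alpha\phi_\beta^{-1}$ act trivially on the associated graded algebra, and $h\mapsto (g_{\alpha\beta}h-h \bmod J^3)$, for $h\in\mathcal O_M$, are derivations $\mathcal O_M\to\bigwedge^2V^\vee$. They form a Čech cocycle, whose class is $\omega_2(S)\in H^1(M,T_M\otimes\bigwedge^2V^\vee)$, where $T_M\otimes\bigwedge^2V^\vee$ is the sheaf of $\mathbb K$-linear derivations $\mathcal O_M\to\bigwedge^2V^\vee$. **Theorem.** Let $\tilde S\to S$ be a finite covering of supermanifolds. 1. If $S$ is split (resp. projected), then $\tilde S$ is split (resp. projected). For every $i\ge 0$, if $S^{(i)}$ is split (resp. projected), then $\tilde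 S^{(i)}$ is split (resp. projected). 2. Conversely, if $\tilde S$ is split, then $S$ is split, and for every $i\ge0$, if $\tilde S^{(i)}$ is split, then $S^{(i)}$ is split. 3. If $\omega_2(\tilde S)\neq 0$ (for some choice of the data defining it), then $S$ is not projected. -/

import Mathlib

open CategoryTheory Opposite TopologicalSpace Topology
open scoped Manifold ContDiff

universe u

noncomputable section

/-- A sheaf `O` of `ℤ/2`-graded, supercommutative `𝕜`-algebras on the topological space `M`:
a sheaf of `𝕜`-algebras, with even and odd subsheaves `O = O₀ ⊕ O₁`. -/
structure SuperSheaf (𝕜 : Type) [Field 𝕜] (M : Type u) [TopologicalSpace M] where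
  /-- the underlying sheaf of algebras -/
  presheaf : (Opens M)ᵒᵖ ⥤ AlgCat.{u} 𝕜
  isSheaf : TopCat.Presheaf.IsSheaf (X := TopCat.of M) presheaf
  /-- the even sections over `U` -/
  even (U : Opens M) : Submodule 𝕜 (presheaf.obj (op U))
  /-- the odd sections over `U` -/
  odd (U : Opens M) : Submodule 𝕜 (presheaf.obj (op U))
  isCompl (U : Opens M) : IsCompl (even U) (odd U)
  res_even {U W : Opens M} (h : W ≤ U) {s : presheaf.obj (op U)} :
    s ∈ even U → (presheaf.map (homOfLE h).op).hom s ∈ even W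
  res_odd {U W : Opens M} (h : W ≤ U) {s : presheaf.obj (op U)} :
    s ∈ odd U → (presheaf.map (homOfLE h).op).hom s ∈ odd W
  one_mem (U : Opens M) : 1 ∈ even U
  even_mul_even {U : Opens M} {a b : presheaf.obj (op U)} :
    a ∈ even U → b ∈ even U → a * b ∈ even U
  even_mul_odd {U : Opens M} {a b : presheaf.obj (op U)} :
    a ∈ even U → b ∈ odd U → a * b ∈ odd U
  odd_mul_odd {U : Opens M} {a b : presheaf.obj (op U)} :
    a ∈ odd U → b ∈ odd U → a * b ∈ even U
  even_comm {U : Opens M} {a : presheaf.obj (op U)} (b : presheaf.obj (op U)) :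
    a ∈ even U → a * b = b * a
  odd_anticomm {U : Opens M} {a b : presheaf.obj (op U)} :
    a ∈ odd U → b ∈ odd U → a * b = -(b * a)

namespace SuperSheaf

section Basic

variable {𝕜 : Type} [Field 𝕜] {M : Type u} [TopologicalSpace M] (X Y : SuperSheaf 𝕜 M)

/-- The algebra of sections over an open set. -/
abbrev Sec (U : Opens M) : Type u := X.presheaf.obj (op U)

/-- Restriction of sections. -/
def res {U W : Opens M} (h : W ≤ U) : X.Sec U →ₐ[𝕜] X.Sec W :=
  (X.presheaf.map (homOfLE h).op).hom

/-- The underlying sheaf. -/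
abbrev sheaf : TopCat.Sheaf (AlgCat.{u} 𝕜) (TopCat.of M) := ⟨X.presheaf, X.isSheaf⟩

theorem res_res {U W T : Opens M} (h : W ≤ U) (h' : T ≤ W) (s : X.Sec U) :
    X.res h' (X.res h s) = X.res (h'.trans h) s := by
  have := X.presheaf.map_comp (homOfLE h).op (homOfLE h').op
  have h2 := congrArg (fun f => f.hom s) this
  exact h2.symm

theorem res_self {U : Opens M} (s : X.Sec U) : X.res le_rfl s = s := by
  have := X.presheaf.map_id (op U)
  exact congrArg (fun f => f.hom s) this

/-- Two sections which agree locally are equal. -/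
theorem sec_ext {U : Opens M} {s t : X.Sec U}
    (h : ∀ x ∈ U, ∃ (W : Opens M) (hW : W ≤ U), x ∈ W ∧ X.res hW s = X.res hW t) : s = t := by
  choose! W hW hx hs using h
  refine X.sheaf.eq_of_locally_eq' (fun x : U => W x) U (fun x => homOfLE (hW x x.2)) ?_ s t ?_
  · intro x hxU
    exact Opens.mem_iSup.2 ⟨⟨x, hxU⟩, hx x hxU⟩
  · intro x
    exact hs x x.2

/-- Over any open set, compatible sections glue. -/
theorem sec_glue {U : Opens M} (W : U → Opens M) (hW : ∀ x, W x ≤ U) (hx : ∀ x : U, x.1 ∈ W x)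
    (s : ∀ x, X.Sec (W x))
    (hs : ∀ x y, X.res (inf_le_left : W x ⊓ W y ≤ W x) (s x) =
      X.res (inf_le_right : W x ⊓ W y ≤ W y) (s y)) :
    ∃ t : X.Sec U, ∀ x, X.res (hW x) t = s x := by
  obtain ⟨t, ht, -⟩ := X.sheaf.existsUnique_gluing' W U (fun x => homOfLE (hW x))
    (fun x hxU => Opens.mem_iSup.2 ⟨⟨x, hxU⟩, hx ⟨x, hxU⟩⟩) s (fun x y => hs x y)
  exact ⟨t, ht⟩

/-- The presheaf ideal generated by the odd sections over `U`. -/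
def oddIdeal (U : Opens M) : Ideal (X.Sec U) := Ideal.span (X.odd U : Set (X.Sec U))

/-- Every section is the sum of an even and an odd one. -/
theorem exists_even_odd {U : Opens M} (s : X.Sec U) :
    ∃ a ∈ X.even U, ∃ b ∈ X.odd U, s = a + b := by
  have : s ∈ X.even U ⊔ X.odd U := by rw [(X.isCompl U).sup_eq_top]; trivial
  obtain ⟨a, ha, b, hb, h⟩ := Submodule.mem_sup.1 this
  exact ⟨a, ha, b, hb, h.symm⟩

instance (U : Opens M) : (X.oddIdeal U).IsTwoSided where
  mul_mem_of_left {a} b ha := by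
    unfold oddIdeal at *
    induction ha using Submodule.span_induction with
    | mem x hx =>
      obtain ⟨c, hc, d, hd, rfl⟩ := X.exists_even_odd b
      rw [mul_add, ← X.even_comm x hc, X.odd_anticomm hx hd, ← neg_mul]
      exact add_mem (Ideal.mul_mem_left _ _ (Ideal.subset_span hx))
        (Ideal.mul_mem_left _ _ (Ideal.subset_span hx))
    | zero => simp
    | add x y _ _ hx hy => rw [add_mul]; exact add_mem hx hy
    | smul c x _ hx => rw [smul_eq_mul, mul_assoc]; exact Ideal.mul_mem_left _ _ hx

theorem oddIdeal_le_comap {U W : Opens M} (h : W ≤ U) (k : ℕ) :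
    X.oddIdeal U ^ k ≤ (X.oddIdeal W ^ k).comap (X.res h) := by
  induction k with
  | zero => rw [Submodule.pow_zero, Submodule.pow_zero, Ideal.one_eq_top, Ideal.one_eq_top]; simp
  | succ k ih =>
    rw [Submodule.pow_succ, Submodule.pow_succ, Ideal.mul_le]
    intro r hr s hs
    rw [Ideal.mem_comap, map_mul]
    refine Ideal.mul_mem_mul (ih hr) ?_
    have h1 : X.oddIdeal U ≤ (X.oddIdeal W).comap (X.res h) := by
      rw [oddIdeal, Ideal.span_le]
      exact fun t ht => Ideal.subset_span (X.res_odd h ht)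
    exact h1 hs

/-- The sections over `U` of the `k`-th power `J ^ k` of the ideal sheaf `J` generated by the odd
functions. -/
def J (k : ℕ) (U : Opens M) : Ideal (X.Sec U) where
  carrier := {s | ∀ x ∈ U, ∃ (W : Opens M) (hW : W ≤ U), x ∈ W ∧ X.res hW s ∈ X.oddIdeal W ^ k}
  zero_mem' := fun x hx => ⟨U, le_rfl, hx, by simp⟩
  add_mem' := by
    intro a b ha hb x hx
    obtain ⟨W, hW, hxW, h⟩ := ha x hx
    obtain ⟨W', hW', hxW', h'⟩ := hb x hx
    refine ⟨W ⊓ W', inf_le_left.trans hW, ⟨hxW, hxW'⟩, ?_⟩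
    rw [map_add, ← X.res_res hW inf_le_left a, ← X.res_res hW' inf_le_right b]
    exact add_mem (X.oddIdeal_le_comap _ _ h) (X.oddIdeal_le_comap _ _ h')
  smul_mem' := by
    intro c a ha x hx
    obtain ⟨W, hW, hxW, h⟩ := ha x hx
    refine ⟨W, hW, hxW, ?_⟩
    rw [smul_eq_mul, map_mul]
    exact Ideal.mul_mem_left _ _ h

instance (k : ℕ) (U : Opens M) : (X.J k U).IsTwoSided where
  mul_mem_of_left {a} b ha := by
    intro x hx
    obtain ⟨W, hW, hxW, h⟩ := ha x hx
    refine ⟨W, hW, hxW, ?_⟩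
    rw [map_mul]
    exact Ideal.mul_mem_right _ _ h

theorem J_le_comap {U W : Opens M} (h : W ≤ U) (k : ℕ) :
    X.J k U ≤ (X.J k W).comap (X.res h) := by
  intro s hs x hx
  obtain ⟨T, hT, hxT, hsT⟩ := hs x (h hx)
  refine ⟨T ⊓ W, inf_le_right, ⟨hxT, hx⟩, ?_⟩
  have := X.oddIdeal_le_comap (inf_le_left : T ⊓ W ≤ T) k hsT
  rw [Ideal.mem_comap, X.res_res] at this
  rwa [X.res_res]

/-- The sums of an even and an odd element of an ideal. -/
def homPart {U : Opens M} (I : Ideal (X.Sec U)) : Ideal (X.Sec U) where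
  carrier := {s | ∃ a ∈ X.even U, ∃ b ∈ X.odd U, a ∈ I ∧ b ∈ I ∧ s = a + b}
  zero_mem' := ⟨0, zero_mem _, 0, zero_mem _, zero_mem _, zero_mem _, by simp⟩
  add_mem' := by
    rintro _ _ ⟨a, ha, b, hb, ha', hb', rfl⟩ ⟨c, hc, d, hd, hc', hd', rfl⟩
    exact ⟨a + c, add_mem ha hc, b + d, add_mem hb hd, add_mem ha' hc', add_mem hb' hd', by abel⟩
  smul_mem' := by
    rintro r _ ⟨a, ha, b, hb, ha', hb', rfl⟩
    obtain ⟨c, hc, d, hd, rfl⟩ := X.exists_even_odd r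
    refine ⟨c * a + d * b, add_mem (X.even_mul_even hc ha) (X.odd_mul_odd hd hb),
      c * b + d * a, add_mem (X.even_mul_odd hc hb) ?_,
      add_mem (I.mul_mem_left _ ha') (I.mul_mem_left _ hb'),
      add_mem (I.mul_mem_left _ hb') (I.mul_mem_left _ ha'), ?_⟩
    · rw [← X.even_comm d ha]; exact X.even_mul_odd ha hd
    · rw [smul_eq_mul]; noncomm_ring

theorem oddIdeal_pow_le_homPart (U : Opens M) (k : ℕ) :
    X.oddIdeal U ^ k ≤ X.homPart (X.oddIdeal U ^ k) := by
  induction k with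
  | zero =>
    intro s _
    obtain ⟨a, ha, b, hb, rfl⟩ := X.exists_even_odd s
    exact ⟨a, ha, b, hb, by rw [Submodule.pow_zero, Ideal.one_eq_top]; trivial,
      by rw [Submodule.pow_zero, Ideal.one_eq_top]; trivial, rfl⟩
  | succ k ih =>
    have h1 : X.oddIdeal U ≤ X.homPart (X.oddIdeal U) := by
      conv_lhs => rw [oddIdeal]
      rw [Ideal.span_le]
      exact fun s hs => ⟨0, zero_mem _, s, hs, zero_mem _, Ideal.subset_span hs, by simp⟩
    conv_lhs => rw [Submodule.pow_succ]
    rw [Ideal.mul_le]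
    intro r hr s hs
    obtain ⟨a, ha, b, hb, ha', hb', rfl⟩ := ih hr
    obtain ⟨c, hc, d, hd, hc', hd', rfl⟩ := h1 hs
    rw [Submodule.pow_succ]
    refine ⟨a * c + b * d, add_mem (X.even_mul_even ha hc) (X.odd_mul_odd hb hd),
      a * d + b * c, add_mem (X.even_mul_odd ha hd) ?_,
      add_mem (Ideal.mul_mem_mul ha' hc') (Ideal.mul_mem_mul hb' hd'),
      add_mem (Ideal.mul_mem_mul ha' hd') (Ideal.mul_mem_mul hb' hc'), ?_⟩
    · rw [← X.even_comm b hc]; exact X.even_mul_odd hc hb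
    · noncomm_ring

theorem even_odd_unique {U : Opens M} {a b c d : X.Sec U} (ha : a ∈ X.even U) (hb : b ∈ X.odd U)
    (hc : c ∈ X.even U) (hd : d ∈ X.odd U) (h : a + b = c + d) : a = c ∧ b = d := by
  have h1 : a - c = d - b := by rw [sub_eq_sub_iff_add_eq_add, h, add_comm]
  have h2 : a - c = 0 := by
    have := (X.isCompl U).disjoint.le_bot
      ⟨(sub_mem ha hc : a - c ∈ X.even U), h1 ▸ (sub_mem hd hb : d - b ∈ X.odd U)⟩
    simpa using this
  exact ⟨sub_eq_zero.1 h2, (sub_eq_zero.1 (h1 ▸ h2)).symm⟩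

/-- The ideals `J ^ k` are homogeneous. -/
theorem J_homogeneous {U : Opens M} {k : ℕ} {a b : X.Sec U} (ha : a ∈ X.even U)
    (hb : b ∈ X.odd U) (h : a + b ∈ X.J k U) : a ∈ X.J k U ∧ b ∈ X.J k U := by
  have key : ∀ x ∈ U, ∃ (W : Opens M) (hW : W ≤ U), x ∈ W ∧ X.res hW a ∈ X.oddIdeal W ^ k ∧
      X.res hW b ∈ X.oddIdeal W ^ k := by
    intro x hx
    obtain ⟨W, hW, hxW, hs⟩ := h x hx
    obtain ⟨c, hc, d, hd, hc', hd', e⟩ := X.oddIdeal_pow_le_homPart W k hs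
    rw [map_add] at e
    obtain ⟨rfl, rfl⟩ := X.even_odd_unique (X.res_even hW ha) (X.res_odd hW hb) hc hd e
    exact ⟨W, hW, hxW, hc', hd'⟩
  constructor
  · intro x hx
    obtain ⟨W, hW, hxW, h, -⟩ := key x hx
    exact ⟨W, hW, hxW, h⟩
  · intro x hx
    obtain ⟨W, hW, hxW, -, h⟩ := key x hx
    exact ⟨W, hW, hxW, h⟩

theorem J_of_locally {U : Opens M} {k : ℕ} {s : X.Sec U}
    (h : ∀ x ∈ U, ∃ (W : Opens M) (hW : W ≤ U), x ∈ W ∧ X.res hW s ∈ X.J k W) : s ∈ X.J k U := by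
  intro x hx
  obtain ⟨W, hW, hxW, hs⟩ := h x hx
  obtain ⟨T, hT, hxT, hs'⟩ := hs x hxW
  exact ⟨T, hT.trans hW, hxT, by rwa [X.res_res] at hs'⟩

/-- The presheaf `U ↦ O(U) / J ^ k (U)`. -/
def quotPresheaf (k : ℕ) : (Opens M)ᵒᵖ ⥤ AlgCat.{u} 𝕜 where
  obj U := AlgCat.of 𝕜 (X.Sec U.unop ⧸ X.J k U.unop)
  map {U W} f := AlgCat.ofHom
    (Ideal.quotientMapₐ (X.J k W.unop) (X.res (leOfHom f.unop)) (X.J_le_comap _ k))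
  map_id U := by
    ext s
    obtain ⟨s, rfl⟩ := Ideal.Quotient.mk_surjective s
    exact congrArg (Ideal.Quotient.mk (X.J k U.unop)) (X.res_self s)
  map_comp {U W T} f g := by
    ext s
    obtain ⟨s, rfl⟩ := Ideal.Quotient.mk_surjective s
    exact congrArg (Ideal.Quotient.mk (X.J k T.unop))
      (X.res_res (leOfHom f.unop) (leOfHom g.unop) s).symm

/-- The quotient sheaf `O / J ^ k`. -/
def quotSheaf (k : ℕ) : (Opens M)ᵒᵖ ⥤ AlgCat.{u} 𝕜 :=
  sheafify (Opens.grothendieckTopology M) (X.quotPresheaf k)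

theorem quotSheaf_isSheaf (k : ℕ) :
    TopCat.Presheaf.IsSheaf (X := TopCat.of M) (X.quotSheaf k) :=
  ((presheafToSheaf (Opens.grothendieckTopology M) (AlgCat.{u} 𝕜)).obj (X.quotPresheaf k)).property

/-- The quotient map `O → O / J ^ k` on sections. -/
def toQuot (k : ℕ) (U : Opens M) : X.Sec U →ₐ[𝕜] (X.quotSheaf k).obj (op U) :=
  ((toSheafify (Opens.grothendieckTopology M) (X.quotPresheaf k)).app (op U)).hom.comp
    (Ideal.Quotient.mkₐ 𝕜 (X.J k U))

/-- Restriction of sections of the quotient sheaf. -/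
def quotRes (k : ℕ) {U W : Opens M} (h : W ≤ U) :
    (X.quotSheaf k).obj (op U) →ₐ[𝕜] (X.quotSheaf k).obj (op W) :=
  ((X.quotSheaf k).map (homOfLE h).op).hom

theorem toQuot_res (k : ℕ) {U W : Opens M} (h : W ≤ U) (s : X.Sec U) :
    X.toQuot k W (X.res h s) = X.quotRes k h (X.toQuot k U s) := by
  have := (toSheafify (Opens.grothendieckTopology M) (X.quotPresheaf k)).naturality
    (homOfLE h).op
  exact congrArg (fun f => f.hom (Ideal.Quotient.mk (X.J k U) s)) this

theorem quotRes_quotRes (k : ℕ) {U W T : Opens M} (h : W ≤ U) (h' : T ≤ W)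
    (s : (X.quotSheaf k).obj (op U)) :
    X.quotRes k h' (X.quotRes k h s) = X.quotRes k (h'.trans h) s := by
  have := (X.quotSheaf k).map_comp (homOfLE h).op (homOfLE h').op
  exact (congrArg (fun f => f.hom s) this).symm

theorem quot_ext (k : ℕ) {U : Opens M} {s t : (X.quotSheaf k).obj (op U)}
    (h : ∀ x ∈ U, ∃ (W : Opens M) (hW : W ≤ U), x ∈ W ∧ X.quotRes k hW s = X.quotRes k hW t) :
    s = t := by
  choose! W hW hx hs using h
  refine TopCat.Sheaf.eq_of_locally_eq' (X := TopCat.of M)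
    ⟨X.quotSheaf k, X.quotSheaf_isSheaf k⟩ (fun x : U => W x) U (fun x => homOfLE (hW x x.2))
    ?_ s t ?_
  · intro x hxU
    exact Opens.mem_iSup.2 ⟨⟨x, hxU⟩, hx x hxU⟩
  · intro x
    exact hs x x.2

/-- Sections of the quotient sheaf lift locally. -/
theorem exists_toQuot (k : ℕ) {U : Opens M} (s : (X.quotSheaf k).obj (op U)) (x : M)
    (hx : x ∈ U) : ∃ (W : Opens M) (hW : W ≤ U), x ∈ W ∧
      ∃ t : X.Sec W, X.toQuot k W t = X.quotRes k hW s := by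
  obtain ⟨W, f, ⟨t, ht⟩, hxW⟩ := Presheaf.imageSieve_mem
    (Opens.grothendieckTopology M)
    (toSheafify (Opens.grothendieckTopology M) (X.quotPresheaf k)) s x hx
  obtain ⟨t, rfl⟩ := Ideal.Quotient.mk_surjective t
  exact ⟨W, leOfHom f, hxW, t, ht⟩

/-- The kernel of the quotient map is `J ^ k`. -/
theorem toQuot_eq_zero_iff (k : ℕ) {U : Opens M} (s : X.Sec U) :
    X.toQuot k U s = 0 ↔ s ∈ X.J k U := by
  constructor
  · intro h
    refine X.J_of_locally fun x hx => ?_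
    have h' : (toSheafify (Opens.grothendieckTopology M) (X.quotPresheaf k)).app (op U)
        (Ideal.Quotient.mk (X.J k U) s) =
        (toSheafify (Opens.grothendieckTopology M) (X.quotPresheaf k)).app (op U)
        (0 : X.Sec U ⧸ X.J k U) := by
      exact h.trans (map_zero _).symm
    obtain ⟨W, f, hf, hxW⟩ := Presheaf.equalizerSieve_mem
      (Opens.grothendieckTopology M) _ _ _ h' x hx
    refine ⟨W, leOfHom f, hxW, ?_⟩
    rw [← Ideal.Quotient.eq_zero_iff_mem]
    exact hf.trans (map_zero _)
  · intro h
    have : Ideal.Quotient.mkₐ 𝕜 (X.J k U) s = 0 := Ideal.Quotient.eq_zero_iff_mem.2 h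
    exact (congrArg ((toSheafify (Opens.grothendieckTopology M)
      (X.quotPresheaf k)).app (op U)).hom this).trans (map_zero _)

theorem toQuot_eq_iff (k : ℕ) {U : Opens M} (s t : X.Sec U) :
    X.toQuot k U s = X.toQuot k U t ↔ s - t ∈ X.J k U := by
  rw [← toQuot_eq_zero_iff, map_sub, sub_eq_zero]

/-- The sections of `O / J ^ k` over `U` which locally lift to sections in `A`. -/
def quotSub (k : ℕ) (A : ∀ U : Opens M, Submodule 𝕜 (X.Sec U))
    (hA : ∀ {U W : Opens M} (h : W ≤ U) {s : X.Sec U}, s ∈ A U → X.res h s ∈ A W)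
    (U : Opens M) : Submodule 𝕜 ((X.quotSheaf k).obj (op U)) where
  carrier := {s | ∀ x ∈ U, ∃ (W : Opens M) (hW : W ≤ U), x ∈ W ∧
    ∃ t ∈ A W, X.toQuot k W t = X.quotRes k hW s}
  zero_mem' := fun x hx => ⟨U, le_rfl, hx, 0, zero_mem _, by simp⟩
  add_mem' := by
    intro a b ha hb x hx
    obtain ⟨W, hW, hxW, s, hs, e⟩ := ha x hx
    obtain ⟨W', hW', hxW', s', hs', e'⟩ := hb x hx
    refine ⟨W ⊓ W', inf_le_left.trans hW, ⟨hxW, hxW'⟩, X.res inf_le_left s + X.res inf_le_right s',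
      add_mem (hA _ hs) (hA _ hs'), ?_⟩
    rw [map_add, map_add, toQuot_res, toQuot_res, e, e', quotRes_quotRes, quotRes_quotRes]
  smul_mem' := by
    intro c a ha x hx
    obtain ⟨W, hW, hxW, s, hs, e⟩ := ha x hx
    exact ⟨W, hW, hxW, c • s, Submodule.smul_mem _ _ hs, by rw [map_smul, map_smul, e]⟩

/-- Local lifts of two sections of the quotient sheaf over a common neighbourhood. -/
theorem exists_common (k : ℕ) (A B : ∀ U : Opens M, Submodule 𝕜 (X.Sec U))
    (hA : ∀ {U W : Opens M} (h : W ≤ U) {s : X.Sec U}, s ∈ A U → X.res h s ∈ A W)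
    (hB : ∀ {U W : Opens M} (h : W ≤ U) {s : X.Sec U}, s ∈ B U → X.res h s ∈ B W)
    {U : Opens M} {a b : (X.quotSheaf k).obj (op U)} (ha : a ∈ X.quotSub k A hA U)
    (hb : b ∈ X.quotSub k B hB U) (x : M) (hx : x ∈ U) :
    ∃ (W : Opens M) (hW : W ≤ U), x ∈ W ∧ ∃ s ∈ A W, ∃ t ∈ B W,
      X.toQuot k W s = X.quotRes k hW a ∧ X.toQuot k W t = X.quotRes k hW b := by
  obtain ⟨W, hW, hxW, s, hs, e⟩ := ha x hx
  obtain ⟨W', hW', hxW', s', hs', e'⟩ := hb x hx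
  refine ⟨W ⊓ W', inf_le_left.trans hW, ⟨hxW, hxW'⟩, X.res inf_le_left s, hA _ hs,
    X.res inf_le_right s', hB _ hs', ?_, ?_⟩
  · rw [toQuot_res, e, quotRes_quotRes]
  · rw [toQuot_res, e', quotRes_quotRes]

theorem quotSub_mul (k : ℕ) (A B C : ∀ U : Opens M, Submodule 𝕜 (X.Sec U))
    (hA : ∀ {U W : Opens M} (h : W ≤ U) {s : X.Sec U}, s ∈ A U → X.res h s ∈ A W)
    (hB : ∀ {U W : Opens M} (h : W ≤ U) {s : X.Sec U}, s ∈ B U → X.res h s ∈ B W)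
    (hC : ∀ {U W : Opens M} (h : W ≤ U) {s : X.Sec U}, s ∈ C U → X.res h s ∈ C W)
    (hmul : ∀ {U : Opens M} {a b : X.Sec U}, a ∈ A U → b ∈ B U → a * b ∈ C U)
    {U : Opens M} {a b : (X.quotSheaf k).obj (op U)} (ha : a ∈ X.quotSub k A hA U)
    (hb : b ∈ X.quotSub k B hB U) : a * b ∈ X.quotSub k C hC U := by
  intro x hx
  obtain ⟨W, hW, hxW, s, hs, t, ht, e, e'⟩ := X.exists_common k A B hA hB ha hb x hx
  exact ⟨W, hW, hxW, s * t, hmul hs ht, by rw [map_mul, map_mul, e, e']⟩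

theorem quotSub_res (k : ℕ) (A : ∀ U : Opens M, Submodule 𝕜 (X.Sec U))
    (hA : ∀ {U W : Opens M} (h : W ≤ U) {s : X.Sec U}, s ∈ A U → X.res h s ∈ A W)
    {U W : Opens M} (h : W ≤ U) {a : (X.quotSheaf k).obj (op U)} (ha : a ∈ X.quotSub k A hA U) :
    X.quotRes k h a ∈ X.quotSub k A hA W := by
  intro x hx
  obtain ⟨T, hT, hxT, s, hs, e⟩ := ha x (h hx)
  refine ⟨T ⊓ W, inf_le_right, ⟨hxT, hx⟩, X.res inf_le_left s, hA _ hs, ?_⟩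
  rw [toQuot_res, e, quotRes_quotRes, quotRes_quotRes]

/-- A section of the quotient sheaf is the sum of an even and an odd one. -/
theorem quotSub_isCompl (k : ℕ) (U : Opens M) :
    IsCompl (X.quotSub k X.even X.res_even U) (X.quotSub k X.odd X.res_odd U) := by
  constructor
  · rw [Submodule.disjoint_def]
    intro s h0 h1
    refine X.quot_ext k fun x hx => ?_
    obtain ⟨W, hW, hxW, a, ha, b, hb, e, e'⟩ :=
      X.exists_common k X.even X.odd X.res_even X.res_odd h0 h1 x hx
    refine ⟨W, hW, hxW, ?_⟩
    have h2 : a + -b ∈ X.J k W := by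
      rw [← sub_eq_add_neg, ← toQuot_eq_iff, e, e']
    have h3 := (X.J_homogeneous ha (neg_mem hb) h2).1
    rw [map_zero, ← e, (X.toQuot_eq_zero_iff k a).2 h3]
  · rw [codisjoint_iff, Submodule.eq_top_iff']
    intro s
    have h1 : ∀ x : U, ∃ (W : Opens M) (hW : W ≤ U), x.1 ∈ W ∧ ∃ a ∈ X.even W, ∃ b ∈ X.odd W,
        X.toQuot k W (a + b) = X.quotRes k hW s := by
      intro x
      obtain ⟨W, hW, hxW, t, ht⟩ := X.exists_toQuot k s x x.2
      obtain ⟨a, ha, b, hb, rfl⟩ := X.exists_even_odd t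
      exact ⟨W, hW, hxW, a, ha, b, hb, ht⟩
    choose W hW hxW a ha b hb e using h1
    have hcompat : ∀ x y, X.quotRes k (inf_le_left : W x ⊓ W y ≤ W x) (X.toQuot k _ (a x)) =
        X.quotRes k (inf_le_right : W x ⊓ W y ≤ W y) (X.toQuot k _ (a y)) := by
      intro x y
      rw [← toQuot_res, ← toQuot_res, toQuot_eq_iff]
      have h2 : X.toQuot k (W x ⊓ W y) (X.res inf_le_left (a x + b x)) =
          X.toQuot k (W x ⊓ W y) (X.res inf_le_right (a y + b y)) := by
        rw [toQuot_res, toQuot_res, e, e, quotRes_quotRes, quotRes_quotRes]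
      rw [toQuot_eq_iff, map_add, map_add, add_sub_add_comm] at h2
      exact (X.J_homogeneous (sub_mem (X.res_even _ (ha x)) (X.res_even _ (ha y)))
        (sub_mem (X.res_odd _ (hb x)) (X.res_odd _ (hb y))) h2).1
    obtain ⟨s0, hs0, -⟩ := TopCat.Sheaf.existsUnique_gluing' (X := TopCat.of M)
      ⟨X.quotSheaf k, X.quotSheaf_isSheaf k⟩ W U (fun x => homOfLE (hW x))
      (fun x hxU => Opens.mem_iSup.2 ⟨⟨x, hxU⟩, hxW ⟨x, hxU⟩⟩) (fun x => X.toQuot k _ (a x))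
      (fun x y => hcompat x y)
    have hs0' : ∀ x, X.quotRes k (hW x) s0 = X.toQuot k _ (a x) := hs0
    refine Submodule.mem_sup.2 ⟨s0, ?_, s - s0, ?_, by abel⟩
    · exact fun x hx => ⟨W ⟨x, hx⟩, hW _, hxW _, a _, ha _, (hs0' _).symm⟩
    · refine fun x hx => ⟨W ⟨x, hx⟩, hW _, hxW _, b _, hb _, ?_⟩
      rw [map_sub, hs0', ← e, map_add, add_sub_cancel_left]

/-- The sheaf of superalgebras `O / J ^ k`, with the induced grading. -/
def quot (k : ℕ) : SuperSheaf 𝕜 M where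
  presheaf := X.quotSheaf k
  isSheaf := X.quotSheaf_isSheaf k
  even := X.quotSub k X.even X.res_even
  odd := X.quotSub k X.odd X.res_odd
  isCompl := X.quotSub_isCompl k
  res_even := X.quotSub_res k X.even X.res_even
  res_odd := X.quotSub_res k X.odd X.res_odd
  one_mem U := fun x hx => ⟨U, le_rfl, hx, 1, X.one_mem U, by rw [map_one, map_one]⟩
  even_mul_even := X.quotSub_mul k _ _ _ X.res_even X.res_even X.res_even X.even_mul_even
  even_mul_odd := X.quotSub_mul k _ _ _ X.res_even X.res_odd X.res_odd X.even_mul_odd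
  odd_mul_odd := X.quotSub_mul k _ _ _ X.res_odd X.res_odd X.res_even X.odd_mul_odd
  even_comm {U a} b ha := by
    refine X.quot_ext k fun x hx => ?_
    obtain ⟨W, hW, hxW, s, hs, e⟩ := ha x hx
    obtain ⟨W', hW', hxW', t, e'⟩ := X.exists_toQuot k b x hx
    refine ⟨W ⊓ W', inf_le_left.trans hW, ⟨hxW, hxW'⟩, ?_⟩
    have e1 : X.quotRes k (inf_le_left.trans hW : W ⊓ W' ≤ U) a =
        X.toQuot k _ (X.res inf_le_left s) := by rw [toQuot_res, e, quotRes_quotRes]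
    have e2 : X.quotRes k (inf_le_left.trans hW : W ⊓ W' ≤ U) b =
        X.toQuot k _ (X.res inf_le_right t) := by rw [toQuot_res, e', quotRes_quotRes]
    rw [map_mul, map_mul, e1, e2, ← map_mul, ← map_mul]
    exact congrArg _ (X.even_comm _ (X.res_even _ hs))
  odd_anticomm {U a b} ha hb := by
    refine X.quot_ext k fun x hx => ?_
    obtain ⟨W, hW, hxW, s, hs, t, ht, e, e'⟩ :=
      X.exists_common k X.odd X.odd X.res_odd X.res_odd ha hb x hx
    refine ⟨W, hW, hxW, ?_⟩
    rw [map_neg, map_mul, map_mul, ← e, ← e', ← map_mul, ← map_mul, ← map_neg,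
      X.odd_anticomm hs ht]

/-- A morphism of sheaves of superalgebras. -/
structure Hom (X Y : SuperSheaf 𝕜 M) where
  /-- the maps on sections -/
  app (U : Opens M) : X.Sec U →ₐ[𝕜] Y.Sec U
  app_res {U W : Opens M} (h : W ≤ U) (s : X.Sec U) : app W (X.res h s) = Y.res h (app U s)
  app_even {U : Opens M} {s : X.Sec U} : s ∈ X.even U → app U s ∈ Y.even U
  app_odd {U : Opens M} {s : X.Sec U} : s ∈ X.odd U → app U s ∈ Y.odd U

/-- An isomorphism `X|_U ≅ Y|_U` of sheaves of superalgebras. -/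
structure IsoOn (U : Opens M) (X Y : SuperSheaf 𝕜 M) where
  /-- the isomorphisms on sections -/
  app (W : Opens M) (hW : W ≤ U) : X.Sec W ≃ₐ[𝕜] Y.Sec W
  app_res {W T : Opens M} (hW : W ≤ U) (h : T ≤ W) (s : X.Sec W) :
    app T (h.trans hW) (X.res h s) = Y.res h (app W hW s)
  app_even {W : Opens M} (hW : W ≤ U) {s : X.Sec W} : s ∈ X.even W → app W hW s ∈ Y.even W
  app_odd {W : Opens M} (hW : W ≤ U) {s : X.Sec W} : s ∈ X.odd W → app W hW s ∈ Y.odd W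

/-- `X` and `Y` are isomorphic as sheaves of superalgebras on `M`. -/
def IsIso (X Y : SuperSheaf 𝕜 M) : Prop := Nonempty (IsoOn ⊤ X Y)

/-- The quotient morphism `O → O / J ^ k`. -/
def quotHom (k : ℕ) : Hom X (X.quot k) where
  app U := X.toQuot k U
  app_res h s := X.toQuot_res k h s
  app_even {U s} hs := fun x hx => ⟨U, le_rfl, hx, s, hs, by
    have h := X.toQuot_res k le_rfl s
    rw [X.res_self] at h
    exact h⟩
  app_odd {U s} hs := fun x hx => ⟨U, le_rfl, hx, s, hs, by
    have h := X.toQuot_res k le_rfl s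
    rw [X.res_self] at h
    exact h⟩

/-- For `S = (M, O)`, the structure sheaf `O / J ^ (i + 1)` of the subspace `S^(i)`. In particular
`X.trunc 0` is the structure sheaf `O / J` of the reduced space. -/
def trunc (i : ℕ) : SuperSheaf 𝕜 M := X.quot (i + 1)

/-- `S` is projected: the projection `O → O / J` onto the structure sheaf of the reduced space has
a right inverse which is a morphism of sheaves of superalgebras `O / J → O`. -/
def IsProjected : Prop :=
  ∃ σ : Hom (X.trunc 0) X, ∀ (U : Opens M) (s : (X.trunc 0).Sec U),
    (X.quotHom 1).app U (σ.app U s) = s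

/-- Even sections of `J` are sections of `J ^ 2`. -/
theorem even_mem_J_two {U : Opens M} {s : X.Sec U} (hs : s ∈ X.even U) (h : s ∈ X.J 1 U) :
    s ∈ X.J 2 U := by
  intro x hx
  obtain ⟨W, hW, hxW, h⟩ := h x hx
  refine ⟨W, hW, hxW, ?_⟩
  have h1 : ∀ t ∈ X.oddIdeal W, ∃ a ∈ X.even W, ∃ b ∈ X.odd W, a ∈ X.oddIdeal W ^ 2 ∧
      t = a + b := by
    intro t ht
    unfold oddIdeal at ht
    induction ht using Submodule.span_induction with
    | mem x hx => exact ⟨0, zero_mem _, x, hx, zero_mem _, by simp⟩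
    | zero => exact ⟨0, zero_mem _, 0, zero_mem _, zero_mem _, by simp⟩
    | add x y _ _ hx hy =>
      obtain ⟨a, ha, b, hb, ha', rfl⟩ := hx
      obtain ⟨c, hc, d, hd, hc', rfl⟩ := hy
      exact ⟨a + c, add_mem ha hc, b + d, add_mem hb hd, add_mem ha' hc', by abel⟩
    | smul r x _ hx =>
      obtain ⟨a, ha, b, hb, ha', rfl⟩ := hx
      obtain ⟨c, hc, d, hd, rfl⟩ := X.exists_even_odd r
      refine ⟨c * a + d * b, add_mem (X.even_mul_even hc ha) (X.odd_mul_odd hd hb),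
        c * b + d * a, add_mem (X.even_mul_odd hc hb) ?_, add_mem (Ideal.mul_mem_left _ _ ha') ?_,
        ?_⟩
      · rw [← X.even_comm d ha]; exact X.even_mul_odd ha hd
      · rw [Submodule.pow_succ, Submodule.pow_one]
        exact Ideal.mul_mem_mul (Ideal.subset_span hd) (Ideal.subset_span hb)
      · rw [smul_eq_mul]; noncomm_ring
  rw [Submodule.pow_one] at h
  obtain ⟨a, ha, b, hb, ha', e⟩ := h1 _ h
  have := X.even_odd_unique (X.res_even hW hs) (zero_mem _) ha hb (by rw [add_zero]; exact e)
  have e2 : X.res hW s = a := this.1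
  rwa [e2]

namespace IsoOn

variable {X Y} {Z : SuperSheaf 𝕜 M} {U : Opens M}

theorem symm_app_even (f : IsoOn U X Y) {W : Opens M} (hW : W ≤ U) {s : Y.Sec W}
    (hs : s ∈ Y.even W) : (f.app W hW).symm s ∈ X.even W := by
  obtain ⟨a, ha, b, hb, e⟩ := X.exists_even_odd ((f.app W hW).symm s)
  have e' : s + 0 = f.app W hW a + f.app W hW b := by
    rw [← map_add, ← e, AlgEquiv.apply_symm_apply, add_zero]
  have := (Y.even_odd_unique hs (zero_mem _) (f.app_even hW ha) (f.app_odd hW hb) e').1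
  rw [this, AlgEquiv.symm_apply_apply]
  exact ha

theorem symm_app_odd (f : IsoOn U X Y) {W : Opens M} (hW : W ≤ U) {s : Y.Sec W}
    (hs : s ∈ Y.odd W) : (f.app W hW).symm s ∈ X.odd W := by
  obtain ⟨a, ha, b, hb, e⟩ := X.exists_even_odd ((f.app W hW).symm s)
  have e' : 0 + s = f.app W hW a + f.app W hW b := by
    rw [← map_add, ← e, AlgEquiv.apply_symm_apply, zero_add]
  have := (Y.even_odd_unique (zero_mem _) hs (f.app_even hW ha) (f.app_odd hW hb) e').2
  rw [this, AlgEquiv.symm_apply_apply]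
  exact hb

/-- The transition automorphism `f ∘ g⁻¹` of `Y|_T`, for isomorphisms `f : X|_U ≅ Y|_U` and
`g : X|_U' ≅ Y|_U'` and `T` contained in both `U` and `U'`. -/
def trans {U' T : Opens M} (f : IsoOn U X Y) (g : IsoOn U' X Y) (h : T ≤ U) (h' : T ≤ U') :
    IsoOn T Y Y where
  app W hW := (g.app W (hW.trans h')).symm.trans (f.app W (hW.trans h))
  app_res {W S} hW hS s := by
    have : X.res hS ((g.app W (hW.trans h')).symm s) =
        (g.app S ((hS.trans hW).trans h')).symm (Y.res hS s) := by
      rw [AlgEquiv.eq_symm_apply, g.app_res (hW.trans h') hS, AlgEquiv.apply_symm_apply]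
    rw [AlgEquiv.trans_apply, AlgEquiv.trans_apply, ← this]
    exact f.app_res (hW.trans h) hS _
  app_even hW _ hs := f.app_even _ (g.symm_app_even _ hs)
  app_odd hW _ hs := f.app_odd _ (g.symm_app_odd _ hs)

/-- The automorphism `g` of `X|_U` acts as the identity on `Gr_J(O) = ⨁ J ^ k / J ^ (k + 1)`. -/
def ActsTriviallyOnGr (g : IsoOn U X X) : Prop :=
  ∀ (k : ℕ) (W : Opens M) (hW : W ≤ U), ∀ s ∈ X.J k W, g.app W hW s - s ∈ X.J (k + 1) W

end IsoOn

theorem mem_J_zero {U : Opens M} (s : X.Sec U) : s ∈ X.J 0 U :=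
  fun _ hx => ⟨U, le_rfl, hx, by rw [Submodule.pow_zero, Ideal.one_eq_top]; trivial⟩

end Basic
end SuperSheaf

/-! ### Vector bundles and split models -/

section Models

open Bundle

/-- The model space `𝕜^m`. -/
abbrev Std (𝕜 : Type) [RCLike 𝕜] (m : ℕ) : Type := EuclideanSpace 𝕜 (Fin m)

variable (𝕜 : Type) [RCLike 𝕜] (n : WithTop ℕ∞) (m q : ℕ)

/-- A `C^n` vector bundle of rank `q` over the `C^n` manifold `M` modelled on `𝕜^m`. -/
structure VecBundle (M : Type u) [TopologicalSpace M] [ChartedSpace (Std 𝕜 m) M] where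
  /-- the fibres -/
  fiber : M → Type
  [addCommGroup : ∀ x, AddCommGroup (fiber x)]
  [module : ∀ x, Module 𝕜 (fiber x)]
  [topTotal : TopologicalSpace (TotalSpace (Std 𝕜 q) fiber)]
  [topFiber : ∀ x, TopologicalSpace (fiber x)]
  [fiberBundle : FiberBundle (Std 𝕜 q) fiber]
  [vectorBundle : VectorBundle 𝕜 (Std 𝕜 q) fiber]
  [contMDiff : ContMDiffVectorBundle n (Std 𝕜 q) fiber 𝓘(𝕜, Std 𝕜 m)]

namespace VecBundle

attribute [instance] addCommGroup module topTotal topFiber fiberBundle vectorBundle contMDiff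

variable {𝕜 m} (M : Type u) [TopologicalSpace M] [ChartedSpace (Std 𝕜 m) M]

/-- The trivial bundle of rank `q`. -/
def trivial : VecBundle 𝕜 n m q M where
  fiber := Bundle.Trivial M (Std 𝕜 q)
  addCommGroup := fun _ => inferInstanceAs (AddCommGroup (Std 𝕜 q))

variable {n q M} (V : VecBundle 𝕜 n m q M)

/-- The fibre at `x` of the exterior algebra bundle `⋀ V^∨`. -/
abbrev Ext (x : M) : Type := ExteriorAlgebra 𝕜 (Module.Dual 𝕜 (V.fiber x))

/-- The typical fibre of the exterior algebra bundle. -/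
abbrev StdExt (𝕜 : Type) [RCLike 𝕜] (q : ℕ) : Type :=
  ExteriorAlgebra 𝕜 (Module.Dual 𝕜 (Std 𝕜 q))

/-- The map `⋀ V_y^∨ → ⋀ (𝕜^q)^∨` induced by the preferred trivialization of `V` at `x`; an
isomorphism if `y` is close to `x`. -/
def coord (x y : M) : V.Ext y →ₐ[𝕜] StdExt 𝕜 q :=
  ExteriorAlgebra.map ((trivializationAt (Std 𝕜 q) V.fiber x).symmL 𝕜 y).toLinearMap.dualMap

/-- `a : M → ⋀ (𝕜^q)^∨` is of class `C^n` at `x`, i.e. all of its coordinates are. -/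
def SmoothAt {𝕜 : Type} [RCLike 𝕜] {q : ℕ} {M : Type u} [TopologicalSpace M] (n : WithTop ℕ∞)
    (m : ℕ) [ChartedSpace (Std 𝕜 m) M] (a : M → StdExt 𝕜 q) (x : M) : Prop :=
  ∀ ℓ : Module.Dual 𝕜 (StdExt 𝕜 q), ContMDiffAt 𝓘(𝕜, Std 𝕜 m) 𝓘(𝕜, 𝕜) n (fun y => ℓ (a y)) x

/-- The section `s` of `⋀ V^∨` over `U` is of class `C^n` at `x`: near `x`, it is given in the
trivialization at `x` by a function of class `C^n` at `x`. -/
def RegularAt {U : Opens M} (s : ∀ y : U, V.Ext y) (x : M) : Prop :=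
  ∃ a : M → StdExt 𝕜 q, SmoothAt n m a x ∧
    ∀ᶠ y in 𝓝 x, ∀ hy : y ∈ U, V.coord x y (s ⟨y, hy⟩) = a y

instance : Module.Finite 𝕜 (StdExt 𝕜 q) :=
  Module.Finite.of_basis (Module.finBasis 𝕜 (Module.Dual 𝕜 (Std 𝕜 q))).ExteriorAlgebra

theorem SmoothAt.add {a b : M → StdExt 𝕜 q} {x : M} (ha : SmoothAt n m a x) (hb : SmoothAt n m b x) :
    SmoothAt n m (fun y => a y + b y) x := by
  intro ℓ
  simp only [map_add]
  exact (ha ℓ).add (hb ℓ)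

theorem SmoothAt.const (c : StdExt 𝕜 q) (x : M) : SmoothAt n m (fun _ : M => c) x :=
  fun _ => contMDiffAt_const

theorem SmoothAt.linear {a : M → StdExt 𝕜 q} {x : M} (ha : SmoothAt n m a x)
    (f : StdExt 𝕜 q →ₗ[𝕜] StdExt 𝕜 q) : SmoothAt n m (fun y => f (a y)) x :=
  fun ℓ => ha (ℓ ∘ₗ f)

theorem SmoothAt.mul {a b : M → StdExt 𝕜 q} {x : M} (ha : SmoothAt n m a x) (hb : SmoothAt n m b x) :
    SmoothAt n m (fun y => a y * b y) x := by
  intro ℓ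
  let B := Module.finBasis 𝕜 (StdExt 𝕜 q)
  have h : (fun y => ℓ (a y * b y)) = fun y => ∑ i, ∑ j,
      (B.coord i (a y) * B.coord j (b y)) • ℓ (B i * B j) := by
    funext y
    conv_lhs => rw [← B.sum_repr (a y), ← B.sum_repr (b y), Finset.sum_mul_sum]
    simp only [map_sum, smul_mul_smul_comm, map_smul]
    rfl
  rw [h]
  refine ContMDiffAt.sum fun i _ => ContMDiffAt.sum fun j _ => ?_
  exact ContMDiffAt.smul ((ha (B.coord i)).mul (hb (B.coord j))) contMDiffAt_const

/-- The algebra of `C^n` sections over `U` of the exterior algebra bundle `⋀ V^∨`. -/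
def sections (U : Opens M) : Subalgebra 𝕜 (∀ y : U, V.Ext y) where
  carrier := {s | ∀ x ∈ U, V.RegularAt s x}
  mul_mem' := by
    intro s t hs ht x hx
    obtain ⟨a, ha, ha'⟩ := hs x hx
    obtain ⟨b, hb, hb'⟩ := ht x hx
    refine ⟨_, ha.mul hb, ?_⟩
    filter_upwards [ha', hb'] with y h h' hy
    rw [Pi.mul_apply, map_mul, h, h']
  add_mem' := by
    intro s t hs ht x hx
    obtain ⟨a, ha, ha'⟩ := hs x hx
    obtain ⟨b, hb, hb'⟩ := ht x hx
    refine ⟨_, ha.add hb, ?_⟩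
    filter_upwards [ha', hb'] with y h h' hy
    rw [Pi.add_apply, map_add, h, h']
  algebraMap_mem' := by
    intro c x _
    exact ⟨_, SmoothAt.const (algebraMap 𝕜 _ c) x,
      Filter.Eventually.of_forall fun y hy => (V.coord x y).commutes c⟩

theorem sections_res {U W : Opens M} (h : W ≤ U) {s : ∀ y : U, V.Ext y} (hs : s ∈ V.sections U) :
    (fun y : W => s ⟨y, h y.2⟩) ∈ V.sections W := by
  intro x hx
  obtain ⟨a, ha, ha'⟩ := hs x (h hx)
  refine ⟨a, ha, ?_⟩
  filter_upwards [ha'] with y hy hyW using hy (h hyW)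

theorem sections_local {U : Opens M} {s : ∀ y : U, V.Ext y}
    (h : ∀ x : U, ∃ (W : Opens M) (_ : x.1 ∈ W) (hW : W ≤ U),
      (fun y : W => s ⟨y, hW y.2⟩) ∈ V.sections W) : s ∈ V.sections U := by
  intro x hx
  obtain ⟨W, hxW, hW, hs⟩ := h ⟨x, hx⟩
  obtain ⟨a, ha, ha'⟩ := hs x hxW
  refine ⟨a, ha, ?_⟩
  filter_upwards [ha', W.isOpen.mem_nhds hxW] with y hy hyW _ using hy hyW

/-- The presheaf of `C^n` sections of `⋀ V^∨`. -/
def extPresheaf : (Opens M)ᵒᵖ ⥤ AlgCat.{u} 𝕜 where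
  obj U := AlgCat.of 𝕜 (V.sections U.unop)
  map {U W} f := AlgCat.ofHom
    { toFun := fun s => ⟨fun y => s.1 ⟨y, leOfHom f.unop y.2⟩, V.sections_res _ s.2⟩
      map_one' := rfl
      map_mul' := fun _ _ => rfl
      map_zero' := rfl
      map_add' := fun _ _ => rfl
      commutes' := fun _ => rfl }

theorem extPresheaf_isSheaf : TopCat.Presheaf.IsSheaf (X := TopCat.of M) V.extPresheaf := by
  rw [TopCat.Presheaf.isSheaf_iff_isSheaf_comp (X := TopCat.of M) (forget (AlgCat.{u} 𝕜))]
  let P : TopCat.LocalPredicate (X := TopCat.of M) (fun x : M => V.Ext x) :=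
    { pred := fun {U} s => s ∈ V.sections U
      res := fun i _ hs => V.sections_res (leOfHom i) hs
      locality := fun {U} s h => V.sections_local fun x => by
        obtain ⟨W, hxW, i, hs⟩ := h x
        exact ⟨W, hxW, leOfHom i, hs⟩ }
  exact TopCat.subpresheafToTypes.isSheaf P

/-- The sections of parity `i` of `⋀ V^∨`. -/
def parity (i : ZMod 2) (U : Opens M) : Submodule 𝕜 (V.sections U) where
  carrier := {s | ∀ y : U, s.1 y ∈
    CliffordAlgebra.evenOdd (0 : QuadraticForm 𝕜 (Module.Dual 𝕜 (V.fiber y))) i}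
  zero_mem' := fun _ => zero_mem _
  add_mem' := fun hs ht y => add_mem (hs y) (ht y)
  smul_mem' := fun c _ hs y => Submodule.smul_mem _ c (hs y)

theorem coord_involute (x y : M) (a : V.Ext y) :
    V.coord x y (CliffordAlgebra.involute a) = CliffordAlgebra.involute (V.coord x y a) := by
  have h : (V.coord x y).comp CliffordAlgebra.involute =
      (CliffordAlgebra.involute : StdExt 𝕜 q →ₐ[𝕜] StdExt 𝕜 q).comp (V.coord x y) := by
    apply CliffordAlgebra.hom_ext
    ext v
    simp only [LinearMap.comp_apply, AlgHom.toLinearMap_apply, AlgHom.comp_apply,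
      CliffordAlgebra.involute_ι, map_neg]
    have : V.coord x y (CliffordAlgebra.ι 0 v) = CliffordAlgebra.ι 0 _ :=
      ExteriorAlgebra.map_apply_ι _ v
    rw [this, CliffordAlgebra.involute_ι]
  exact congrArg (fun f => f a) h

theorem involute_mem {U : Opens M} {s : ∀ y : U, V.Ext y} (hs : s ∈ V.sections U) :
    (fun y : U => (CliffordAlgebra.involute (s y) : V.Ext y)) ∈ V.sections U := by
  intro x hx
  obtain ⟨a, ha, ha'⟩ := hs x hx
  refine ⟨_, ha.linear (CliffordAlgebra.involute (Q := 0)).toLinearMap, ?_⟩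
  filter_upwards [ha'] with y hy hyU
  rw [coord_involute, hy hyU]
  rfl

theorem exists_parity {W : Type} [AddCommGroup W] [Module 𝕜 W] (a : ExteriorAlgebra 𝕜 W) :
    ∃ b ∈ CliffordAlgebra.evenOdd (0 : QuadraticForm 𝕜 W) 0,
      ∃ c ∈ CliffordAlgebra.evenOdd (0 : QuadraticForm 𝕜 W) 1, a = b + c := by
  have h : a ∈ CliffordAlgebra.evenOdd (0 : QuadraticForm 𝕜 W) 0 ⊔
      CliffordAlgebra.evenOdd (0 : QuadraticForm 𝕜 W) 1 := by
    rw [(CliffordAlgebra.evenOdd_isCompl (0 : QuadraticForm 𝕜 W)).sup_eq_top]; trivial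
  obtain ⟨b, hb, c, hc, h⟩ := Submodule.mem_sup.1 h
  exact ⟨b, hb, c, hc, h.symm⟩

theorem parity_isCompl (U : Opens M) : IsCompl (V.parity 0 U) (V.parity 1 U) := by
  constructor
  · rw [Submodule.disjoint_def]
    intro s h0 h1
    apply Subtype.ext
    funext y
    exact Submodule.disjoint_def.1 (CliffordAlgebra.evenOdd_isCompl
      (0 : QuadraticForm 𝕜 (Module.Dual 𝕜 (V.fiber y)))).disjoint _ (h0 y) (h1 y)
  · rw [codisjoint_iff, Submodule.eq_top_iff']
    intro s
    let t : V.sections U := ⟨_, V.involute_mem s.2⟩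
    refine Submodule.mem_sup.2 ⟨(2⁻¹ : 𝕜) • (s + t), fun y => ?_, (2⁻¹ : 𝕜) • (s - t),
      fun y => ?_, ?_⟩
    · obtain ⟨b, hb, c, hc, e⟩ := exists_parity (s.1 y)
      have : ((2⁻¹ : 𝕜) • (s + t)).1 y = b := by
        change (2⁻¹ : 𝕜) • (s.1 y + CliffordAlgebra.involute (s.1 y)) = b
        rw [e, map_add, CliffordAlgebra.involute_eq_of_mem_even hb,
          CliffordAlgebra.involute_eq_of_mem_odd hc]
        rw [show b + c + (b + -c) = (2 : 𝕜) • b by rw [two_smul]; abel, smul_smul,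
          inv_mul_cancel₀ two_ne_zero, one_smul]
      rw [this]; exact hb
    · obtain ⟨b, hb, c, hc, e⟩ := exists_parity (s.1 y)
      have : ((2⁻¹ : 𝕜) • (s - t)).1 y = c := by
        change (2⁻¹ : 𝕜) • (s.1 y - CliffordAlgebra.involute (s.1 y)) = c
        rw [e, map_add, CliffordAlgebra.involute_eq_of_mem_even hb,
          CliffordAlgebra.involute_eq_of_mem_odd hc]
        rw [show b + c - (b + -c) = (2 : 𝕜) • c by rw [two_smul]; abel, smul_smul,
          inv_mul_cancel₀ two_ne_zero, one_smul]
      rw [this]; exact hc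
    · rw [← smul_add, show s + t + (s - t) = (2 : 𝕜) • s by rw [two_smul]; abel, smul_smul,
        inv_mul_cancel₀ two_ne_zero, one_smul]

theorem ι_anticomm {W : Type} [AddCommGroup W] [Module 𝕜 W] (v w : W) :
    CliffordAlgebra.ι (0 : QuadraticForm 𝕜 W) v * CliffordAlgebra.ι 0 w =
      -(CliffordAlgebra.ι 0 w * CliffordAlgebra.ι 0 v) :=
  eq_neg_of_add_eq_zero_left (ExteriorAlgebra.ι_add_mul_swap v w)

theorem ext_even_comm {W : Type} [AddCommGroup W] [Module 𝕜 W] {a : ExteriorAlgebra 𝕜 W}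
    (b : ExteriorAlgebra 𝕜 W) (ha : a ∈ CliffordAlgebra.evenOdd (0 : QuadraticForm 𝕜 W) 0) :
    a * b = b * a := by
  induction a, ha using CliffordAlgebra.even_induction with
  | algebraMap r => exact Algebra.commutes r b
  | add x y _ _ hx hy => rw [add_mul, mul_add, hx, hy]
  | ι_mul_ι_mul v w x _ hx =>
    have h : ∀ b : ExteriorAlgebra 𝕜 W, (CliffordAlgebra.ι 0 v * CliffordAlgebra.ι 0 w) * b =
        b * (CliffordAlgebra.ι 0 v * CliffordAlgebra.ι 0 w) := by
      intro b
      induction b using ExteriorAlgebra.induction with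
      | algebraMap r => exact (Algebra.commutes r _).symm
      | ι z =>
        change _ * CliffordAlgebra.ι 0 z = CliffordAlgebra.ι 0 z * _
        rw [mul_assoc, ι_anticomm w z, mul_neg, ← mul_assoc, ι_anticomm v z, neg_mul, neg_neg,
          mul_assoc]
      | mul x y hx hy => rw [← mul_assoc, hx, mul_assoc, hy, mul_assoc]
      | add x y hx hy => rw [mul_add, add_mul, hx, hy]
    rw [mul_assoc, hx, ← mul_assoc, h, mul_assoc]

theorem ext_odd_anticomm {W : Type} [AddCommGroup W] [Module 𝕜 W] {a b : ExteriorAlgebra 𝕜 W}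
    (ha : a ∈ CliffordAlgebra.evenOdd (0 : QuadraticForm 𝕜 W) 1)
    (hb : b ∈ CliffordAlgebra.evenOdd (0 : QuadraticForm 𝕜 W) 1) : a * b = -(b * a) := by
  have key : ∀ v : W, ∀ c ∈ CliffordAlgebra.evenOdd (0 : QuadraticForm 𝕜 W) 1,
      CliffordAlgebra.ι 0 v * c = -(c * CliffordAlgebra.ι 0 v) := by
    intro v c hc
    induction c, hc using CliffordAlgebra.odd_induction with
    | ι w => exact ι_anticomm v w
    | add x y _ _ hx hy => rw [mul_add, add_mul, hx, hy, neg_add]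
    | ι_mul_ι_mul m₁ m₂ x _ hx =>
      have h := ext_even_comm (CliffordAlgebra.ι 0 v)
        (CliffordAlgebra.ι_mul_ι_mem_evenOdd_zero (0 : QuadraticForm 𝕜 W) m₁ m₂)
      rw [← mul_assoc, ← h, mul_assoc, hx, mul_neg]
      simp only [mul_assoc]
  induction a, ha using CliffordAlgebra.odd_induction with
  | ι w => exact key w b hb
  | add x y _ _ hx hy => rw [mul_add, add_mul, hx, hy, neg_add]
  | ι_mul_ι_mul m₁ m₂ x _ hx =>
    have h := ext_even_comm b
      (CliffordAlgebra.ι_mul_ι_mem_evenOdd_zero (0 : QuadraticForm 𝕜 W) m₁ m₂)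
    rw [mul_assoc, hx, mul_neg, ← mul_assoc, h, mul_assoc]

/-- The split supermanifold `S(M, V)`: the sheaf of `C^n` sections of `⋀ V^∨`, with its
`ℤ/2`-grading. -/
def split : SuperSheaf 𝕜 M where
  presheaf := V.extPresheaf
  isSheaf := V.extPresheaf_isSheaf
  even := V.parity 0
  odd := V.parity 1
  isCompl := V.parity_isCompl
  res_even h _ hs y := hs ⟨y, h y.2⟩
  res_odd h _ hs y := hs ⟨y, h y.2⟩
  one_mem _ _ := SetLike.one_mem_graded (CliffordAlgebra.evenOdd _)
  even_mul_even ha hb y := (SetLike.mul_mem_graded (ha y) (hb y) :)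
  even_mul_odd ha hb y := (SetLike.mul_mem_graded (ha y) (hb y) :)
  odd_mul_odd ha hb y := (SetLike.mul_mem_graded (ha y) (hb y) :)
  even_comm b ha := Subtype.ext (funext fun y => ext_even_comm (b.1 y) (ha y))
  odd_anticomm ha hb := Subtype.ext (funext fun y => ext_odd_anticomm (ha y) (hb y))

/-! ### The sheaf of `⋀² V^∨`-valued vector fields and the class `ω₂` -/

/-- The projection of the exterior algebra to its component of degree `k`. -/
def pr {W : Type} [AddCommGroup W] [Module 𝕜 W] (k : ℕ) :
    ExteriorAlgebra 𝕜 W →ₗ[𝕜] ExteriorAlgebra 𝕜 W :=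
  GradedAlgebra.proj (fun i : ℕ => ⋀[𝕜]^i W) k

section pr

variable {W W' : Type} [AddCommGroup W] [Module 𝕜 W] [AddCommGroup W'] [Module 𝕜 W']

theorem pr_mem (k : ℕ) (a : ExteriorAlgebra 𝕜 W) : pr k a ∈ ⋀[𝕜]^k W :=
  (DirectSum.decompose (fun i : ℕ => ⋀[𝕜]^i W) a k).2

theorem pr_of_mem {k : ℕ} {a : ExteriorAlgebra 𝕜 W} (h : a ∈ ⋀[𝕜]^k W) : pr k a = a :=
  DirectSum.decompose_of_mem_same (fun i : ℕ => ⋀[𝕜]^i W) h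

theorem pr_of_mem_ne {k l : ℕ} {a : ExteriorAlgebra 𝕜 W} (h : a ∈ ⋀[𝕜]^l W) (hkl : l ≠ k) :
    pr k a = 0 :=
  DirectSum.decompose_of_mem_ne (fun i : ℕ => ⋀[𝕜]^i W) h hkl

theorem pr_mul (k : ℕ) (a b : ExteriorAlgebra 𝕜 W) :
    pr k (a * b) = ∑ ij ∈ Finset.HasAntidiagonal.antidiagonal k, pr ij.1 a * pr ij.2 b := by
  change ((DirectSum.decompose (fun i : ℕ => ⋀[𝕜]^i W) (a * b) k : _) : ExteriorAlgebra 𝕜 W) = _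
  rw [DirectSum.decompose_mul, DirectSum.coe_mul_apply_eq_sum_antidiagonal]
  rfl

theorem pr_map (f : W →ₗ[𝕜] W') (k : ℕ) (a : ExteriorAlgebra 𝕜 W) :
    pr k (ExteriorAlgebra.map f a) = ExteriorAlgebra.map f (pr k a) := by
  induction a using DirectSum.Decomposition.inductionOn (fun i : ℕ => ⋀[𝕜]^i W) with
  | zero => simp
  | add a b ha hb => simp [ha, hb]
  | @homogeneous i a =>
    have h : ExteriorAlgebra.map f a.1 ∈ ⋀[𝕜]^i W' := by
      have h1 := Submodule.mem_map_of_mem (f := (ExteriorAlgebra.map f).toLinearMap) a.2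
      rw [Submodule.map_pow] at h1
      refine (pow_le_pow_left' (?_ : _ ≤ LinearMap.range (ExteriorAlgebra.ι 𝕜)) i) h1
      rintro _ ⟨_, ⟨v, rfl⟩, rfl⟩
      exact ⟨f v, (ExteriorAlgebra.map_apply_ι f v).symm⟩
    by_cases hik : i = k
    · subst hik
      rw [pr_of_mem h, pr_of_mem a.2]
    · rw [pr_of_mem_ne h hik, pr_of_mem_ne a.2 hik, map_zero]

theorem pr_of_parity {i : ZMod 2} {k : ℕ} (hk : (k : ZMod 2) ≠ i) {a : ExteriorAlgebra 𝕜 W}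
    (ha : a ∈ CliffordAlgebra.evenOdd (0 : QuadraticForm 𝕜 W) i) : pr k a = 0 := by
  unfold CliffordAlgebra.evenOdd at ha
  induction ha using Submodule.iSup_induction' with
  | mem j x hx =>
    refine pr_of_mem_ne (l := j.1) hx ?_
    rintro rfl
    exact hk j.2
  | zero => exact map_zero _
  | add x y _ _ hx hy => rw [map_add, hx, hy, add_zero]

end pr

/-- The sections of `⋀^k V^∨` over `U`. In particular `V.deg 0` is the sheaf of `C^n` functions. -/
def deg (k : ℕ) (U : Opens M) : Submodule 𝕜 (V.sections U) where
  carrier := {s | ∀ y : U, s.1 y ∈ ⋀[𝕜]^k (Module.Dual 𝕜 (V.fiber y))}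
  zero_mem' := fun _ => zero_mem _
  add_mem' := fun hs ht y => add_mem (hs y) (ht y)
  smul_mem' := fun c _ hs y => Submodule.smul_mem _ c (hs y)

theorem deg_mul {k l : ℕ} {U : Opens M} {a b : V.sections U} (ha : a ∈ V.deg k U)
    (hb : b ∈ V.deg l U) : a * b ∈ V.deg (k + l) U :=
  fun y => (SetLike.mul_mem_graded (ha y) (hb y) :)

/-- Restriction of sections of `⋀^k V^∨`. -/
def degRes (k : ℕ) {U W : Opens M} (h : W ≤ U) : V.deg k U →ₗ[𝕜] V.deg k W where
  toFun s := ⟨⟨fun y => s.1.1 ⟨y, h y.2⟩, V.sections_res h s.1.2⟩, fun y => s.2 ⟨y, h y.2⟩⟩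
  map_add' _ _ := rfl
  map_smul' _ _ := rfl

theorem pr_mem_sections (k : ℕ) {U : Opens M} {s : ∀ y : U, V.Ext y} (hs : s ∈ V.sections U) :
    (fun y => pr k (s y)) ∈ V.sections U := by
  intro x hx
  obtain ⟨a, ha, ha'⟩ := hs x hx
  refine ⟨_, ha.linear (pr k), ?_⟩
  filter_upwards [ha'] with y hy hyU
  rw [← hy hyU, coord, pr_map]

theorem pr_of_mem_J {k : ℕ} {U : Opens M} {s : V.sections U} (hs : s ∈ V.split.J k U) (y : U)
    {l : ℕ} (hl : l < k) : pr l (s.1 y) = 0 := by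
  have key : ∀ (k : ℕ) (W : Opens M) (t : V.sections W), t ∈ V.split.oddIdeal W ^ k →
      ∀ (y : W) (l : ℕ), l < k → pr l (t.1 y) = 0 := by
    intro k W
    have h1 : ∀ t : V.sections W, t ∈ V.split.oddIdeal W → ∀ y : W, pr 0 (t.1 y) = 0 := by
      intro t ht y
      unfold SuperSheaf.oddIdeal at ht
      induction ht using Submodule.span_induction with
      | mem t ht => exact pr_of_parity (by decide) (ht y)
      | zero => exact map_zero _
      | add a b _ _ ha hb =>
        change pr 0 (a.1 y + b.1 y) = 0
        rw [map_add, ha, hb, add_zero]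
      | smul a b _ hb =>
        change pr 0 (a.1 y * b.1 y) = 0
        rw [pr_mul]
        simp [hb]
    induction k with
    | zero => intro _ _ _ _ hl; exact absurd hl (Nat.not_lt_zero _)
    | succ k ih =>
      intro t ht y
      rw [Submodule.pow_succ] at ht
      refine Submodule.smul_induction_on (p := fun t : V.split.Sec W =>
        ∀ l : ℕ, l < k + 1 → pr l ((t : V.sections W).1 y) = 0) ht ?_ ?_
      · intro a ha b hb l hl
        change pr l (a.1 y * b.1 y) = 0
        rw [pr_mul]
        refine Finset.sum_eq_zero fun ij hij => ?_
        rw [Finset.HasAntidiagonal.mem_antidiagonal] at hij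
        by_cases h : ij.1 < k
        · rw [ih a ha y _ h, zero_mul]
        · rw [show ij.2 = 0 by omega, h1 b hb y, mul_zero]
      · intro a b ha hb l hl
        change pr l (a.1 y + b.1 y) = 0
        rw [map_add, ha l hl, hb l hl, add_zero]
  obtain ⟨W, hW, hyW, h⟩ := hs y y.2
  exact key k W _ h ⟨y, hyW⟩ l hl

/-- `D` is a `𝕜`-linear derivation of the sheaf of functions `O_M|_U` with values in
`⋀² V^∨|_U`. -/
structure IsDer {U : Opens M}
    (D : ∀ W : {W : Opens M // W ≤ U}, V.deg 0 W.1 → ∀ y : W.1, V.Ext y) : Prop where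
  mem (W) (f : V.deg 0 W.1) : D W f ∈ V.sections W.1
  mem_two (W) (f : V.deg 0 W.1) (y : W.1) : D W f y ∈ ⋀[𝕜]^2 (Module.Dual 𝕜 (V.fiber y))
  res (W T) (h : T.1 ≤ W.1) (f : V.deg 0 W.1) (y : T.1) :
    D T (V.degRes 0 h f) y = D W f ⟨y, h y.2⟩
  add (W) (f g : V.deg 0 W.1) (y : W.1) : D W (f + g) y = D W f y + D W g y
  smul (W) (c : 𝕜) (f : V.deg 0 W.1) (y : W.1) : D W (c • f) y = c • D W f y
  mul (W) (f g : V.deg 0 W.1) (y : W.1) :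
    D W ⟨f.1 * g.1, V.deg_mul f.2 g.2⟩ y = f.1.1 y * D W g y + D W f y * g.1.1 y

variable {V} in
theorem IsDer.zero {U : Opens M} : V.IsDer (U := U) (fun _ _ _ => 0) where
  mem _ _ := (V.sections _).zero_mem
  mem_two _ _ _ := Submodule.zero_mem _
  res _ _ _ _ _ := rfl
  add _ _ _ _ := (add_zero 0).symm
  smul _ c _ _ := (smul_zero c).symm
  mul W f g y := by rw [mul_zero, zero_mul, add_zero]

variable {V} in
theorem IsDer.sum {U : Opens M}
    {D E : ∀ W : {W : Opens M // W ≤ U}, V.deg 0 W.1 → ∀ y : W.1, V.Ext y}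
    (hD : V.IsDer D) (hE : V.IsDer E) : V.IsDer (fun W f y => D W f y + E W f y) where
  mem W f := (V.sections _).add_mem (hD.mem W f) (hE.mem W f)
  mem_two W f y := Submodule.add_mem _ (hD.mem_two W f y) (hE.mem_two W f y)
  res W T h f y := by rw [hD.res W T h, hE.res W T h]
  add W f g y := by rw [hD.add, hE.add, add_add_add_comm]
  smul W c f y := by rw [hD.smul, hE.smul, smul_add]
  mul W f g y := by rw [hD.mul, hE.mul, mul_add, add_mul, add_add_add_comm]

variable {V} in
theorem IsDer.const_smul {U : Opens M}
    {D : ∀ W : {W : Opens M // W ≤ U}, V.deg 0 W.1 → ∀ y : W.1, V.Ext y}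
    (hD : V.IsDer D) (r : 𝕜) : V.IsDer (fun W f y => r • D W f y) where
  mem W f := (V.sections _).smul_mem (hD.mem W f) r
  mem_two W f y := Submodule.smul_mem _ r (hD.mem_two W f y)
  res W T h f y := by rw [hD.res W T h]
  add W f g y := by rw [hD.add, smul_add]
  smul W c f y := by rw [hD.smul, smul_comm]
  mul W f g y := by rw [hD.mul, smul_add, mul_smul_comm, smul_mul_assoc]

variable {V} in
theorem IsDer.restrict {U U' : Opens M}
    {D : ∀ W : {W : Opens M // W ≤ U}, V.deg 0 W.1 → ∀ y : W.1, V.Ext y}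
    (hD : V.IsDer D) (h : U' ≤ U) :
    V.IsDer (U := U') (fun T => D ⟨T.1, T.2.trans h⟩) where
  mem W f := hD.mem ⟨W.1, W.2.trans h⟩ f
  mem_two W f y := hD.mem_two ⟨W.1, W.2.trans h⟩ f y
  res W T hT f y := hD.res ⟨W.1, W.2.trans h⟩ ⟨T.1, T.2.trans h⟩ hT f y
  add W f g y := hD.add ⟨W.1, W.2.trans h⟩ f g y
  smul W c f y := hD.smul ⟨W.1, W.2.trans h⟩ c f y
  mul W f g y := hD.mul ⟨W.1, W.2.trans h⟩ f g y

/-- The sections over `U` of `T_+M ⊗ ⋀² V^∨ = Hom(⋀² T_-, T_+)`, i.e. the `⋀² V^∨`-valued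
`𝕜`-linear derivations of the sheaf of functions `O_M|_U`. -/
def der (U : Opens M) :
    Submodule 𝕜 (∀ W : {W : Opens M // W ≤ U}, V.deg 0 W.1 → ∀ y : W.1, V.Ext y) where
  carrier := {D | V.IsDer D}
  zero_mem' := IsDer.zero
  add_mem' := IsDer.sum
  smul_mem' r _ hD := hD.const_smul r

/-- Restriction of derivations. -/
def derRes {U U' : Opens M} (h : U' ≤ U) : V.der U →+ V.der U' where
  toFun D := ⟨fun T => D.1 ⟨T.1, T.2.trans h⟩, D.2.restrict h⟩
  map_zero' := rfl
  map_add' _ _ := rfl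

/-- The sheaf of abelian groups `T_+M ⊗ ⋀² V^∨`, written multiplicatively. -/
def derPresheaf : (Opens M)ᵒᵖ ⥤ GrpCat.{u} where
  obj U := GrpCat.of (Multiplicative (V.der U.unop))
  map f := GrpCat.ofHom (AddMonoidHom.toMultiplicative (V.derRes (leOfHom f.unop)))
  map_id _ := rfl
  map_comp _ _ := rfl

section leadingTerm

variable {U : Opens M} (g : SuperSheaf.IsoOn U V.split V.split)

theorem pr_zero_app (hg : g.ActsTriviallyOnGr) {W : Opens M} (hW : W ≤ U) (f : V.deg 0 W) (y : W) :
    pr 0 ((g.app W hW f.1 : V.sections W).1 y) = f.1.1 y := by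
  have h := V.pr_of_mem_J (hg 0 W hW f.1 (V.split.mem_J_zero _)) y (Nat.lt_succ_self 0)
  have h' : pr 0 ((g.app W hW f.1 : V.sections W).1 y - f.1.1 y) = 0 := h
  rwa [map_sub, pr_of_mem (f.2 y), sub_eq_zero] at h'

theorem deg_zero_le_even {W : Opens M} (f : V.deg 0 W) : f.1 ∈ V.split.even W := by
  intro y
  have h := f.2 y
  rw [ExteriorAlgebra.exteriorPower, Submodule.pow_zero] at h
  exact CliffordAlgebra.one_le_evenOdd_zero _ h

theorem pr_one_app {W : Opens M} (hW : W ≤ U) (f : V.deg 0 W) (y : W) :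
    pr 1 ((g.app W hW f.1 : V.sections W).1 y) = 0 :=
  pr_of_parity (i := 0) (by decide) (g.app_even hW (V.deg_zero_le_even f) y)

theorem app_mul_two (hg : g.ActsTriviallyOnGr) {W : Opens M} (hW : W ≤ U) (f f' : V.deg 0 W)
    (y : W) : pr 2 ((g.app W hW (f.1 * f'.1 : V.sections W) : V.sections W).1 y) =
      f.1.1 y * pr 2 ((g.app W hW f'.1 : V.sections W).1 y) +
        pr 2 ((g.app W hW f.1 : V.sections W).1 y) * f'.1.1 y := by
  have h1 : (g.app W hW (f.1 * f'.1 : V.sections W) : V.sections W) =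
    (g.app W hW f.1 : V.sections W) * (g.app W hW f'.1 : V.sections W) :=
    map_mul (g.app W hW) _ _
  have h2 : (g.app W hW (f.1 * f'.1 : V.sections W) : V.sections W).1 y =
    (g.app W hW f.1 : V.sections W).1 y * (g.app W hW f'.1 : V.sections W).1 y :=
    congrArg (fun t : V.sections W => t.1 y) h1
  have e0 := V.pr_zero_app g hg hW f y
  have e0' := V.pr_zero_app g hg hW f' y
  have e1 := V.pr_one_app g hW f y
  rw [h2]
  generalize (g.app W hW f.1 : V.sections W).1 y = a at *
  generalize (g.app W hW f'.1 : V.sections W).1 y = b at *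
  rw [pr_mul, Finset.Nat.sum_antidiagonal_eq_sum_range_succ (fun i j => pr i a * pr j b),
    Finset.sum_range_succ, Finset.sum_range_succ, Finset.sum_range_one, e0, e1, zero_mul, add_zero]
  exact congrArg (fun t => _ + _ * t) e0'

theorem app_add_two {W : Opens M} (hW : W ≤ U) (s t : V.sections W)
    (y : W) : pr 2 ((g.app W hW (s + t : V.sections W) : V.sections W).1 y) =
      pr 2 ((g.app W hW s : V.sections W).1 y) + pr 2 ((g.app W hW t : V.sections W).1 y) := by
  have h1 : (g.app W hW (s + t : V.sections W) : V.sections W) =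
    (g.app W hW s : V.sections W) + (g.app W hW t : V.sections W) := map_add (g.app W hW) _ _
  have h2 : (g.app W hW (s + t : V.sections W) : V.sections W).1 y =
    (g.app W hW s : V.sections W).1 y + (g.app W hW t : V.sections W).1 y :=
    congrArg (fun t : V.sections W => t.1 y) h1
  rw [h2, map_add]

theorem app_smul_two {W : Opens M} (hW : W ≤ U) (c : 𝕜) (s : V.sections W)
    (y : W) : pr 2 ((g.app W hW (c • s : V.sections W) : V.sections W).1 y) =
      c • pr 2 ((g.app W hW s : V.sections W).1 y) := by
  have h1 : (g.app W hW (c • s : V.sections W) : V.sections W) =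
    c • (g.app W hW s : V.sections W) := map_smul (g.app W hW) _ _
  have h2 : (g.app W hW (c • s : V.sections W) : V.sections W).1 y =
    c • (g.app W hW s : V.sections W).1 y :=
    congrArg (fun t : V.sections W => t.1 y) h1
  rw [h2, map_smul]

theorem app_res_two {W T : Opens M} (hW : W ≤ U) (h : T ≤ W) (f : V.deg 0 W) (y : T) :
    pr 2 ((g.app T (h.trans hW) (V.degRes 0 h f).1 : V.sections T).1 y) =
      pr 2 ((g.app W hW f.1 : V.sections W).1 ⟨y, h y.2⟩) := by
  have h1 := g.app_res hW h f.1
  have h2 : (g.app T (h.trans hW) (V.degRes 0 h f).1 : V.sections T) =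
    V.split.res h (g.app W hW f.1) := h1
  exact congrArg (fun t : V.sections T => pr 2 (t.1 y)) h2

/-- The leading term of an automorphism `g` of `⋀ V^∨` over `U` which acts trivially on the
associated graded algebra: the derivation sending a function `f` to the component of degree `2`
of `g f` (equivalently, to `g f - f` modulo `J ^ 3`). -/
def leadingTerm (hg : g.ActsTriviallyOnGr) : V.der U where
  val W f y := pr 2 ((g.app W.1 W.2 f.1 : V.sections W.1).1 y)
  property :=
    { mem := fun W f => V.pr_mem_sections 2 (g.app W.1 W.2 f.1 : V.sections W.1).2
      mem_two := fun _ _ _ => pr_mem 2 _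
      res := fun W _ h f y => V.app_res_two g W.2 h f y
      add := fun W f f' y => V.app_add_two g W.2 f.1 f'.1 y
      smul := fun W c f y => V.app_smul_two g W.2 c f.1 y
      mul := fun W f f' y => V.app_mul_two g hg W.2 f f' y }

theorem pr_two_app_of_mem_J_two (hg : g.ActsTriviallyOnGr) {W : Opens M} (hW : W ≤ U)
    (s : V.sections W) (hs : s ∈ V.split.J 2 W) (y : W) :
    pr 2 ((g.app W hW s : V.sections W).1 y) = pr 2 (s.1 y) := by
  have h := V.pr_of_mem_J (hg 2 W hW s hs) y (Nat.lt_succ_self 2)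
  have h' : pr 2 ((g.app W hW s : V.sections W).1 y - s.1 y) = 0 := h
  rwa [map_sub, sub_eq_zero] at h'

/-- Leading terms are additive. -/
theorem pr_two_app_app (hg : g.ActsTriviallyOnGr) (g' : SuperSheaf.IsoOn U V.split V.split)
    (hg' : g'.ActsTriviallyOnGr) {W : Opens M} (hW : W ≤ U) (f : V.deg 0 W) (y : W) :
    pr 2 ((g.app W hW (g'.app W hW f.1) : V.sections W).1 y) =
      pr 2 ((g.app W hW f.1 : V.sections W).1 y) +
        pr 2 ((g'.app W hW f.1 : V.sections W).1 y) := by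
  obtain ⟨r, hr⟩ : ∃ r : V.split.Sec W, r = f.1 := ⟨_, rfl⟩
  obtain ⟨a, ha⟩ : ∃ a : V.split.Sec W, a = g'.app W hW r - r := ⟨_, rfl⟩
  have ha1 : a ∈ V.split.J 1 W := by
    rw [ha, hr]
    exact hg' 0 W hW f.1 (V.split.mem_J_zero _)
  have hae : a ∈ V.split.even W := by
    rw [ha, hr]
    exact (V.split.even W).sub_mem (g'.app_even hW (V.deg_zero_le_even f)) (V.deg_zero_le_even f)
  have ha2 : a ∈ V.split.J 2 W := V.split.even_mem_J_two hae ha1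
  have e : g'.app W hW f.1 = r + a := by rw [ha, ← hr, add_sub_cancel]
  have e1 : pr 2 ((g'.app W hW f.1 : V.sections W).1 y) = pr 2 ((a : V.sections W).1 y) := by
    rw [e, hr]
    change pr 2 (f.1.1 y + (a : V.sections W).1 y) = _
    rw [map_add, pr_of_mem_ne (f.2 y) (by decide), zero_add]
  rw [e1, e, hr, ← V.pr_two_app_of_mem_J_two g hg hW a ha2 y]
  exact V.app_add_two g hW f.1 a y

end leadingTerm

end VecBundle

section Supermanifold

variable {𝕜} {M M' : Type u} [TopologicalSpace M] [ChartedSpace (Std 𝕜 m) M]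
  [TopologicalSpace M'] [ChartedSpace (Std 𝕜 m) M']

/-- `S = (M, O)` is a `C^n` supermanifold of dimension `m|q` over `𝕜`: it is locally isomorphic to
the sheaf of `C^n` sections of `⋀ (𝕜^q)^∨`. -/
def SuperSheaf.IsSupermanifold (S : SuperSheaf 𝕜 M) : Prop :=
  ∀ x : M, ∃ U : Opens M, x ∈ U ∧
    Nonempty (SuperSheaf.IsoOn U S (VecBundle.trivial n q M : VecBundle 𝕜 n m q M).split)

/-- `S` is split: it is isomorphic to `S(M, V)` for some vector bundle `V`. -/
def SuperSheaf.IsSplit (S : SuperSheaf 𝕜 M) : Prop :=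
  ∃ V : VecBundle 𝕜 n m q M, SuperSheaf.IsIso S V.split

/-- `S^(i)` is split: it is isomorphic to `S(M, V)^(i)` for some vector bundle `V`. -/
def SuperSheaf.IsSplitTrunc (i : ℕ) (S : SuperSheaf 𝕜 M) : Prop :=
  ∃ V : VecBundle 𝕜 n m q M, SuperSheaf.IsIso (S.trunc i) (V.split.trunc i)

/-- A vector bundle `V`, an open covering of `M` and isomorphisms of `S` with `S(M, V)` over its
members, which all induce the same isomorphism `Gr_J(O) ≅ ⋀ V^∨` of graded sheaves. -/
structure GradedAtlas (S : SuperSheaf 𝕜 M) where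
  /-- the vector bundle `V = T_-` -/
  V : VecBundle 𝕜 n m q M
  /-- the index set of the covering -/
  ι : Type u
  /-- the members of the covering -/
  U : ι → Opens M
  cover : ⨆ i, U i = ⊤
  /-- the local isomorphisms -/
  iso (i : ι) : SuperSheaf.IsoOn (U i) S V.split
  compat (i j : ι) (T : Opens M) (h : T ≤ U i) (h' : T ≤ U j) :
    ((iso i).trans (iso j) h h').ActsTriviallyOnGr

namespace GradedAtlas

variable {n m q} {S : SuperSheaf 𝕜 M} (A : GradedAtlas n m q S)

/-- The Čech cocycle of leading terms of the transition automorphisms `iso i ∘ (iso j)⁻¹`. -/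
def cocycle : PresheafOfGroups.OneCocycle A.V.derPresheaf A.U where
  ev i j T a b := Multiplicative.ofAdd
    (A.V.leadingTerm ((A.iso i).trans (A.iso j) (leOfHom a) (leOfHom b)) (A.compat i j T _ _))
  ev_precomp _ _ _ _ _ _ _ := rfl
  ev_trans i j k T a b c := by
    change Multiplicative.ofAdd (_ + _) = _
    refine congrArg Multiplicative.ofAdd (Subtype.ext ?_)
    funext W f y
    have h := A.V.pr_two_app_app ((A.iso i).trans (A.iso j) (leOfHom a) (leOfHom b))
      (A.compat i j T _ _) ((A.iso j).trans (A.iso k) (leOfHom b) (leOfHom c))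
      (A.compat j k T _ _) W.2 f y
    refine h.symm.trans ?_
    have e : ((A.iso i).trans (A.iso j) (leOfHom a) (leOfHom b)).app W.1 W.2
        (((A.iso j).trans (A.iso k) (leOfHom b) (leOfHom c)).app W.1 W.2 f.1) =
        ((A.iso i).trans (A.iso k) (leOfHom a) (leOfHom c)).app W.1 W.2 f.1 := by
      exact congrArg ((A.iso i).app W.1 _) (AlgEquiv.symm_apply_apply _ _)
    exact congrArg (fun t : A.V.sections W.1 => VecBundle.pr 2 (t.1 y)) e

/-- The first obstruction class `ω₂ ∈ H¹(M, T_+M ⊗ ⋀² V^∨)`, in the first Čech cohomology of the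
covering (a subgroup of `H¹`). It is written multiplicatively. -/
def omegaTwo : PresheafOfGroups.H1 A.V.derPresheaf A.U := A.cocycle.class

end GradedAtlas

/-- A finite covering `(M', O') → (M, O)` of supermanifolds: a finite covering `f : M' → M` of the
reduced spaces and an isomorphism `f⁻¹ O ≅ O'`. The latter is a family of maps
`O(U) → O'(f⁻¹ U)` which is bijective on the sheets of the covering. -/
structure FiniteCovering (S' : SuperSheaf 𝕜 M') (S : SuperSheaf 𝕜 M) where
  /-- the map of reduced spaces -/
  base : M' → M
  isCoveringMap : IsCoveringMap base
  isLocalDiffeomorph : IsLocalDiffeomorph 𝓘(𝕜, Std 𝕜 m) 𝓘(𝕜, Std 𝕜 m) n base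
  surjective : Function.Surjective base
  finite_fiber (x : M) : (base ⁻¹' {x}).Finite
  /-- the pullback of functions -/
  pull (U : Opens M) : S.Sec U →ₐ[𝕜] S'.Sec (U.comap ⟨base, isCoveringMap.continuous⟩)
  pull_res {U W : Opens M} (h : W ≤ U) (s : S.Sec U) :
    pull W (S.res h s) = S'.res (fun _ hx => h hx) (pull U s)
  pull_even {U : Opens M} {s : S.Sec U} : s ∈ S.even U → pull U s ∈ S'.even _
  pull_odd {U : Opens M} {s : S.Sec U} : s ∈ S.odd U → pull U s ∈ S'.odd _
  bijective (U : Opens M) (W : Opens M') (h : W ≤ U.comap ⟨base, isCoveringMap.continuous⟩) :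
    Set.BijOn base W U → Function.Bijective fun s : S.Sec U => S'.res h (pull U s)

end Supermanifold

end Models
end

/-!
An Euler derivation of a sheaf `O` of superalgebras is an even derivation of `O` which preserves the
powers of the ideal `J` and acts on `J ^ k / J ^ (k + 1)` as multiplication by `k`
(`SuperSheaf.Euler`). The proof rests on the fact that a supermanifold is split if and only if it
has an Euler derivation, and that `S^(i)` is split if and only if `O / J ^ (i + 1)` has one
(`IsSupermanifold.isSplit_iff`, `IsSupermanifold.isSplitTrunc_iff`).

* The degree derivation of `⋀ V^∨` is an Euler derivation (`VecBundle.splitEuler`), and Euler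
  derivations descend to quotients by powers of `J` (`Euler.nonempty_quot`).
* Conversely, since `J` is nilpotent and the characteristic is zero, an Euler derivation is
  diagonalizable with eigenvalues `0, …, N`, the projections to the eigenspaces being the Lagrange
  polynomials in the derivation (`Euler.weight`). The eigenspaces grade the sheaf. A supermanifold
  has an atlas of local isomorphisms with some `S(M, V)` whose transition automorphisms act
  trivially on the associated graded algebra (`IsSupermanifold.nonempty_gradedAtlas`): `V` is glued
  from the linear parts `VecBundle.linPart` of the transition automorphisms of any atlas. The part
  of a local isomorphism which preserves the gradings is again an isomorphism, and it is determined
  by the map induced on the associated graded algebra. Hence for such an atlas these parts agree on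
  overlaps and glue to an isomorphism (`Euler.isIso_of_cover`).

Derivations pull back along local isomorphisms (`Euler.nonempty_pull`), so coverings of split
supermanifolds are split. In the other direction, the conditions on an Euler derivation are affine,
so that the average over the sheets of a finite covering of an Euler derivation upstairs is an Euler
derivation downstairs (`Euler.average`); this again uses characteristic zero. The same arguments
apply to the truncations, because a local isomorphism induces one of the quotients by powers of `J`.

Projections pull back along local isomorphisms as well (`IsProjected.pull`). If `σ : O_M → O` is a
projection and `φ` a local isomorphism with `S(M, V)`, then the part of `φ ∘ σ` of degree two is a
derivation from functions to `⋀² V^∨` (`SuperSheaf.projTerm`), and these derivations bound the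
cocycle defining `ω₂` (`IsProjected.omegaTwo_eq_one`). Thus `ω₂(S') ≠ 0` implies that `S'` is not
projected, and then neither is `S`.
-/

noncomputable section

namespace SuperSheaf

/-! ### Gluing, and powers of the odd ideal -/

section Gluing

variable {𝕜 : Type} [Field 𝕜] {M M' : Type u} [TopologicalSpace M] [TopologicalSpace M']
  (X : SuperSheaf 𝕜 M) (X' : SuperSheaf 𝕜 M')

/-- A property which has, locally and uniquely, a section as solution, has a global solution. -/
theorem exists_glue {W : Opens M} (P : ∀ T : Opens M, T ≤ W → X.Sec T → Prop)
    (hres : ∀ (T T' : Opens M) (h : T ≤ W) (h' : T' ≤ T) (t : X.Sec T), P T h t →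
      P T' (h'.trans h) (X.res h' t))
    (huniq : ∀ (T : Opens M) (h : T ≤ W) (t t' : X.Sec T), P T h t → P T h t' → t = t')
    (hex : ∀ x ∈ W, ∃ (T : Opens M) (h : T ≤ W), x ∈ T ∧ ∃ t, P T h t) :
    ∃ t : X.Sec W, ∀ (T : Opens M) (h : T ≤ W) (s : X.Sec T), P T h s → X.res h t = s := by
  have hex' : ∀ x : W, ∃ (T : Opens M) (h : T ≤ W), x.1 ∈ T ∧ ∃ t, P T h t :=
    fun x => hex x x.2
  choose T hT hxT s hs using hex'
  obtain ⟨t, ht⟩ := X.sec_glue T hT hxT s (fun x y => huniq _ (inf_le_left.trans (hT x)) _ _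
    (hres _ _ _ inf_le_left _ (hs x)) (hres _ _ _ inf_le_right _ (hs y)))
  refine ⟨t, fun R hR r hr => X.sec_ext fun x hx => ?_⟩
  refine ⟨R ⊓ T ⟨x, hR hx⟩, inf_le_left, ⟨hx, hxT _⟩, ?_⟩
  rw [X.res_res, ← X.res_res (hT ⟨x, hR hx⟩) inf_le_right, ht]
  exact huniq _ (inf_le_left.trans hR) _ _ (hres _ _ _ inf_le_right _ (hs _))
    (hres _ _ _ inf_le_left _ hr)

variable {X X'} in
theorem map_mem_oddIdeal_pow {U : Opens M} {U' : Opens M'} (φ : X.Sec U →ₐ[𝕜] X'.Sec U')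
    (hφ : ∀ s ∈ X.odd U, φ s ∈ X'.odd U') (k : ℕ) {s : X.Sec U} (hs : s ∈ X.oddIdeal U ^ k) :
    φ s ∈ X'.oddIdeal U' ^ k := by
  suffices key : X.oddIdeal U ^ k ≤ (X'.oddIdeal U' ^ k).comap φ from key hs
  clear hs s
  induction k with
  | zero => rw [Submodule.pow_zero, Submodule.pow_zero, Ideal.one_eq_top, Ideal.one_eq_top]; simp
  | succ k ih =>
    rw [Submodule.pow_succ, Submodule.pow_succ, Ideal.mul_le]
    intro r hr s hs
    rw [Ideal.mem_comap, map_mul]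
    refine Ideal.mul_mem_mul (ih hr) ?_
    have h1 : X.oddIdeal U ≤ (X'.oddIdeal U').comap φ := by
      rw [oddIdeal, Ideal.span_le]
      exact fun t ht => Ideal.subset_span (hφ t ht)
    exact h1 hs

theorem mem_J_of_mem_oddIdeal_pow {U : Opens M} {k : ℕ} {s : X.Sec U}
    (hs : s ∈ X.oddIdeal U ^ k) : s ∈ X.J k U :=
  fun _ hx => ⟨U, le_rfl, hx, by rwa [X.res_self]⟩

theorem res_mem_J {U W : Opens M} (h : W ≤ U) {k : ℕ} {s : X.Sec U} (hs : s ∈ X.J k U) :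
    X.res h s ∈ X.J k W :=
  X.J_le_comap h k hs

theorem J_antitone {U : Opens M} {k l : ℕ} (h : k ≤ l) : X.J l U ≤ X.J k U := by
  intro s hs x hx
  obtain ⟨W, hW, hxW, h'⟩ := hs x hx
  exact ⟨W, hW, hxW, Ideal.pow_le_pow_right h h'⟩

theorem mul_mem_J {U : Opens M} {k l : ℕ} {s t : X.Sec U} (hs : s ∈ X.J k U) (ht : t ∈ X.J l U) :
    s * t ∈ X.J (k + l) U := by
  intro x hx
  obtain ⟨W, hW, hxW, h⟩ := hs x hx
  obtain ⟨W', hW', hxW', h'⟩ := ht x hx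
  refine ⟨W ⊓ W', inf_le_left.trans hW, ⟨hxW, hxW'⟩, ?_⟩
  rw [map_mul, ← X.res_res hW inf_le_left, ← X.res_res hW' inf_le_right, Ideal.IsTwoSided.pow_add]
  exact Ideal.mul_mem_mul (X.oddIdeal_le_comap _ _ h) (X.oddIdeal_le_comap _ _ h')

end Gluing

section Quot

variable {𝕜 : Type} [Field 𝕜] {M : Type u} [TopologicalSpace M] (X : SuperSheaf 𝕜 M)

/-- The quotient map `O → O / J ^ k`, as a map between sections of the sheaves of superalgebras
`X` and `X.quot k`. -/
def proj (k : ℕ) (U : Opens M) : X.Sec U →ₐ[𝕜] (X.quot k).Sec U := X.toQuot k U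

theorem proj_odd (k : ℕ) {U : Opens M} {s : X.Sec U} (hs : s ∈ X.odd U) :
    X.proj k U s ∈ (X.quot k).odd U :=
  (X.quotHom k).app_odd hs

theorem proj_even (k : ℕ) {U : Opens M} {s : X.Sec U} (hs : s ∈ X.even U) :
    X.proj k U s ∈ (X.quot k).even U :=
  (X.quotHom k).app_even hs

theorem res_proj (k : ℕ) {U W : Opens M} (h : W ≤ U) (s : X.Sec U) :
    (X.quot k).res h (X.proj k U s) = X.proj k W (X.res h s) :=
  (X.toQuot_res k h s).symm

theorem proj_eq_iff (k : ℕ) {U : Opens M} (s t : X.Sec U) :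
    X.proj k U s = X.proj k U t ↔ s - t ∈ X.J k U :=
  X.toQuot_eq_iff k s t

theorem proj_eq_zero_iff (k : ℕ) {U : Opens M} (s : X.Sec U) :
    X.proj k U s = 0 ↔ s ∈ X.J k U :=
  X.toQuot_eq_zero_iff k s

theorem exists_proj (k : ℕ) {U : Opens M} (s : (X.quot k).Sec U) (x : M) (hx : x ∈ U) :
    ∃ (W : Opens M) (hW : W ≤ U), x ∈ W ∧ ∃ t : X.Sec W, X.proj k W t = (X.quot k).res hW s :=
  X.exists_toQuot k s x hx

theorem exists_proj_even (k : ℕ) {U : Opens M} {s : (X.quot k).Sec U} (hs : s ∈ (X.quot k).even U)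
    (x : M) (hx : x ∈ U) : ∃ (W : Opens M) (hW : W ≤ U), x ∈ W ∧
      ∃ t ∈ X.even W, X.proj k W t = (X.quot k).res hW s :=
  hs x hx

theorem exists_proj_odd (k : ℕ) {U : Opens M} {s : (X.quot k).Sec U} (hs : s ∈ (X.quot k).odd U)
    (x : M) (hx : x ∈ U) : ∃ (W : Opens M) (hW : W ≤ U), x ∈ W ∧
      ∃ t ∈ X.odd W, X.proj k W t = (X.quot k).res hW s :=
  hs x hx

theorem proj_mem_J (k l : ℕ) {U : Opens M} {s : X.Sec U} (hs : s ∈ X.J l U) :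
    X.proj k U s ∈ (X.quot k).J l U := by
  intro x hx
  obtain ⟨W, hW, hxW, h⟩ := hs x hx
  refine ⟨W, hW, hxW, ?_⟩
  rw [res_proj]
  exact map_mem_oddIdeal_pow (X.proj k W) (fun s hs => X.proj_odd k hs) l h

/-- Sections of the `l`-th power of the odd ideal of `O / J ^ k` lift locally to such sections. -/
theorem exists_proj_oddIdeal_pow (k l : ℕ) {U : Opens M} {s : (X.quot k).Sec U}
    (hs : s ∈ (X.quot k).oddIdeal U ^ l) (x : M) (hx : x ∈ U) :
    ∃ (W : Opens M) (hW : W ≤ U), x ∈ W ∧ ∃ t ∈ X.oddIdeal W ^ l,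
      X.proj k W t = (X.quot k).res hW s := by
  have hadd : ∀ (l : ℕ) (a b : (X.quot k).Sec U),
      (∃ (W : Opens M) (hW : W ≤ U), x ∈ W ∧ ∃ t ∈ X.oddIdeal W ^ l,
        X.proj k W t = (X.quot k).res hW a) →
      (∃ (W : Opens M) (hW : W ≤ U), x ∈ W ∧ ∃ t ∈ X.oddIdeal W ^ l,
        X.proj k W t = (X.quot k).res hW b) →
      ∃ (W : Opens M) (hW : W ≤ U), x ∈ W ∧ ∃ t ∈ X.oddIdeal W ^ l,
        X.proj k W t = (X.quot k).res hW (a + b) := by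
    rintro l a b ⟨W, hW, hxW, t, ht, e⟩ ⟨W', hW', hxW', t', ht', e'⟩
    refine ⟨W ⊓ W', inf_le_left.trans hW, ⟨hxW, hxW'⟩, X.res inf_le_left t + X.res inf_le_right t',
      add_mem (X.oddIdeal_le_comap _ _ ht) (X.oddIdeal_le_comap _ _ ht'), ?_⟩
    rw [map_add, map_add, ← res_proj, ← res_proj, e, e', res_res, res_res]
  have hmul : ∀ (l l' : ℕ) (a b : (X.quot k).Sec U),
      (∃ (W : Opens M) (hW : W ≤ U), x ∈ W ∧ ∃ t ∈ X.oddIdeal W ^ l,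
        X.proj k W t = (X.quot k).res hW a) →
      (∃ (W : Opens M) (hW : W ≤ U), x ∈ W ∧ ∃ t ∈ X.oddIdeal W ^ l',
        X.proj k W t = (X.quot k).res hW b) →
      ∃ (W : Opens M) (hW : W ≤ U), x ∈ W ∧ ∃ t ∈ X.oddIdeal W ^ (l + l'),
        X.proj k W t = (X.quot k).res hW (a * b) := by
    rintro l l' a b ⟨W, hW, hxW, t, ht, e⟩ ⟨W', hW', hxW', t', ht', e'⟩
    refine ⟨W ⊓ W', inf_le_left.trans hW, ⟨hxW, hxW'⟩, X.res inf_le_left t * X.res inf_le_right t',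
      ?_, ?_⟩
    · rw [Ideal.IsTwoSided.pow_add]
      exact Ideal.mul_mem_mul (X.oddIdeal_le_comap _ _ ht) (X.oddIdeal_le_comap _ _ ht')
    · rw [map_mul, map_mul, ← res_proj, ← res_proj, e, e', res_res, res_res]
  have htriv : ∀ a : (X.quot k).Sec U, ∃ (W : Opens M) (hW : W ≤ U), x ∈ W ∧
      ∃ t ∈ X.oddIdeal W ^ 0, X.proj k W t = (X.quot k).res hW a := by
    intro a
    obtain ⟨W, hW, hxW, t, ht⟩ := X.exists_proj k a x hx
    exact ⟨W, hW, hxW, t, by rw [Submodule.pow_zero, Ideal.one_eq_top]; trivial, ht⟩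
  have hone : ∀ a ∈ (X.quot k).oddIdeal U, ∃ (W : Opens M) (hW : W ≤ U), x ∈ W ∧
      ∃ t ∈ X.oddIdeal W ^ 1, X.proj k W t = (X.quot k).res hW a := by
    intro a ha
    unfold oddIdeal at ha
    induction ha using Submodule.span_induction with
    | mem a ha =>
      obtain ⟨W, hW, hxW, t, ht, e⟩ := X.exists_proj_odd k ha x hx
      exact ⟨W, hW, hxW, t, by rw [Submodule.pow_one]; exact Ideal.subset_span ht, e⟩
    | zero => exact ⟨U, le_rfl, hx, 0, zero_mem _, by rw [map_zero, map_zero]⟩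
    | add a b _ _ ha hb => exact hadd 1 a b ha hb
    | smul c a _ ha =>
      have := hmul 0 1 c a (htriv c) ha
      rwa [Nat.zero_add] at this
  induction l generalizing s with
  | zero => exact htriv s
  | succ l ih =>
    rw [Submodule.pow_succ] at hs
    refine Submodule.smul_induction_on hs ?_ ?_
    · intro a ha b hb
      exact hmul l 1 a b (ih ha) (hone b hb)
    · intro a b ha hb
      exact hadd _ a b ha hb

theorem exists_proj_of_mem_J (k l : ℕ) {U : Opens M} {s : (X.quot k).Sec U}
    (hs : s ∈ (X.quot k).J l U) (x : M) (hx : x ∈ U) :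
    ∃ (W : Opens M) (hW : W ≤ U), x ∈ W ∧ ∃ t ∈ X.J l W,
      X.proj k W t = (X.quot k).res hW s := by
  obtain ⟨W, hW, hxW, h⟩ := hs x hx
  obtain ⟨T, hT, hxT, t, ht, e⟩ := X.exists_proj_oddIdeal_pow k l h x hxW
  exact ⟨T, hT.trans hW, hxT, t, X.mem_J_of_mem_oddIdeal_pow ht, by rw [e, res_res]⟩

theorem quot_J_eq_bot (k : ℕ) (U : Opens M) : (X.quot k).J k U = ⊥ := by
  rw [eq_bot_iff]
  intro s hs
  refine (X.quot k).sec_ext fun x hx => ?_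
  obtain ⟨W, hW, hxW, t, ht, e⟩ := X.exists_proj_of_mem_J k k hs x hx
  refine ⟨W, hW, hxW, ?_⟩
  rw [← e, map_zero]
  exact (X.proj_eq_zero_iff k t).2 ht

end Quot

/-! ### Local isomorphisms over a local homeomorphism -/

variable {𝕜 : Type} [Field 𝕜] {M M' : Type u} [TopologicalSpace M] [TopologicalSpace M']

/-- An isomorphism of `X'|_U'` with the pullback of `X` along `f : M' → M`, for a local
homeomorphism `f`. It is given by the maps `X(W) → X'(W')` for `W' ≤ U'` and `f W' ⊆ W`, which have
to be bijective if `f` maps `W'` bijectively to `W`. For `f = id` this is an isomorphism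
`X|_U' ≅ X'|_U'`. -/
structure LocIso (f : M' → M) (U' : Opens M') (X : SuperSheaf 𝕜 M) (X' : SuperSheaf 𝕜 M') where
  /-- the pullback of sections -/
  pull (W : Opens M) (W' : Opens M') (h : W' ≤ U') (hf : Set.MapsTo f W' W) :
    X.Sec W →ₐ[𝕜] X'.Sec W'
  pull_res {W T : Opens M} {W' T' : Opens M'} (hT : T ≤ W) (hT' : T' ≤ W') (h : W' ≤ U')
    (hf : Set.MapsTo f W' W) (hf' : Set.MapsTo f T' T) (s : X.Sec W) :
    pull T T' (hT'.trans h) hf' (X.res hT s) = X'.res hT' (pull W W' h hf s)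
  pull_even {W : Opens M} {W' : Opens M'} (h : W' ≤ U') (hf : Set.MapsTo f W' W) {s : X.Sec W} :
    s ∈ X.even W → pull W W' h hf s ∈ X'.even W'
  pull_odd {W : Opens M} {W' : Opens M'} (h : W' ≤ U') (hf : Set.MapsTo f W' W) {s : X.Sec W} :
    s ∈ X.odd W → pull W W' h hf s ∈ X'.odd W'
  bijective (W : Opens M) (W' : Opens M') (h : W' ≤ U') (hf : Set.BijOn f W' W) :
    Function.Bijective (pull W W' h hf.mapsTo)

/-- Every point has arbitrarily small neighbourhoods which are mapped bijectively to arbitrarily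
small neighbourhoods of its image. -/
theorem exists_sheet {f : M' → M} (hf : IsLocalHomeomorph f) {W : Opens M} {W' : Opens M'} {x : M'}
    (hx : x ∈ W') (hfx : f x ∈ W) :
    ∃ (T : Opens M) (T' : Opens M'), T ≤ W ∧ T' ≤ W' ∧ x ∈ T' ∧ Set.BijOn f T' T := by
  obtain ⟨e, hxe, rfl⟩ := hf x
  have hopen : IsOpen (e.source ∩ W' ∩ e ⁻¹' W) :=
    (e.open_source.inter W'.isOpen).inter (W.isOpen.preimage hf.continuous)
  refine ⟨⟨_, hf.isOpenMap _ hopen⟩, ⟨_, hopen⟩, ?_, ?_, ⟨⟨hxe, hx⟩, hfx⟩, ?_⟩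
  · rintro _ ⟨y, hy, rfl⟩
    exact hy.2
  · exact fun y hy => hy.1.2
  · exact ⟨fun y hy => ⟨y, hy, rfl⟩, fun y hy z hz h => e.injOn hy.1.1 hz.1.1 h,
      fun y hy => hy⟩

namespace LocIso

variable {f : M' → M} {U' : Opens M'} {X Y : SuperSheaf 𝕜 M} {X' Y' : SuperSheaf 𝕜 M'}

section

variable (L : LocIso f U' X X')

theorem res_pull {W : Opens M} {W' T' : Opens M'} (hT' : T' ≤ W') (h : W' ≤ U')
    (hf : Set.MapsTo f W' W) (s : X.Sec W) :
    X'.res hT' (L.pull W W' h hf s) =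
      L.pull W T' (hT'.trans h) (fun _ hx => hf (hT' hx)) s := by
  have := L.pull_res le_rfl hT' h hf (fun _ hx => hf (hT' hx)) s
  rw [X.res_self] at this
  exact this.symm

theorem pull_res_left {W T : Opens M} {W' : Opens M'} (hT : T ≤ W) (h : W' ≤ U')
    (hf : Set.MapsTo f W' T) (s : X.Sec W) :
    L.pull T W' h hf (X.res hT s) = L.pull W W' h (fun _ hx => hT (hf hx)) s := by
  have := L.pull_res hT le_rfl h (fun _ hx => hT (hf hx)) hf s
  rw [X'.res_self] at this
  exact this

/-- The isomorphism of sections over a sheet. -/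
def sheet {W : Opens M} {W' : Opens M'} (h : W' ≤ U') (hf : Set.BijOn f W' W) :
    X.Sec W ≃ₐ[𝕜] X'.Sec W' :=
  AlgEquiv.ofBijective (L.pull W W' h hf.mapsTo) (L.bijective W W' h hf)

theorem sheet_apply {W : Opens M} {W' : Opens M'} (h : W' ≤ U') (hf : Set.BijOn f W' W)
    (s : X.Sec W) : L.sheet h hf s = L.pull W W' h hf.mapsTo s := rfl

theorem pull_sheet_symm {W : Opens M} {W' : Opens M'} (h : W' ≤ U') (hf : Set.BijOn f W' W)
    (s : X'.Sec W') : L.pull W W' h hf.mapsTo ((L.sheet h hf).symm s) = s :=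
  (L.sheet h hf).apply_symm_apply s

theorem sheet_symm_res {W T : Opens M} {W' T' : Opens M'} (hT : T ≤ W) (hT' : T' ≤ W')
    (h : W' ≤ U') (hf : Set.BijOn f W' W) (hf' : Set.BijOn f T' T) (s : X'.Sec W') :
    (L.sheet (hT'.trans h) hf').symm (X'.res hT' s) = X.res hT ((L.sheet h hf).symm s) := by
  rw [AlgEquiv.symm_apply_eq, sheet_apply, L.pull_res_left, ← L.res_pull hT' h hf.mapsTo,
    pull_sheet_symm]

theorem sheet_symm_even {W : Opens M} {W' : Opens M'} (h : W' ≤ U') (hf : Set.BijOn f W' W)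
    {s : X'.Sec W'} (hs : s ∈ X'.even W') : (L.sheet h hf).symm s ∈ X.even W := by
  obtain ⟨a, ha, b, hb, e⟩ := X.exists_even_odd ((L.sheet h hf).symm s)
  have e' : s + 0 = L.sheet h hf a + L.sheet h hf b := by
    rw [← map_add, ← e, AlgEquiv.apply_symm_apply, add_zero]
  have := (X'.even_odd_unique hs (zero_mem _) (L.pull_even h hf.mapsTo ha)
    (L.pull_odd h hf.mapsTo hb) e').1
  rw [this, ← L.sheet_apply h hf, AlgEquiv.symm_apply_apply]
  exact ha

theorem sheet_symm_odd {W : Opens M} {W' : Opens M'} (h : W' ≤ U') (hf : Set.BijOn f W' W)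
    {s : X'.Sec W'} (hs : s ∈ X'.odd W') : (L.sheet h hf).symm s ∈ X.odd W := by
  obtain ⟨a, ha, b, hb, e⟩ := X.exists_even_odd ((L.sheet h hf).symm s)
  have e' : 0 + s = L.sheet h hf a + L.sheet h hf b := by
    rw [← map_add, ← e, AlgEquiv.apply_symm_apply, zero_add]
  have := (X'.even_odd_unique (zero_mem _) hs (L.pull_even h hf.mapsTo ha)
    (L.pull_odd h hf.mapsTo hb) e').2
  rw [this, ← L.sheet_apply h hf, AlgEquiv.symm_apply_apply]
  exact hb

variable (hf : IsLocalHomeomorph f)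
include hf

/-- Sections of `X'` are locally pulled back from `X`. -/
theorem exists_pull {W' : Opens M'} (h : W' ≤ U') (s : X'.Sec W') (x : M') (hx : x ∈ W')
    {W : Opens M} (hW : f x ∈ W) :
    ∃ (T : Opens M) (T' : Opens M') (_ : T ≤ W) (hT' : T' ≤ W') (hT : Set.BijOn f T' T), x ∈ T' ∧
      ∃ t, L.pull T T' (hT'.trans h) hT.mapsTo t = X'.res hT' s := by
  obtain ⟨T, T', hT, hT', hxT', hb⟩ := exists_sheet hf hx hW
  exact ⟨T, T', hT, hT', hb, hxT', _, L.pull_sheet_symm (hT'.trans h) hb _⟩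

theorem pull_mem_J {W : Opens M} {W' : Opens M'} (h : W' ≤ U') (hW : Set.MapsTo f W' W) {k : ℕ}
    {s : X.Sec W} (hs : s ∈ X.J k W) : L.pull W W' h hW s ∈ X'.J k W' := by
  intro x hx
  obtain ⟨T, hT, hxT, hs'⟩ := hs (f x) (hW hx)
  obtain ⟨R, R', hR, hR', hxR', hb⟩ := exists_sheet hf hx hxT
  refine ⟨R', hR', hxR', ?_⟩
  rw [← L.pull_res (hR.trans hT) hR' h hW hb.mapsTo, ← X.res_res hT hR]
  exact map_mem_oddIdeal_pow _ (fun s hs => L.pull_odd _ _ hs) k (X.oddIdeal_le_comap hR k hs')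

theorem mem_J_of_pull {W : Opens M} {W' : Opens M'} (h : W' ≤ U') (hW : Set.BijOn f W' W) {k : ℕ}
    {s : X.Sec W} (hs : L.pull W W' h hW.mapsTo s ∈ X'.J k W') : s ∈ X.J k W := by
  intro y hy
  obtain ⟨x, hx, rfl⟩ := hW.surjOn hy
  obtain ⟨T', hT', hxT', hs'⟩ := hs x hx
  obtain ⟨R, R', hR, hR', hxR', hb⟩ := exists_sheet hf hxT' hy
  refine ⟨R, hR, hb.mapsTo hxR', ?_⟩
  have h1 := map_mem_oddIdeal_pow (L.sheet ((hR'.trans hT').trans h) hb).symm.toAlgHom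
    (fun s hs => L.sheet_symm_odd _ _ hs) k (X'.oddIdeal_le_comap hR' k hs')
  rw [X'.res_res] at h1
  have h2 : (L.sheet ((hR'.trans hT').trans h) hb).symm
      (X'.res (hR'.trans hT') (L.pull W W' h hW.mapsTo s)) ∈ X.oddIdeal R ^ k := h1
  rwa [L.sheet_symm_res hR (hR'.trans hT') h hW, ← L.sheet_apply h hW,
    AlgEquiv.symm_apply_apply] at h2

theorem sheet_symm_mem_J {W : Opens M} {W' : Opens M'} (h : W' ≤ U') (hW : Set.BijOn f W' W)
    {k : ℕ} {s : X'.Sec W'} (hs : s ∈ X'.J k W') : (L.sheet h hW).symm s ∈ X.J k W := by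
  refine L.mem_J_of_pull hf h hW ?_
  rwa [pull_sheet_symm]

/-- Two sections with the same pullback agree near the image of each point. -/
theorem eq_near_of_pull_eq {W₁ W₂ : Opens M} {W' : Opens M'} (h : W' ≤ U')
    (h₁ : Set.MapsTo f W' W₁) (h₂ : Set.MapsTo f W' W₂) {s₁ : X.Sec W₁} {s₂ : X.Sec W₂}
    (e : L.pull W₁ W' h h₁ s₁ = L.pull W₂ W' h h₂ s₂) (x : M') (hx : x ∈ W') :
    ∃ (T : Opens M) (T' : Opens M') (hT₁ : T ≤ W₁) (hT₂ : T ≤ W₂) (_ : T' ≤ W')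
      (_ : Set.BijOn f T' T), x ∈ T' ∧ X.res hT₁ s₁ = X.res hT₂ s₂ := by
  obtain ⟨T, T', hT, hT', hxT', hb⟩ :=
    exists_sheet (W := W₁ ⊓ W₂) hf hx ⟨h₁ hx, h₂ hx⟩
  refine ⟨T, T', hT.trans inf_le_left, hT.trans inf_le_right, hT', hb, hxT', ?_⟩
  apply (L.bijective T T' (hT'.trans h) hb).1
  rw [L.pull_res (hT.trans inf_le_left) hT' h h₁, L.pull_res (hT.trans inf_le_right) hT' h h₂, e]

end

/-- An operator `X → Y` on sections pulls back to an operator `X' → Y'`. -/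
theorem exists_pullOp (L : LocIso f ⊤ X X') (K : LocIso f ⊤ Y Y') (hf : IsLocalHomeomorph f)
    (O : ∀ U : Opens M, X.Sec U → Y.Sec U)
    (hO : ∀ {U W : Opens M} (h : W ≤ U) (s : X.Sec U), O W (X.res h s) = Y.res h (O U s)) :
    ∃ O' : ∀ U' : Opens M', X'.Sec U' → Y'.Sec U',
      (∀ {U W : Opens M'} (h : W ≤ U) (s : X'.Sec U), O' W (X'.res h s) = Y'.res h (O' U s)) ∧
      ∀ (W : Opens M) (W' : Opens M') (h : Set.MapsTo f W' W) (s : X.Sec W),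
        O' W' (L.pull W W' le_top h s) = K.pull W W' le_top h (O W s) := by
  have key : ∀ (W' : Opens M') (s : X'.Sec W'), ∃ t : Y'.Sec W',
      ∀ (T' : Opens M') (hT' : T' ≤ W') (b : Y'.Sec T'),
        (∃ (T : Opens M) (h : Set.MapsTo f T' T) (r : X.Sec T),
          L.pull T T' le_top h r = X'.res hT' s ∧ K.pull T T' le_top h (O T r) = b) →
        Y'.res hT' t = b := by
    intro W' s
    refine Y'.exists_glue (fun T' hT' b => ∃ (T : Opens M) (h : Set.MapsTo f T' T) (r : X.Sec T),
          L.pull T T' le_top h r = X'.res hT' s ∧ K.pull T T' le_top h (O T r) = b) ?_ ?_ ?_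
    · rintro T' R' hT' hR' b ⟨T, h, r, e, e'⟩
      refine ⟨T, fun x hx => h (hR' hx), r, ?_, ?_⟩
      · rw [← L.res_pull hR' le_top h, e, X'.res_res]
      · rw [← K.res_pull hR' le_top h, e']
    · rintro T' hT' b b' ⟨T, h, r, e, rfl⟩ ⟨T₂, h₂, r₂, e₂, rfl⟩
      refine Y'.sec_ext fun x hx => ?_
      obtain ⟨R, R', hR₁, hR₂, hR', hb, hxR', e₃⟩ :=
        L.eq_near_of_pull_eq hf le_top h h₂ (e.trans e₂.symm) x hx
      refine ⟨R', hR', hxR', ?_⟩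
      rw [← K.pull_res hR₁ hR' le_top h hb.mapsTo, ← K.pull_res hR₂ hR' le_top h₂ hb.mapsTo,
        ← hO, ← hO, e₃]
    · intro x hx
      obtain ⟨T, T', -, hT', hb, hxT', r, e⟩ :=
        L.exists_pull hf le_top s x hx (W := ⊤) trivial
      exact ⟨T', hT', hxT', _, T, hb.mapsTo, r, e, rfl⟩
  choose O' hO' using key
  refine ⟨O', ?_, ?_⟩
  · intro U W h s
    refine Y'.sec_ext fun x hx => ?_
    obtain ⟨T, T', -, hT', hb, hxT', r, e⟩ :=
      L.exists_pull hf le_top (X'.res h s) x hx (W := ⊤) trivial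
    refine ⟨T', hT', hxT', ?_⟩
    rw [hO' W _ T' hT' _ ⟨T, hb.mapsTo, r, e, rfl⟩, Y'.res_res]
    exact (hO' U s T' (hT'.trans h) _ ⟨T, hb.mapsTo, r, by rw [e, X'.res_res], rfl⟩).symm
  · intro W W' h s
    have := hO' W' (L.pull W W' le_top h s) W' le_rfl _ ⟨W, h, s, by rw [X'.res_self], rfl⟩
    rwa [Y'.res_self] at this

end LocIso

namespace LocIso

section Quot

variable {𝕜 : Type} [Field 𝕜] {M M' : Type u} [TopologicalSpace M] [TopologicalSpace M']
  {f : M' → M} {U' : Opens M'} {X : SuperSheaf 𝕜 M} {X' : SuperSheaf 𝕜 M'}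
  (L : LocIso f U' X X') (hf : IsLocalHomeomorph f)
include hf

theorem exists_quotPull (k : ℕ) (W : Opens M) (W' : Opens M') (h : W' ≤ U')
    (hW : Set.MapsTo f W' W) (s : (X.quot k).Sec W) :
    ∃ t : (X'.quot k).Sec W', ∀ (T : Opens M) (T' : Opens M') (hT : T ≤ W) (hT' : T' ≤ W')
      (hTT : Set.MapsTo f T' T) (r : X.Sec T), X.proj k T r = (X.quot k).res hT s →
      (X'.quot k).res hT' t = X'.proj k T' (L.pull T T' (hT'.trans h) hTT r) := by
  refine ((X'.quot k).exists_glue (W := W') (fun T' hT' b =>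
    ∃ (T : Opens M) (hT : T ≤ W) (hTT : Set.MapsTo f T' T) (r : X.Sec T),
      X.proj k T r = (X.quot k).res hT s ∧ X'.proj k T' (L.pull T T' (hT'.trans h) hTT r) = b)
    ?_ ?_ ?_).imp fun t ht T T' hT hT' hTT r e => ht T' hT' _ ⟨T, hT, hTT, r, e, rfl⟩
  · rintro T' R' hT' hR' b ⟨T, hT, hTT, r, e, rfl⟩
    refine ⟨T, hT, fun x hx => hTT (hR' hx), r, e, ?_⟩
    rw [res_proj, L.res_pull]
  · rintro T' hT' b b' ⟨T, hT, hTT, r, e, rfl⟩ ⟨R, hR, hRR, r', e', rfl⟩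
    have hTR : Set.MapsTo f T' (T ⊓ R : Opens M) := fun x hx => ⟨hTT hx, hRR hx⟩
    have h1 : X.res inf_le_left r - X.res inf_le_right r' ∈ X.J k (T ⊓ R) := by
      rw [← X.proj_eq_iff, ← res_proj, ← res_proj, e, e', res_res, res_res]
    have h2 := L.pull_mem_J hf (hT'.trans h) hTR h1
    rwa [map_sub, L.pull_res_left, L.pull_res_left, ← X'.proj_eq_iff] at h2
  · intro x hx
    obtain ⟨T, hT, hxT, r, e⟩ := X.exists_proj k s (f x) (hW hx)
    obtain ⟨R, R', hR, hR', hxR', hb⟩ := exists_sheet hf hx hxT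
    refine ⟨R', hR', hxR', _, R, hR.trans hT, hb.mapsTo, X.res hR r, ?_, rfl⟩
    rw [← res_proj, e, res_res]

/-- The pullback of sections of `O / J ^ k`. -/
def quotPull (k : ℕ) (W : Opens M) (W' : Opens M') (h : W' ≤ U')
    (hW : Set.MapsTo f W' W) (s : (X.quot k).Sec W) : (X'.quot k).Sec W' :=
  (L.exists_quotPull hf k W W' h hW s).choose

theorem res_quotPull (k : ℕ) {W : Opens M} {W' : Opens M'} (h : W' ≤ U')
    (hW : Set.MapsTo f W' W) (s : (X.quot k).Sec W) {T : Opens M} {T' : Opens M'} (hT : T ≤ W)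
    (hT' : T' ≤ W') (hTT : Set.MapsTo f T' T) (r : X.Sec T)
    (e : X.proj k T r = (X.quot k).res hT s) :
    (X'.quot k).res hT' (L.quotPull hf k W W' h hW s) =
      X'.proj k T' (L.pull T T' (hT'.trans h) hTT r) :=
  (L.exists_quotPull hf k W W' h hW s).choose_spec T T' hT hT' hTT r e

theorem quotPull_proj (k : ℕ) {W : Opens M} {W' : Opens M'} (h : W' ≤ U')
    (hW : Set.MapsTo f W' W) (s : X.Sec W) :
    L.quotPull hf k W W' h hW (X.proj k W s) = X'.proj k W' (L.pull W W' h hW s) := by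
  have := L.res_quotPull hf k h hW (X.proj k W s) le_rfl le_rfl hW s
    (by rw [(X.quot k).res_self])
  rwa [(X'.quot k).res_self] at this

/-- To check an identity between sections built by pullback, one may assume that the sections of
the quotient sheaf lift. -/
theorem quot_lift_near (k : ℕ) {W : Opens M} {W' : Opens M'}
    (hW : Set.MapsTo f W' W) (s t : (X.quot k).Sec W) (x : M') (hx : x ∈ W') :
    ∃ (T : Opens M) (T' : Opens M') (hT : T ≤ W) (_ : T' ≤ W') (_ : Set.BijOn f T' T), x ∈ T' ∧
      ∃ a b : X.Sec T, X.proj k T a = (X.quot k).res hT s ∧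
        X.proj k T b = (X.quot k).res hT t := by
  obtain ⟨T, hT, hxT, r, e⟩ := X.exists_proj k s (f x) (hW hx)
  obtain ⟨T₂, hT₂, hxT₂, r₂, e₂⟩ := X.exists_proj k t (f x) (hW hx)
  obtain ⟨R, R', hR, hR', hxR', hb⟩ := exists_sheet (W := T ⊓ T₂) hf hx ⟨hxT, hxT₂⟩
  refine ⟨R, R', hR.trans (inf_le_left.trans hT), hR', hb, hxR',
    X.res (hR.trans inf_le_left) r, X.res (hR.trans inf_le_right) r₂, ?_, ?_⟩
  · rw [← res_proj, e, res_res]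
  · rw [← res_proj, e₂, res_res]

/-- A local isomorphism induces local isomorphisms of the quotient sheaves `O / J ^ k`. -/
def quot (k : ℕ) : LocIso f U' (X.quot k) (X'.quot k) where
  pull W W' h hW :=
    { toFun := L.quotPull hf k W W' h hW
      map_one' := by
        have := L.quotPull_proj hf k h hW 1
        rwa [map_one, map_one, map_one] at this
      map_zero' := by
        have := L.quotPull_proj hf k h hW 0
        rwa [map_zero, map_zero, map_zero] at this
      map_mul' := fun s t => by
        refine (X'.quot k).sec_ext fun x hx => ?_
        obtain ⟨T, T', hT, hT', hb, hxT', a, b, ha, hb'⟩ := quot_lift_near hf k hW s t x hx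
        refine ⟨T', hT', hxT', ?_⟩
        rw [map_mul, L.res_quotPull hf k h hW s hT hT' hb.mapsTo a ha,
          L.res_quotPull hf k h hW t hT hT' hb.mapsTo b hb',
          L.res_quotPull hf k h hW (s * t) hT hT' hb.mapsTo (a * b)
            (by rw [map_mul, map_mul, ha, hb']), map_mul, map_mul]
      map_add' := fun s t => by
        refine (X'.quot k).sec_ext fun x hx => ?_
        obtain ⟨T, T', hT, hT', hb, hxT', a, b, ha, hb'⟩ := quot_lift_near hf k hW s t x hx
        refine ⟨T', hT', hxT', ?_⟩
        rw [map_add, L.res_quotPull hf k h hW s hT hT' hb.mapsTo a ha,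
          L.res_quotPull hf k h hW t hT hT' hb.mapsTo b hb',
          L.res_quotPull hf k h hW (s + t) hT hT' hb.mapsTo (a + b)
            (by rw [map_add, map_add, ha, hb']), map_add, map_add]
      commutes' := fun c => by
        have := L.quotPull_proj hf k h hW (algebraMap 𝕜 _ c)
        rwa [AlgHom.commutes, AlgHom.commutes, AlgHom.commutes] at this }
  pull_res {W T W' T'} hT hT' h hW hW' s := by
    refine (X'.quot k).sec_ext fun x hx => ?_
    obtain ⟨R, R', hR, hR', hb, hxR', a, -, ha, -⟩ :=
      quot_lift_near hf k hW' ((X.quot k).res hT s) 0 x hx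
    refine ⟨R', hR', hxR', ?_⟩
    have ha' := ha
    rw [res_res] at ha'
    refine (L.res_quotPull hf k (hT'.trans h) hW' _ hR hR' hb.mapsTo a ha).trans ?_
    rw [res_res]
    exact (L.res_quotPull hf k h hW s (hR.trans hT) (hR'.trans hT') hb.mapsTo a ha').symm
  pull_even {W W'} h hW {s} hs := by
    intro x hx
    obtain ⟨T, hT, hxT, a, ha, e⟩ := hs (f x) (hW hx)
    obtain ⟨R, R', hR, hR', hxR', hb⟩ := exists_sheet hf hx hxT
    refine ⟨R', hR', hxR', _, L.pull_even (hR'.trans h) hb.mapsTo (X.res_even hR ha), ?_⟩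
    refine (L.res_quotPull hf k h hW s (hR.trans hT) hR' hb.mapsTo (X.res hR a) ?_).symm
    rw [← res_proj, ← res_res (X.quot k) hT hR]
    exact congrArg _ e
  pull_odd {W W'} h hW {s} hs := by
    intro x hx
    obtain ⟨T, hT, hxT, a, ha, e⟩ := hs (f x) (hW hx)
    obtain ⟨R, R', hR, hR', hxR', hb⟩ := exists_sheet hf hx hxT
    refine ⟨R', hR', hxR', _, L.pull_odd (hR'.trans h) hb.mapsTo (X.res_odd hR ha), ?_⟩
    refine (L.res_quotPull hf k h hW s (hR.trans hT) hR' hb.mapsTo (X.res hR a) ?_).symm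
    rw [← res_proj, ← res_res (X.quot k) hT hR]
    exact congrArg _ e
  bijective W W' h hW := by
    constructor
    · intro s t e
      refine (X.quot k).sec_ext fun y hy => ?_
      obtain ⟨x, hx, rfl⟩ := hW.surjOn hy
      obtain ⟨T, T', hT, hT', hb, hxT', a, b, ha, hb'⟩ :=
        quot_lift_near hf k hW.mapsTo s t x hx
      refine ⟨T, hT, hb.mapsTo hxT', ?_⟩
      have e' : L.quotPull hf k W W' h hW.mapsTo s = L.quotPull hf k W W' h hW.mapsTo t := e
      have e2 := congrArg ((X'.quot k).res hT') e'
      rw [L.res_quotPull hf k h hW.mapsTo s hT hT' hb.mapsTo a ha,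
        L.res_quotPull hf k h hW.mapsTo t hT hT' hb.mapsTo b hb', X'.proj_eq_iff, ← map_sub] at e2
      rw [← ha, ← hb', X.proj_eq_iff]
      exact L.mem_J_of_pull hf (hT'.trans h) hb e2
    · intro t
      refine ((X.quot k).exists_glue (W := W) (fun T hT b =>
        ∃ (T' : Opens M') (hT' : T' ≤ W') (hTT : Set.BijOn f T' T) (r : X.Sec T),
          X'.proj k T' (L.pull T T' (hT'.trans h) hTT.mapsTo r) = (X'.quot k).res hT' t ∧
          X.proj k T r = b) ?_ ?_ ?_).imp fun s hs => (X'.quot k).sec_ext fun x hx => ?_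
      · rintro T R hT hR b ⟨T', hT', hTT, r, e, rfl⟩
        have ho : IsOpen (T' ∩ f ⁻¹' R : Set M') :=
          T'.isOpen.inter (R.isOpen.preimage hf.continuous)
        have hle : (⟨_, ho⟩ : Opens M') ≤ T' := fun x hx => hx.1
        have hbij : Set.BijOn f (⟨_, ho⟩ : Opens M') R := by
          refine ⟨fun x hx => hx.2, hTT.injOn.mono hle, fun y hy => ?_⟩
          obtain ⟨x, hx, rfl⟩ := hTT.surjOn (hR hy)
          exact ⟨x, ⟨hx, hy⟩, rfl⟩
        refine ⟨⟨_, ho⟩, hle.trans hT', hbij, X.res hR r, ?_, ?_⟩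
        · rw [L.pull_res hR hle (hT'.trans h) hTT.mapsTo, ← res_proj, e, res_res]
        · rw [res_proj]
      · rintro T hT b b' ⟨T', hT', hTT, r, e, rfl⟩ ⟨R', hR', hRR, r', e', rfl⟩
        have hTR : T' = R' := by
          apply le_antisymm
          · intro x hx
            obtain ⟨z, hz, hzx⟩ := hRR.surjOn (hTT.mapsTo hx)
            rwa [← hW.injOn (hR' hz) (hT' hx) hzx]
          · intro x hx
            obtain ⟨z, hz, hzx⟩ := hTT.surjOn (hRR.mapsTo hx)
            rwa [← hW.injOn (hT' hz) (hR' hx) hzx]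
        subst hTR
        rw [X.proj_eq_iff]
        apply L.mem_J_of_pull hf (hT'.trans h) hTT
        rw [map_sub, ← X'.proj_eq_iff, e, e']
      · intro y hy
        obtain ⟨x, hx, rfl⟩ := hW.surjOn hy
        obtain ⟨R, hR, hxR, r, e⟩ := X'.exists_proj k t x hx
        obtain ⟨T, T', hT, hT', hb, hxT', q, e'⟩ :=
          L.exists_pull hf (hR.trans h) r x hxR (W := W) hy
        refine ⟨T, hT, hb.mapsTo hxT', _, T', hT'.trans hR, hb, q, ?_, rfl⟩
        rw [e', ← res_proj, e, res_res]
      · obtain ⟨R, hR, hxR, r, e⟩ := X'.exists_proj k t x hx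
        obtain ⟨T, T', hT, hT', hb, hxT', q, e'⟩ :=
          L.exists_pull hf (hR.trans h) r x hxR (W := W) (hW.mapsTo hx)
        refine ⟨T', hT'.trans hR, hxT', ?_⟩
        have e2 : X'.proj k T' (L.pull T T' ((hT'.trans hR).trans h) hb.mapsTo q) =
            (X'.quot k).res (hT'.trans hR) t := by
          rw [e', ← res_proj, e, res_res]
        rw [← e2]
        exact L.res_quotPull hf k h hW.mapsTo s hT (hT'.trans hR) hb.mapsTo q
          (hs T hT _ ⟨T', hT'.trans hR, hb, q, e2, rfl⟩).symm

theorem quot_pull_proj (k : ℕ) {W : Opens M} {W' : Opens M'} (h : W' ≤ U')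
    (hW : Set.MapsTo f W' W) (s : X.Sec W) :
    (L.quot hf k).pull W W' h hW (X.proj k W s) = X'.proj k W' (L.pull W W' h hW s) :=
  L.quotPull_proj hf k h hW s

end Quot

end LocIso

/-! ### Isomorphisms over an open set, and coverings, as local isomorphisms -/

section IsoOn

variable {𝕜 : Type} [Field 𝕜] {M : Type u} [TopologicalSpace M] {U : Opens M}
  {X Y : SuperSheaf 𝕜 M}

theorem isLocalHomeomorph_id : IsLocalHomeomorph (id : M → M) :=
  (Homeomorph.refl M).isLocalHomeomorph

/-- An isomorphism over `U` as a local isomorphism over the identity. -/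
def IsoOn.toLocIso (g : IsoOn U X Y) : LocIso id U X Y where
  pull _ W' h hf := (g.app W' h).toAlgHom.comp (X.res hf)
  pull_res {W T W' T'} hT hT' h hf hf' s := by
    have hf₁ : W' ≤ W := hf
    have hf₂ : T' ≤ T := hf'
    change g.app T' _ (X.res hf₂ (X.res hT s)) = Y.res hT' (g.app W' h (X.res hf₁ s))
    rw [X.res_res, ← g.app_res h hT', X.res_res]
  pull_even h hf _ hs := g.app_even h (X.res_even hf hs)
  pull_odd h hf _ hs := g.app_odd h (X.res_odd hf hs)
  bijective W W' h hf := by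
    obtain rfl : W = W' := by
      apply Opens.ext
      have := hf.image_eq
      rwa [Set.image_id, eq_comm] at this
    have e : (g.app W h).toAlgHom.comp (X.res hf.mapsTo) = (g.app W h).toAlgHom := by
      ext s
      exact congrArg (g.app W h) (X.res_self s)
    rw [e]
    exact (g.app W h).bijective

/-- A local isomorphism over the identity as an isomorphism over `U`. -/
def LocIso.toIsoOn (L : LocIso id U X Y) : IsoOn U X Y where
  app _ hW := L.sheet hW (Set.bijOn_id _)
  app_res hW h s := L.pull_res h h hW (Set.mapsTo_id _) (Set.mapsTo_id _) s
  app_even hW _ hs := L.pull_even hW (Set.mapsTo_id _) hs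
  app_odd hW _ hs := L.pull_odd hW (Set.mapsTo_id _) hs

theorem IsoOn.toLocIso_pull (g : IsoOn U X Y) {W : Opens M} (hW : W ≤ U) (s : X.Sec W) :
    g.toLocIso.pull W W hW (Set.mapsTo_id _) s = g.app W hW s :=
  congrArg (g.app W hW) (X.res_self s)

theorem IsoOn.app_mem_J (g : IsoOn U X Y) {W : Opens M} (hW : W ≤ U) {k : ℕ} {s : X.Sec W}
    (hs : s ∈ X.J k W) : g.app W hW s ∈ Y.J k W := by
  have := g.toLocIso.pull_mem_J isLocalHomeomorph_id hW (Set.mapsTo_id _) hs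
  rwa [g.toLocIso_pull] at this

/-- The inverse of an isomorphism. -/
def IsoOn.symm (g : IsoOn U X Y) : IsoOn U Y X where
  app W hW := (g.app W hW).symm
  app_res {W T} hW h s := by
    rw [AlgEquiv.symm_apply_eq, g.app_res hW h, AlgEquiv.apply_symm_apply]
  app_even hW _ hs := g.symm_app_even hW hs
  app_odd hW _ hs := g.symm_app_odd hW hs

/-- The composition of isomorphisms. -/
def IsoOn.comp {Z : SuperSheaf 𝕜 M} (g : IsoOn U Y Z) (h : IsoOn U X Y) : IsoOn U X Z where
  app W hW := (h.app W hW).trans (g.app W hW)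
  app_res {W T} hW hT s := by
    rw [AlgEquiv.trans_apply, AlgEquiv.trans_apply, h.app_res hW hT, g.app_res hW hT]
  app_even hW _ hs := g.app_even hW (h.app_even hW hs)
  app_odd hW _ hs := g.app_odd hW (h.app_odd hW hs)

/-- The isomorphism of the quotient sheaves `O / J ^ k` induced by an isomorphism. -/
def IsoOn.quot (g : IsoOn U X Y) (k : ℕ) : IsoOn U (X.quot k) (Y.quot k) :=
  (g.toLocIso.quot isLocalHomeomorph_id k).toIsoOn

theorem IsoOn.quot_app_proj (g : IsoOn U X Y) (k : ℕ) {W : Opens M} (hW : W ≤ U) (s : X.Sec W) :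
    (g.quot k).app W hW (X.proj k W s) = Y.proj k W (g.app W hW s) := by
  rw [← g.toLocIso_pull]
  exact g.toLocIso.quot_pull_proj isLocalHomeomorph_id k hW (Set.mapsTo_id _) s

end IsoOn

section Covering

variable {𝕜 : Type} [RCLike 𝕜] {n : WithTop ℕ∞} {m : ℕ} {M M' : Type u} [TopologicalSpace M]
  [ChartedSpace (Std 𝕜 m) M] [TopologicalSpace M'] [ChartedSpace (Std 𝕜 m) M']
  {S : SuperSheaf 𝕜 M} {S' : SuperSheaf 𝕜 M'}

/-- A covering of supermanifolds as a local isomorphism. -/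
def _root_.FiniteCovering.toLocIso (π : FiniteCovering n m S' S) : LocIso π.base ⊤ S S' where
  pull W W' _ hf := (S'.res (W := W') (U := W.comap ⟨π.base, π.isCoveringMap.continuous⟩)
    hf).comp (π.pull W)
  pull_res {W T W' T'} hT hT' _ hf hf' s := by
    have hf₁ : W' ≤ W.comap ⟨π.base, π.isCoveringMap.continuous⟩ := hf
    have hf₂ : T' ≤ T.comap ⟨π.base, π.isCoveringMap.continuous⟩ := hf'
    change S'.res hf₂ (π.pull T (S.res hT s)) = S'.res hT' (S'.res hf₁ (π.pull W s))
    have hTW : T.comap ⟨π.base, π.isCoveringMap.continuous⟩ ≤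
        W.comap ⟨π.base, π.isCoveringMap.continuous⟩ := fun _ hx => hT hx
    rw [π.pull_res, S'.res_res]
    exact S'.res_res hTW hf₂ _
  pull_even _ _ _ hs := S'.res_even _ (π.pull_even hs)
  pull_odd _ _ _ hs := S'.res_odd _ (π.pull_odd hs)
  bijective W W' _ hf := π.bijective W W' hf.mapsTo hf

end Covering

/-! ### Euler derivations -/

variable {𝕜 : Type} [Field 𝕜] {M M' : Type u} [TopologicalSpace M] [TopologicalSpace M']

/-- An Euler derivation of a sheaf of superalgebras: an even derivation which acts on
`J ^ k / J ^ (k + 1)` as multiplication by `k`. -/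
structure Euler (X : SuperSheaf 𝕜 M) where
  /-- the derivation on sections -/
  app (U : Opens M) : X.Sec U →ₗ[𝕜] X.Sec U
  app_res {U W : Opens M} (h : W ≤ U) (s : X.Sec U) : app W (X.res h s) = X.res h (app U s)
  app_mul {U : Opens M} (s t : X.Sec U) : app U (s * t) = app U s * t + s * app U t
  app_even {U : Opens M} {s : X.Sec U} : s ∈ X.even U → app U s ∈ X.even U
  app_odd {U : Opens M} {s : X.Sec U} : s ∈ X.odd U → app U s ∈ X.odd U
  app_J {U : Opens M} {k : ℕ} {s : X.Sec U} :
    s ∈ X.J k U → app U s - (k : 𝕜) • s ∈ X.J (k + 1) U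

theorem smul_mem_J {X : SuperSheaf 𝕜 M} {U : Opens M} {k : ℕ} (c : 𝕜) {s : X.Sec U}
    (hs : s ∈ X.J k U) : c • s ∈ X.J k U := by
  rw [← smul_one_mul c s]
  exact (X.J k U).mul_mem_left _ hs

/-- Parity is a local property. -/
theorem even_of_locally (X : SuperSheaf 𝕜 M) {U : Opens M} {s : X.Sec U}
    (h : ∀ x ∈ U, ∃ (W : Opens M) (hW : W ≤ U), x ∈ W ∧ X.res hW s ∈ X.even W) :
    s ∈ X.even U := by
  obtain ⟨a, ha, b, hb, rfl⟩ := X.exists_even_odd s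
  have hb0 : b = 0 := by
    refine X.sec_ext fun x hx => ?_
    obtain ⟨W, hW, hxW, hs⟩ := h x hx
    refine ⟨W, hW, hxW, ?_⟩
    rw [map_zero]
    rw [map_add] at hs
    exact (X.even_odd_unique (X.res_even hW ha) (X.res_odd hW hb) hs (zero_mem _)
      (add_zero _).symm).2
  rw [hb0, add_zero]
  exact ha

theorem odd_of_locally (X : SuperSheaf 𝕜 M) {U : Opens M} {s : X.Sec U}
    (h : ∀ x ∈ U, ∃ (W : Opens M) (hW : W ≤ U), x ∈ W ∧ X.res hW s ∈ X.odd W) :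
    s ∈ X.odd U := by
  obtain ⟨a, ha, b, hb, rfl⟩ := X.exists_even_odd s
  have ha0 : a = 0 := by
    refine X.sec_ext fun x hx => ?_
    obtain ⟨W, hW, hxW, hs⟩ := h x hx
    refine ⟨W, hW, hxW, ?_⟩
    rw [map_zero]
    rw [map_add] at hs
    exact (X.even_odd_unique (X.res_even hW ha) (X.res_odd hW hb) (zero_mem _) hs
      (zero_add _).symm).1
  rw [ha0, zero_add]
  exact hb

namespace Euler

theorem app_mem_J {X : SuperSheaf 𝕜 M} (E : Euler X) {U : Opens M} {k : ℕ} {s : X.Sec U}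
    (hs : s ∈ X.J k U) : E.app U s ∈ X.J k U := by
  have h1 := X.J_antitone (Nat.le_succ k) (E.app_J hs)
  have h2 := add_mem h1 (smul_mem_J (k : 𝕜) hs)
  rwa [sub_add_cancel] at h2

variable {X : SuperSheaf 𝕜 M} {X' : SuperSheaf 𝕜 M'}

/-- Two sections upstairs are, near a given point, pulled back from the same open set downstairs. -/
theorem _root_.SuperSheaf.LocIso.exists_pull₂ {f : M' → M} (L : LocIso f ⊤ X X')
    (hf : IsLocalHomeomorph f) {W' : Opens M'} (s t : X'.Sec W') (x : M') (hx : x ∈ W') :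
    ∃ (T : Opens M) (T' : Opens M') (hT' : T' ≤ W') (hT : Set.BijOn f T' T), x ∈ T' ∧
      ∃ a b, L.pull T T' le_top hT.mapsTo a = X'.res hT' s ∧
        L.pull T T' le_top hT.mapsTo b = X'.res hT' t := by
  obtain ⟨T, T', -, hT', hxT', hb⟩ := exists_sheet (W := ⊤) hf hx trivial
  exact ⟨T, T', hT', hb, hxT', _, _, L.pull_sheet_symm le_top hb _, L.pull_sheet_symm le_top hb _⟩

/-- Euler derivations can be pulled back. -/
theorem nonempty_pull {f : M' → M} (L : LocIso f ⊤ X X') (hf : IsLocalHomeomorph f)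
    (E : Euler X) : Nonempty (Euler X') := by
  obtain ⟨O, hO, hOp⟩ := L.exists_pullOp L hf (fun U s => E.app U s) E.app_res
  have hpar : ∀ (A : ∀ U : Opens M', Submodule 𝕜 (X'.Sec U)) (B : ∀ U, Submodule 𝕜 (X.Sec U)),
      (∀ U (s : X.Sec U), s ∈ B U → E.app U s ∈ B U) →
      (∀ (T : Opens M) (T' : Opens M') (hT : Set.BijOn f T' T) (s : X.Sec T),
        s ∈ B T → L.pull T T' le_top hT.mapsTo s ∈ A T') →
      (∀ (T : Opens M) (T' : Opens M') (hT : Set.BijOn f T' T) (s : X'.Sec T'),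
        s ∈ A T' → (L.sheet le_top hT).symm s ∈ B T) →
      (∀ (U W : Opens M') (h : W ≤ U) (s : X'.Sec U), s ∈ A U → X'.res h s ∈ A W) →
      ∀ (U : Opens M') (s : X'.Sec U), s ∈ A U → ∀ x ∈ U, ∃ (W : Opens M') (hW : W ≤ U), x ∈ W ∧
        X'.res hW (O U s) ∈ A W := by
    intro A B hB h1 h2 hA U s hs x hx
    obtain ⟨T, T', -, hT', hxT', hb⟩ := exists_sheet (W := ⊤) hf hx trivial
    refine ⟨T', hT', hxT', ?_⟩
    rw [← hO, ← L.pull_sheet_symm le_top hb (X'.res hT' s), hOp]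
    exact h1 T T' hb _ (hB _ _ (h2 T T' hb _ (hA _ _ hT' _ hs)))
  refine ⟨{ app := fun U => { toFun := O U, map_add' := ?_, map_smul' := ?_ },
            app_res := hO, app_mul := ?_, app_even := ?_, app_odd := ?_, app_J := ?_ }⟩
  · intro s t
    refine X'.sec_ext fun x hx => ?_
    obtain ⟨T, T', hT', hb, hxT', a, b, ha, hb'⟩ := L.exists_pull₂ hf s t x hx
    refine ⟨T', hT', hxT', ?_⟩
    rw [map_add, ← hO, ← hO, ← hO, map_add, ← ha, ← hb', ← map_add, hOp, hOp, hOp, map_add, map_add]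
  · intro c s
    refine X'.sec_ext fun x hx => ?_
    obtain ⟨T, T', hT', hb, hxT', a, -, ha, -⟩ := L.exists_pull₂ hf s s x hx
    refine ⟨T', hT', hxT', ?_⟩
    rw [RingHom.id_apply, map_smul, ← hO, ← hO, map_smul, ← ha, ← map_smul, hOp, hOp, map_smul,
      map_smul]
  · intro U s t
    refine X'.sec_ext fun x hx => ?_
    obtain ⟨T, T', hT', hb, hxT', a, b, ha, hb'⟩ := L.exists_pull₂ hf s t x hx
    refine ⟨T', hT', hxT', ?_⟩
    change X'.res hT' (O U (s * t)) = X'.res hT' (O U s * t + s * O U t)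
    rw [map_add, map_mul, map_mul, ← hO, ← hO, ← hO, map_mul, ← ha, ← hb', ← map_mul, hOp, hOp,
      hOp, E.app_mul, map_add, map_mul, map_mul]
  · intro U s hs
    exact X'.even_of_locally (hpar X'.even X.even (fun _ _ h => E.app_even h)
      (fun _ _ h _ hs => L.pull_even _ h.mapsTo hs) (fun _ _ h _ hs => L.sheet_symm_even _ h hs)
      (fun _ _ h _ hs => X'.res_even h hs) U s hs)
  · intro U s hs
    exact X'.odd_of_locally (hpar X'.odd X.odd (fun _ _ h => E.app_odd h)
      (fun _ _ h _ hs => L.pull_odd _ h.mapsTo hs) (fun _ _ h _ hs => L.sheet_symm_odd _ h hs)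
      (fun _ _ h _ hs => X'.res_odd h hs) U s hs)
  · intro U k s hs
    refine X'.J_of_locally fun x hx => ?_
    obtain ⟨T, T', hT', hb, hxT', a, -, ha, -⟩ := L.exists_pull₂ hf s s x hx
    refine ⟨T', hT', hxT', ?_⟩
    have haJ : a ∈ X.J k T := L.mem_J_of_pull hf le_top hb (by rw [ha]; exact X'.res_mem_J hT' hs)
    change X'.res hT' (O U s - (k : 𝕜) • s) ∈ _
    rw [map_sub, map_smul, ← hO, ← ha, hOp, ← map_smul, ← map_sub]
    exact L.pull_mem_J hf le_top hb.mapsTo (E.app_J haJ)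

/-- An Euler derivation induces Euler derivations of the quotients `O / J ^ k`. -/
theorem nonempty_quot (E : Euler X) (k : ℕ) : Nonempty (Euler (X.quot k)) := by
  have key : ∀ (W : Opens M) (s : (X.quot k).Sec W), ∃ t : (X.quot k).Sec W,
      ∀ (T : Opens M) (hT : T ≤ W) (b : (X.quot k).Sec T),
        (∃ r : X.Sec T, X.proj k T r = (X.quot k).res hT s ∧ X.proj k T (E.app T r) = b) →
        (X.quot k).res hT t = b := by
    intro W s
    refine (X.quot k).exists_glue (fun T hT b =>
      ∃ r : X.Sec T, X.proj k T r = (X.quot k).res hT s ∧ X.proj k T (E.app T r) = b) ?_ ?_ ?_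
    · rintro T R hT hR b ⟨r, e, rfl⟩
      exact ⟨X.res hR r, by rw [← res_proj, e, res_res], by rw [E.app_res, res_proj]⟩
    · rintro T hT b b' ⟨r, e, rfl⟩ ⟨r', e', rfl⟩
      rw [X.proj_eq_iff, ← map_sub]
      exact E.app_mem_J ((X.proj_eq_iff k r r').1 (e.trans e'.symm))
    · intro x hx
      obtain ⟨T, hT, hxT, r, e⟩ := X.exists_proj k s x hx
      exact ⟨T, hT, hxT, _, r, e, rfl⟩
  choose O hO' using key
  have hOp : ∀ (U : Opens M) (s : X.Sec U), O U (X.proj k U s) = X.proj k U (E.app U s) := by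
    intro U s
    have := hO' U (X.proj k U s) U le_rfl _ ⟨s, by rw [(X.quot k).res_self], rfl⟩
    rwa [(X.quot k).res_self] at this
  have hO : ∀ {U W : Opens M} (h : W ≤ U) (s : (X.quot k).Sec U),
      O W ((X.quot k).res h s) = (X.quot k).res h (O U s) := by
    intro U W h s
    refine (X.quot k).sec_ext fun x hx => ?_
    obtain ⟨T, hT, hxT, r, e⟩ := X.exists_proj k s x (h hx)
    have e' : X.proj k (T ⊓ W) (X.res inf_le_left r) = (X.quot k).res (inf_le_left.trans hT) s := by
      rw [← res_proj, e, res_res]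
    refine ⟨T ⊓ W, inf_le_right, ⟨hxT, hx⟩, ?_⟩
    rw [hO' W _ (T ⊓ W) inf_le_right _ ⟨_, by rw [e', res_res], rfl⟩, res_res]
    exact (hO' U s (T ⊓ W) (inf_le_left.trans hT) _ ⟨_, e', rfl⟩).symm
  have lift₂ : ∀ {U : Opens M} (s t : (X.quot k).Sec U) (x : M), x ∈ U →
      ∃ (W : Opens M) (hW : W ≤ U), x ∈ W ∧ ∃ a b : X.Sec W,
        X.proj k W a = (X.quot k).res hW s ∧ X.proj k W b = (X.quot k).res hW t := by
    intro U s t x hx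
    obtain ⟨T, hT, hxT, r, e⟩ := X.exists_proj k s x hx
    obtain ⟨T', hT', hxT', r', e'⟩ := X.exists_proj k t x hx
    refine ⟨T ⊓ T', inf_le_left.trans hT, ⟨hxT, hxT'⟩, X.res inf_le_left r, X.res inf_le_right r',
      ?_, ?_⟩
    · rw [← res_proj, e, res_res]
    · rw [← res_proj, e', res_res]
  refine ⟨{ app := fun U => { toFun := O U, map_add' := ?_, map_smul' := ?_ },
            app_res := hO, app_mul := ?_, app_even := ?_, app_odd := ?_, app_J := ?_ }⟩
  · intro s t
    refine (X.quot k).sec_ext fun x hx => ?_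
    obtain ⟨T, hT, hxT, a, b, ha, hb⟩ := lift₂ s t x hx
    refine ⟨T, hT, hxT, ?_⟩
    rw [map_add, ← hO, ← hO, ← hO, map_add, ← ha, ← hb, ← map_add, hOp, hOp, hOp, map_add, map_add]
  · intro c s
    refine (X.quot k).sec_ext fun x hx => ?_
    obtain ⟨T, hT, hxT, a, -, ha, -⟩ := lift₂ s s x hx
    refine ⟨T, hT, hxT, ?_⟩
    rw [RingHom.id_apply, map_smul, ← hO, ← hO, map_smul, ← ha, ← map_smul, hOp, hOp, map_smul,
      map_smul]
  · intro U s t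
    refine (X.quot k).sec_ext fun x hx => ?_
    obtain ⟨T, hT, hxT, a, b, ha, hb⟩ := lift₂ s t x hx
    refine ⟨T, hT, hxT, ?_⟩
    change (X.quot k).res hT (O U (s * t)) = (X.quot k).res hT (O U s * t + s * O U t)
    rw [map_add, map_mul, map_mul, ← hO, ← hO, ← hO, map_mul, ← ha, ← hb, ← map_mul, hOp, hOp,
      hOp, E.app_mul, map_add, map_mul, map_mul]
  · intro U s hs
    refine (X.quot k).even_of_locally fun x hx => ?_
    obtain ⟨T, hT, hxT, a, ha, e⟩ := X.exists_proj_even k hs x hx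
    refine ⟨T, hT, hxT, ?_⟩
    change (X.quot k).res hT (O U s) ∈ _
    rw [← hO, ← e, hOp]
    exact X.proj_even k (E.app_even ha)
  · intro U s hs
    refine (X.quot k).odd_of_locally fun x hx => ?_
    obtain ⟨T, hT, hxT, a, ha, e⟩ := X.exists_proj_odd k hs x hx
    refine ⟨T, hT, hxT, ?_⟩
    change (X.quot k).res hT (O U s) ∈ _
    rw [← hO, ← e, hOp]
    exact X.proj_odd k (E.app_odd ha)
  · intro U l s hs
    refine (X.quot k).J_of_locally fun x hx => ?_
    obtain ⟨T, hT, hxT, a, ha, e⟩ := X.exists_proj_of_mem_J k l hs x hx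
    refine ⟨T, hT, hxT, ?_⟩
    change (X.quot k).res hT (O U s - (l : 𝕜) • s) ∈ _
    rw [map_sub, map_smul, ← hO, ← e, hOp, ← map_smul, ← map_sub]
    exact X.proj_mem_J k _ (E.app_J ha)

end Euler

/-- Projections pull back along local isomorphisms. -/
theorem IsProjected.pull {X : SuperSheaf 𝕜 M} {X' : SuperSheaf 𝕜 M'} {f : M' → M}
    (L : LocIso f ⊤ X X') (hf : IsLocalHomeomorph f) (h : X.IsProjected) : X'.IsProjected := by
  obtain ⟨σ, hσ⟩ : ∃ σ : Hom (X.quot 1) X, ∀ (U : Opens M) (s : (X.quot 1).Sec U),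
    X.proj 1 U (σ.app U s) = s := h
  suffices h' : ∃ σ' : Hom (X'.quot 1) X', ∀ (U : Opens M') (s : (X'.quot 1).Sec U),
    X'.proj 1 U (σ'.app U s) = s from h'
  let K : LocIso f ⊤ (X.quot 1) (X'.quot 1) := L.quot hf 1
  obtain ⟨O, hO, hOp⟩ := K.exists_pullOp L hf (fun U (s : (X.quot 1).Sec U) => σ.app U s)
    (fun h s => σ.app_res h s)
  refine ⟨{ app := fun U =>
              { toFun := O U, map_one' := ?_, map_zero' := ?_, map_add' := ?_, map_mul' := ?_,
                commutes' := ?_ },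
            app_res := hO, app_even := ?_, app_odd := ?_ }, ?_⟩
  · have := hOp ⊤ U (fun _ _ => trivial) 1
    rw [map_one] at this
    rwa [map_one, map_one] at this
  · intro s t
    refine X'.sec_ext fun x hx => ?_
    obtain ⟨T, T', hT', hb, hxT', a, b, ha, hb'⟩ := K.exists_pull₂ hf s t x hx
    refine ⟨T', hT', hxT', ?_⟩
    change X'.res hT' (O U (s * t)) = X'.res hT' (O U s * O U t)
    rw [map_mul, ← hO, ← hO, ← hO, map_mul, ← ha, ← hb', ← map_mul, hOp, hOp, hOp, map_mul, map_mul]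
  · have := hOp ⊤ U (fun _ _ => trivial) 0
    rw [map_zero] at this
    rwa [map_zero, map_zero] at this
  · intro s t
    refine X'.sec_ext fun x hx => ?_
    obtain ⟨T, T', hT', hb, hxT', a, b, ha, hb'⟩ := K.exists_pull₂ hf s t x hx
    refine ⟨T', hT', hxT', ?_⟩
    change X'.res hT' (O U (s + t)) = X'.res hT' (O U s + O U t)
    rw [map_add, ← hO, ← hO, ← hO, map_add, ← ha, ← hb', ← map_add, hOp, hOp, hOp, map_add, map_add]
  · intro c
    have := hOp ⊤ U (fun _ _ => trivial) (algebraMap 𝕜 _ c)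
    rw [AlgHom.commutes] at this
    rwa [AlgHom.commutes, AlgHom.commutes] at this
  · intro U s hs
    refine X'.even_of_locally fun x hx => ?_
    obtain ⟨T, T', -, hT', hxT', hb⟩ := exists_sheet (W := ⊤) hf hx trivial
    refine ⟨T', hT', hxT', ?_⟩
    change X'.res hT' (O U s) ∈ _
    rw [← hO, ← K.pull_sheet_symm le_top hb ((X'.quot 1).res hT' s), hOp]
    exact L.pull_even _ _ (σ.app_even (K.sheet_symm_even le_top hb ((X'.quot 1).res_even hT' hs)))
  · intro U s hs
    refine X'.odd_of_locally fun x hx => ?_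
    obtain ⟨T, T', -, hT', hxT', hb⟩ := exists_sheet (W := ⊤) hf hx trivial
    refine ⟨T', hT', hxT', ?_⟩
    change X'.res hT' (O U s) ∈ _
    rw [← hO, ← K.pull_sheet_symm le_top hb ((X'.quot 1).res hT' s), hOp]
    exact L.pull_odd _ _ (σ.app_odd (K.sheet_symm_odd le_top hb ((X'.quot 1).res_odd hT' hs)))
  · intro U s
    refine (X'.quot 1).sec_ext fun x hx => ?_
    obtain ⟨T, T', hT', hb, hxT', a, -, ha, -⟩ := K.exists_pull₂ hf s s x hx
    refine ⟨T', hT', hxT', ?_⟩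
    change (X'.quot 1).res hT' (X'.proj 1 U (O U s)) = _
    rw [res_proj, ← hO, ← ha, hOp]
    exact (L.quot_pull_proj hf 1 le_top hb.mapsTo (σ.app T a)).symm.trans (congrArg _ (hσ T a))

/-! ### The normalized trace of a finite covering, and averages of Euler derivations -/

variable {𝕜 : Type} [Field 𝕜] {M M' : Type u} [TopologicalSpace M] [TopologicalSpace M']

/-- A decomposition of the preimage of `U` into sheets, indexed by `ι`. -/
structure Sheets (f : M' → M) (U : Opens M) (ι : Type u) where
  /-- the sheets -/
  sheet : ι → Opens M'
  bijOn (i : ι) : Set.BijOn f (sheet i) U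
  cover (x : M') : f x ∈ U → ∃ i, x ∈ sheet i
  disjoint (i j : ι) (x : M') : x ∈ sheet i → x ∈ sheet j → i = j

/-- Every point has a neighbourhood whose preimage consists of finitely many sheets. -/
theorem exists_sheets {f : M' → M} (hf : IsCoveringMap f) (hs : Function.Surjective f)
    (hfin : ∀ x, (f ⁻¹' {x}).Finite) (x : M) :
    ∃ (U : Opens M) (ι : Type u) (_ : Fintype ι) (_ : Nonempty ι), x ∈ U ∧
      Nonempty (Sheets f U ι) := by
  obtain ⟨hd, U, hxU, hU, hfU, H, hH⟩ := hf x
  refine ⟨⟨U, hU⟩, f ⁻¹' {x}, (hfin x).fintype, ⟨⟨(hs x).choose, (hs x).choose_spec⟩⟩, hxU, ⟨?_⟩⟩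
  refine
    { sheet := fun i => ⟨Subtype.val '' {y : f ⁻¹' U | (H y).2 = i}, ?_⟩
      bijOn := ?_, cover := ?_, disjoint := ?_ }
  · refine hfU.isOpenMap_subtype_val _ ?_
    exact (isOpen_discrete {i}).preimage (continuous_snd.comp H.continuous)
  · intro i
    refine ⟨?_, ?_, ?_⟩
    · rintro _ ⟨y, -, rfl⟩
      exact y.2
    · rintro _ ⟨y, hy, rfl⟩ _ ⟨z, hz, rfl⟩ h
      have : H y = H z := by
        refine Prod.ext (Subtype.ext ?_) (hy.trans hz.symm)
        rw [hH, hH, h]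
      rw [H.injective this]
    · intro y hy
      refine ⟨H.symm (⟨y, hy⟩, i), ⟨H.symm (⟨y, hy⟩, i), ?_, rfl⟩, ?_⟩
      · change (H (H.symm _)).2 = i
        rw [H.apply_symm_apply]
      · rw [← hH, H.apply_symm_apply]
  · intro y hy
    exact ⟨(H ⟨y, hy⟩).2, ⟨y, hy⟩, rfl, rfl⟩
  · rintro i j _ ⟨y, hy, rfl⟩ ⟨z, hz, h⟩
    obtain rfl := Subtype.ext h
    exact hy.symm.trans hz

namespace Sheets

variable {f : M' → M} {X : SuperSheaf 𝕜 M} {X' : SuperSheaf 𝕜 M'} {U : Opens M} {ι κ : Type u}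

/-- The restriction of a decomposition into sheets to a smaller open set. -/
def restrict (S : Sheets f U ι) (hf : Continuous f) {T : Opens M} (hT : T ≤ U) : Sheets f T ι where
  sheet i := S.sheet i ⊓ T.comap ⟨f, hf⟩
  bijOn i := by
    refine ⟨fun x hx => hx.2, (S.bijOn i).injOn.mono fun x hx => hx.1, fun y hy => ?_⟩
    obtain ⟨x, hx, rfl⟩ := (S.bijOn i).surjOn (hT hy)
    exact ⟨x, ⟨hx, hy⟩, rfl⟩
  cover x hx := by
    obtain ⟨i, hi⟩ := S.cover x (hT hx)
    exact ⟨i, hi, hx⟩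
  disjoint i j x hi hj := S.disjoint i j x hi.1 hj.1

variable [Fintype ι] [Fintype κ]

/-- The average over the sheets of a section of `X'` over the preimage of `U`. -/
def trace (S : Sheets f U ι) (L : LocIso f ⊤ X X') {V' : Opens M'} (h : ∀ i, S.sheet i ≤ V')
    (a : X'.Sec V') : X.Sec U :=
  (Fintype.card ι : 𝕜)⁻¹ • ∑ i, (L.sheet le_top (S.bijOn i)).symm (X'.res (h i) a)

theorem res_trace (S : Sheets f U ι) (L : LocIso f ⊤ X X') {V' : Opens M'}
    (h : ∀ i, S.sheet i ≤ V') (a : X'.Sec V') (hf : Continuous f) {T : Opens M} (hT : T ≤ U) :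
    X.res hT (S.trace L h a) =
      (S.restrict hf hT).trace L (fun i => inf_le_left.trans (h i)) a := by
  unfold trace
  rw [map_smul, map_sum]
  congr 1
  refine Finset.sum_congr rfl fun i _ => ?_
  rw [← L.sheet_symm_res hT (inf_le_left : S.sheet i ⊓ T.comap ⟨f, hf⟩ ≤ _) le_top (S.bijOn i)
    ((S.restrict hf hT).bijOn i), X'.res_res]
  rfl

/-- The average does not depend on the decomposition into sheets. -/
theorem trace_eq (S : Sheets f U ι) (S' : Sheets f U κ) (L : LocIso f ⊤ X X')
    (hf : IsLocalHomeomorph f) {V' : Opens M'} (h : ∀ i, S.sheet i ≤ V')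
    (h' : ∀ i, S'.sheet i ≤ V') (a : X'.Sec V') : S.trace L h a = S'.trace L h' a := by
  refine X.sec_ext fun y hy => ?_
  have h1 : ∀ i, ∃ x ∈ S.sheet i, f x = y := fun i => (S.bijOn i).surjOn hy
  have h2 : ∀ j, ∃ x ∈ S'.sheet j, f x = y := fun j => (S'.bijOn j).surjOn hy
  choose p hp hpy using h1
  choose p' hp' hpy' using h2
  -- the sheet of `S'` through the point of `S.sheet i` above `y`, and conversely
  have h3 : ∀ i, ∃ j, p i ∈ S'.sheet j := fun i => S'.cover _ (by rw [hpy]; exact hy)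
  have h4 : ∀ j, ∃ i, p' j ∈ S.sheet i := fun j => S.cover _ (by rw [hpy']; exact hy)
  choose σ hσ using h3
  choose τ hτ using h4
  have e1 : ∀ i, p' (σ i) = p i := fun i =>
    (S'.bijOn (σ i)).injOn (hp' _) (hσ i) ((hpy' _).trans (hpy i).symm)
  have e2 : ∀ j, p (τ j) = p' j := fun j =>
    (S.bijOn (τ j)).injOn (hp _) (hτ j) ((hpy _).trans (hpy' j).symm)
  let e : ι ≃ κ :=
    { toFun := σ
      invFun := τ
      left_inv := fun i => S.disjoint _ _ (p i) (by rw [← e1]; exact hτ _) (hp i)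
      right_inv := fun j => S'.disjoint _ _ (p' j) (by rw [← e2]; exact hσ _) (hp' j) }
  have key : ∀ i, ∃ (T : Opens M) (hT : T ≤ U), y ∈ T ∧
      X.res hT ((L.sheet le_top (S.bijOn i)).symm (X'.res (h i) a)) =
        X.res hT ((L.sheet le_top (S'.bijOn (e i))).symm (X'.res (h' (e i)) a)) := by
    intro i
    obtain ⟨T, T', hT, hT', hxT', hb⟩ := exists_sheet (W' := S.sheet i ⊓ S'.sheet (σ i)) hf
      ⟨hp i, hσ i⟩ (show f (p i) ∈ U by rw [hpy]; exact hy)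
    refine ⟨T, hT, by rw [← hpy i]; exact hb.mapsTo hxT', ?_⟩
    rw [← L.sheet_symm_res hT (hT'.trans inf_le_left) le_top (S.bijOn i) hb,
      ← L.sheet_symm_res hT (hT'.trans inf_le_right) le_top (S'.bijOn (e i)) hb, X'.res_res,
      X'.res_res]
  choose T hT hyT hTe using key
  have ho : IsOpen ((U : Set M) ∩ ⋂ i, (T i : Set M)) :=
    U.isOpen.inter (isOpen_iInter_of_finite fun i => (T i).isOpen)
  have hle : ∀ i, (⟨_, ho⟩ : Opens M) ≤ T i := fun i x hx => Set.mem_iInter.1 hx.2 i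
  refine ⟨⟨_, ho⟩, fun x hx => hx.1, ⟨hy, Set.mem_iInter.2 hyT⟩, ?_⟩
  unfold trace
  rw [map_smul, map_smul, map_sum, map_sum, Fintype.card_congr e]
  congr 1
  refine Fintype.sum_equiv e _ _ fun i => ?_
  have := congrArg (X.res (hle i)) (hTe i)
  rwa [X.res_res, X.res_res] at this

end Sheets

/-- The preimage of an open set. -/
abbrev preimage {f : M' → M} (hf : Continuous f) (V : Opens M) : Opens M' := V.comap ⟨f, hf⟩

theorem preimage_mono {f : M' → M} (hf : Continuous f) {V W : Opens M} (h : W ≤ V) :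
    preimage hf W ≤ preimage hf V :=
  fun _ hx => h hx

theorem mapsTo_preimage {f : M' → M} (hf : Continuous f) (V : Opens M) :
    Set.MapsTo f (preimage hf V) V :=
  fun _ hx => hx

section Trace

variable {f : M' → M} (hf : IsCoveringMap f) (hs : Function.Surjective f)
    (hfin : ∀ x, (f ⁻¹' {x}).Finite) {X : SuperSheaf 𝕜 M} {X' : SuperSheaf 𝕜 M'}
    (L : LocIso f ⊤ X X')
include hs hfin

theorem exists_trace (V : Opens M) (a : X'.Sec (preimage hf.continuous V)) :
    ∃ t : X.Sec V, ∀ (U : Opens M) (hU : U ≤ V) (ι : Type u) (_ : Fintype ι) (S : Sheets f U ι)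
      (h : ∀ i, S.sheet i ≤ preimage hf.continuous V), X.res hU t = S.trace L h a := by
  refine (X.exists_glue (fun U hU b => ∃ (ι : Type u) (_ : Fintype ι) (S : Sheets f U ι)
    (h : ∀ i, S.sheet i ≤ preimage hf.continuous V), S.trace L h a = b) ?_ ?_ ?_).imp
    fun t ht U hU ι _ S h => ht U hU _ ⟨ι, _, S, h, rfl⟩
  · rintro U T hU hT b ⟨ι, _, S, h, rfl⟩
    exact ⟨ι, _, S.restrict hf.continuous hT, _, (S.res_trace L h a hf.continuous hT).symm⟩
  · rintro U hU b b' ⟨ι, _, S, h, rfl⟩ ⟨κ, _, S', h', rfl⟩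
    exact S.trace_eq S' L hf.isLocalHomeomorph h h' a
  · intro x hx
    obtain ⟨U, ι, hι, -, hxU, ⟨S⟩⟩ := exists_sheets hf hs hfin x
    have h : ∀ i, (S.restrict hf.continuous (inf_le_left : U ⊓ V ≤ U)).sheet i ≤
        preimage hf.continuous V := fun i y hy => hy.2.2
    exact ⟨U ⊓ V, inf_le_right, ⟨hxU, hx⟩, Sheets.trace _ L h a, ι, hι, _, h, rfl⟩

/-- The normalized trace of a finite covering: the average over the sheets. -/
def trace (V : Opens M) (a : X'.Sec (preimage hf.continuous V)) : X.Sec V :=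
  (exists_trace hf hs hfin L V a).choose

theorem res_trace {V U : Opens M} (a : X'.Sec (preimage hf.continuous V)) (hU : U ≤ V)
    {ι : Type u} [Fintype ι] (S : Sheets f U ι)
    (h : ∀ i, S.sheet i ≤ preimage hf.continuous V) :
    X.res hU (trace hf hs hfin L V a) = S.trace L h a :=
  (exists_trace hf hs hfin L V a).choose_spec U hU ι _ S h

theorem exists_sheets_le {V : Opens M} (x : M) (hx : x ∈ V) :
    ∃ (U : Opens M) (_ : U ≤ V) (ι : Type u) (_ : Fintype ι) (_ : Nonempty ι) (S : Sheets f U ι)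
      (_ : ∀ i, S.sheet i ≤ preimage hf.continuous V), x ∈ U := by
  obtain ⟨U, ι, hι, hι', hxU, ⟨S⟩⟩ := exists_sheets hf hs hfin x
  exact ⟨U ⊓ V, inf_le_right, ι, hι, hι', S.restrict hf.continuous inf_le_left,
      fun i y hy => hy.2.2, hxU, hx⟩

theorem trace_res {V W : Opens M} (hW : W ≤ V) (a : X'.Sec (preimage hf.continuous V)) :
    trace hf hs hfin L W (X'.res (preimage_mono hf.continuous hW) a) =
      X.res hW (trace hf hs hfin L V a) := by
  refine X.sec_ext fun x hx => ?_
  obtain ⟨U, hU, ι, _, -, S, h, hxU⟩ := exists_sheets_le hf hs hfin x hx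
  refine ⟨U, hU, hxU, ?_⟩
  rw [X.res_res, res_trace hf hs hfin L _ hU S h, res_trace hf hs hfin L a (hU.trans hW) S
    (fun i => (h i).trans (preimage_mono hf.continuous hW))]
  unfold Sheets.trace
  congr 1
  refine Finset.sum_congr rfl fun i _ => ?_
  rw [X'.res_res]

theorem trace_add {V : Opens M} (a b : X'.Sec (preimage hf.continuous V)) :
    trace hf hs hfin L V (a + b) = trace hf hs hfin L V a + trace hf hs hfin L V b := by
  refine X.sec_ext fun x hx => ?_
  obtain ⟨U, hU, ι, _, -, S, h, hxU⟩ := exists_sheets_le hf hs hfin x hx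
  refine ⟨U, hU, hxU, ?_⟩
  rw [map_add, res_trace hf hs hfin L _ hU S h, res_trace hf hs hfin L _ hU S h,
    res_trace hf hs hfin L _ hU S h]
  simp only [Sheets.trace, map_add, Finset.sum_add_distrib, smul_add]

theorem trace_smul {V : Opens M} (c : 𝕜) (a : X'.Sec (preimage hf.continuous V)) :
    trace hf hs hfin L V (c • a) = c • trace hf hs hfin L V a := by
  refine X.sec_ext fun x hx => ?_
  obtain ⟨U, hU, ι, _, -, S, h, hxU⟩ := exists_sheets_le hf hs hfin x hx
  refine ⟨U, hU, hxU, ?_⟩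
  rw [map_smul, res_trace hf hs hfin L _ hU S h, res_trace hf hs hfin L _ hU S h]
  simp only [Sheets.trace, map_smul, ← Finset.smul_sum]
  rw [smul_comm]

/-- The averaging map is linear over the sections downstairs. -/
theorem trace_pull_mul {V : Opens M} (s : X.Sec V) (a : X'.Sec (preimage hf.continuous V)) :
    trace hf hs hfin L V (L.pull V _ le_top (mapsTo_preimage hf.continuous V) s * a) =
      s * trace hf hs hfin L V a := by
  refine X.sec_ext fun x hx => ?_
  obtain ⟨U, hU, ι, _, -, S, h, hxU⟩ := exists_sheets_le hf hs hfin x hx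
  refine ⟨U, hU, hxU, ?_⟩
  rw [map_mul, res_trace hf hs hfin L _ hU S h, res_trace hf hs hfin L _ hU S h]
  unfold Sheets.trace
  rw [mul_smul_comm, Finset.mul_sum]
  congr 1
  refine Finset.sum_congr rfl fun i _ => ?_
  rw [map_mul, map_mul]
  congr 1
  rw [← L.pull_res hU (h i) le_top (mapsTo_preimage hf.continuous V) (S.bijOn i).mapsTo,
    ← L.sheet_apply le_top (S.bijOn i), AlgEquiv.symm_apply_apply]

theorem trace_mul_pull {V : Opens M} (s : X.Sec V) (a : X'.Sec (preimage hf.continuous V)) :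
    trace hf hs hfin L V (a * L.pull V _ le_top (mapsTo_preimage hf.continuous V) s) =
      trace hf hs hfin L V a * s := by
  refine X.sec_ext fun x hx => ?_
  obtain ⟨U, hU, ι, _, -, S, h, hxU⟩ := exists_sheets_le hf hs hfin x hx
  refine ⟨U, hU, hxU, ?_⟩
  rw [map_mul, res_trace hf hs hfin L _ hU S h, res_trace hf hs hfin L _ hU S h]
  unfold Sheets.trace
  rw [smul_mul_assoc, Finset.sum_mul]
  congr 1
  refine Finset.sum_congr rfl fun i _ => ?_
  rw [map_mul, map_mul]
  congr 1
  rw [← L.pull_res hU (h i) le_top (mapsTo_preimage hf.continuous V) (S.bijOn i).mapsTo,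
    ← L.sheet_apply le_top (S.bijOn i), AlgEquiv.symm_apply_apply]

/-- The averaging map is a left inverse of the pullback. -/
theorem trace_pull [CharZero 𝕜] {V : Opens M} (s : X.Sec V) :
    trace hf hs hfin L V (L.pull V _ le_top (mapsTo_preimage hf.continuous V) s) = s := by
  refine X.sec_ext fun x hx => ?_
  obtain ⟨U, hU, ι, _, hι, S, h, hxU⟩ := exists_sheets_le hf hs hfin x hx
  refine ⟨U, hU, hxU, ?_⟩
  rw [res_trace hf hs hfin L _ hU S h]
  unfold Sheets.trace
  have : ∀ i, (L.sheet le_top (S.bijOn i)).symm (X'.res (h i)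
      (L.pull V _ le_top (mapsTo_preimage hf.continuous V) s)) = X.res hU s := by
    intro i
    rw [← L.pull_res hU (h i) le_top (mapsTo_preimage hf.continuous V) (S.bijOn i).mapsTo,
      ← L.sheet_apply le_top (S.bijOn i), AlgEquiv.symm_apply_apply]
  rw [Finset.sum_congr rfl fun i _ => this i, Finset.sum_const, Finset.card_univ,
    ← Nat.cast_smul_eq_nsmul 𝕜, smul_smul, inv_mul_cancel₀, one_smul]
  exact Nat.cast_ne_zero.2 Fintype.card_ne_zero

theorem trace_even {V : Opens M} {a : X'.Sec (preimage hf.continuous V)} (ha : a ∈ X'.even _) :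
    trace hf hs hfin L V a ∈ X.even V := by
  refine X.even_of_locally fun x hx => ?_
  obtain ⟨U, hU, ι, _, -, S, h, hxU⟩ := exists_sheets_le hf hs hfin x hx
  refine ⟨U, hU, hxU, ?_⟩
  rw [res_trace hf hs hfin L _ hU S h]
  exact Submodule.smul_mem _ _ (Submodule.sum_mem _ fun i _ =>
    L.sheet_symm_even le_top (S.bijOn i) (X'.res_even (h i) ha))

theorem trace_odd {V : Opens M} {a : X'.Sec (preimage hf.continuous V)} (ha : a ∈ X'.odd _) :
    trace hf hs hfin L V a ∈ X.odd V := by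
  refine X.odd_of_locally fun x hx => ?_
  obtain ⟨U, hU, ι, _, -, S, h, hxU⟩ := exists_sheets_le hf hs hfin x hx
  refine ⟨U, hU, hxU, ?_⟩
  rw [res_trace hf hs hfin L _ hU S h]
  exact Submodule.smul_mem _ _ (Submodule.sum_mem _ fun i _ =>
    L.sheet_symm_odd le_top (S.bijOn i) (X'.res_odd (h i) ha))

theorem trace_mem_J {V : Opens M} {k : ℕ} {a : X'.Sec (preimage hf.continuous V)}
    (ha : a ∈ X'.J k _) : trace hf hs hfin L V a ∈ X.J k V := by
  refine X.J_of_locally fun x hx => ?_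
  obtain ⟨U, hU, ι, _, -, S, h, hxU⟩ := exists_sheets_le hf hs hfin x hx
  refine ⟨U, hU, hxU, ?_⟩
  rw [res_trace hf hs hfin L _ hU S h]
  exact smul_mem_J _ (Submodule.sum_mem _ fun i _ =>
    L.sheet_symm_mem_J hf.isLocalHomeomorph le_top (S.bijOn i) (X'.res_mem_J (h i) ha))

/-- Euler derivations form an affine space, so the average over the sheets of an Euler derivation
of `X'` is an Euler derivation of `X`. -/
def Euler.average [CharZero 𝕜] (E : Euler X') : Euler X where
  app V :=
    { toFun := fun s => trace hf hs hfin L V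
        (E.app _ (L.pull V _ le_top (mapsTo_preimage hf.continuous V) s))
      map_add' := fun s t => by rw [map_add, map_add, trace_add]
      map_smul' := fun c s => by rw [map_smul, map_smul, trace_smul]; rfl }
  app_res {V W} h s := by
    change trace hf hs hfin L W _ = X.res h (trace hf hs hfin L V _)
    rw [← trace_res hf hs hfin L h, ← E.app_res,
      ← L.pull_res h (preimage_mono hf.continuous h) le_top (mapsTo_preimage hf.continuous V)
        (mapsTo_preimage hf.continuous W)]
  app_mul {V} s t := by
    change trace hf hs hfin L V _ = trace hf hs hfin L V _ * t + s * trace hf hs hfin L V _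
    rw [map_mul, E.app_mul, trace_add, trace_mul_pull, trace_pull_mul]
  app_even h := trace_even hf hs hfin L (E.app_even (L.pull_even _ _ h))
  app_odd h := trace_odd hf hs hfin L (E.app_odd (L.pull_odd _ _ h))
  app_J {V k s} h := by
    have h1 := trace_mem_J hf hs hfin L
      (E.app_J (L.pull_mem_J hf.isLocalHomeomorph le_top (W' := preimage hf.continuous V)
        (mapsTo_preimage hf.continuous V) h))
    rw [sub_eq_add_neg, ← neg_smul, trace_add, trace_smul, trace_pull, neg_smul,
      ← sub_eq_add_neg] at h1
    exact h1

end Trace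

/-! ### Gluing isomorphisms -/

section Glue

variable {𝕜 : Type} [Field 𝕜] {M : Type u} [TopologicalSpace M] {X Y : SuperSheaf 𝕜 M}

theorem exists_mem_cover {ι : Type*} {U : ι → Opens M} (hU : ⨆ i, U i = ⊤) (x : M) :
    ∃ i, x ∈ U i :=
  Opens.mem_iSup.1 (by rw [hU]; trivial)

/-- Local isomorphisms which agree on overlaps glue to a family of homomorphisms which restricts to
them. -/
theorem IsoOn.exists_glueHom {ι : Type*} {U : ι → Opens M} (hU : ⨆ i, U i = ⊤)
    (g : ∀ i, IsoOn (U i) X Y)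
    (hg : ∀ (i j : ι) (W : Opens M) (hi : W ≤ U i) (hj : W ≤ U j) (s : X.Sec W),
      (g i).app W hi s = (g j).app W hj s) :
    ∃ φ : ∀ W : Opens M, X.Sec W →ₐ[𝕜] Y.Sec W, ∀ (W : Opens M) (s : X.Sec W) (i : ι) (T : Opens M)
      (hT : T ≤ W) (hi : T ≤ U i), Y.res hT (φ W s) = (g i).app T hi (X.res hT s) := by
  have key : ∀ (W : Opens M) (s : X.Sec W), ∃ t : Y.Sec W, ∀ (T : Opens M) (hT : T ≤ W)
      (b : Y.Sec T), (∃ (i : ι) (hi : T ≤ U i), (g i).app T hi (X.res hT s) = b) →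
      Y.res hT t = b := by
    intro W s
    refine Y.exists_glue
      (fun T hT b => ∃ (i : ι) (hi : T ≤ U i), (g i).app T hi (X.res hT s) = b) ?_ ?_ ?_
    · rintro T R hT hR b ⟨i, hi, rfl⟩
      exact ⟨i, hR.trans hi, by rw [← (g i).app_res hi hR, X.res_res]⟩
    · rintro T hT b b' ⟨i, hi, rfl⟩ ⟨j, hj, rfl⟩
      exact hg i j T hi hj _
    · intro x hx
      obtain ⟨i, hi⟩ := exists_mem_cover hU x
      exact ⟨W ⊓ U i, inf_le_left, ⟨hx, hi⟩, _, i, inf_le_right, rfl⟩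
  choose φ hφ using key
  have hφ' : ∀ (W : Opens M) (s : X.Sec W) (i : ι) (T : Opens M)
      (hT : T ≤ W) (hi : T ≤ U i), Y.res hT (φ W s) = (g i).app T hi (X.res hT s) :=
    fun W s i T hT hi => hφ W s T hT _ ⟨i, hi, rfl⟩
  have hext : ∀ {W : Opens M} {a b : Y.Sec W}, (∀ (i : ι) (T : Opens M) (hT : T ≤ W), T ≤ U i →
      Y.res hT a = Y.res hT b) → a = b := by
    intro W a b h
    refine Y.sec_ext fun x hx => ?_
    obtain ⟨i, hi⟩ := exists_mem_cover hU x
    exact ⟨W ⊓ U i, inf_le_left, ⟨hx, hi⟩, h i _ _ inf_le_right⟩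
  refine ⟨fun W =>
    { toFun := φ W, map_one' := ?_, map_zero' := ?_, map_mul' := ?_, map_add' := ?_,
      commutes' := ?_ }, hφ'⟩
  · exact hext fun i T hT hi => by rw [hφ' W 1 i T hT hi, map_one, map_one, map_one]
  · intro s t
    exact hext fun i T hT hi => by
      rw [map_mul, hφ' W _ i T hT hi, hφ' W _ i T hT hi, hφ' W _ i T hT hi, map_mul, map_mul]
  · exact hext fun i T hT hi => by rw [hφ' W 0 i T hT hi, map_zero, map_zero, map_zero]
  · intro s t
    exact hext fun i T hT hi => by
      rw [map_add, hφ' W _ i T hT hi, hφ' W _ i T hT hi, hφ' W _ i T hT hi, map_add, map_add]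
  · intro c
    exact hext fun i T hT hi => by
      rw [hφ' W _ i T hT hi, AlgHom.commutes, AlgHom.commutes, AlgEquiv.commutes]

/-- Isomorphisms over the members of an open covering which agree on overlaps glue. -/
theorem IsoOn.isIso_of_cover {ι : Type*} {U : ι → Opens M} (hU : ⨆ i, U i = ⊤)
    (g : ∀ i, IsoOn (U i) X Y)
    (hg : ∀ (i j : ι) (W : Opens M) (hi : W ≤ U i) (hj : W ≤ U j) (s : X.Sec W),
      (g i).app W hi s = (g j).app W hj s) : IsIso X Y := by
  obtain ⟨φ, hφ⟩ := IsoOn.exists_glueHom hU g hg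
  obtain ⟨ψ, hψ⟩ := IsoOn.exists_glueHom hU (fun i => (g i).symm) fun i j W hi hj s => by
    change ((g i).app W hi).symm s = ((g j).app W hj).symm s
    rw [AlgEquiv.symm_apply_eq, hg i j W hi hj, AlgEquiv.apply_symm_apply]
  have hloc : ∀ (W : Opens M), ∀ x ∈ W, ∃ (i : ι) (T : Opens M) (_ : T ≤ W), x ∈ T ∧ T ≤ U i := by
    intro W x hx
    obtain ⟨i, hi⟩ := exists_mem_cover hU x
    exact ⟨i, W ⊓ U i, inf_le_left, ⟨hx, hi⟩, inf_le_right⟩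
  refine ⟨⟨fun W _ => AlgEquiv.ofAlgHom (φ W) (ψ W) ?_ ?_, ?_, ?_, ?_⟩⟩
  · ext s
    refine Y.sec_ext fun x hx => ?_
    obtain ⟨i, T, hT, hxT, hi⟩ := hloc W x hx
    refine ⟨T, hT, hxT, ?_⟩
    change Y.res hT (φ W (ψ W s)) = Y.res hT s
    rw [hφ W _ i T hT hi, hψ W _ i T hT hi]
    exact AlgEquiv.apply_symm_apply _ _
  · ext s
    refine X.sec_ext fun x hx => ?_
    obtain ⟨i, T, hT, hxT, hi⟩ := hloc W x hx
    refine ⟨T, hT, hxT, ?_⟩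
    change X.res hT (ψ W (φ W s)) = X.res hT s
    rw [hψ W _ i T hT hi, hφ W _ i T hT hi]
    exact AlgEquiv.symm_apply_apply _ _
  · intro W R _ hR s
    refine Y.sec_ext fun x hx => ?_
    obtain ⟨i, T, hT, hxT, hi⟩ := hloc R x hx
    refine ⟨T, hT, hxT, ?_⟩
    change Y.res hT (φ R (X.res hR s)) = Y.res hT (Y.res hR (φ W s))
    rw [Y.res_res, hφ R _ i T hT hi, hφ W _ i T (hT.trans hR) hi, X.res_res]
  · intro W _ s hs
    refine Y.even_of_locally fun x hx => ?_
    obtain ⟨i, T, hT, hxT, hi⟩ := hloc W x hx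
    refine ⟨T, hT, hxT, ?_⟩
    change Y.res hT (φ W s) ∈ _
    rw [hφ W _ i T hT hi]
    exact (g i).app_even hi (X.res_even hT hs)
  · intro W _ s hs
    refine Y.odd_of_locally fun x hx => ?_
    obtain ⟨i, T, hT, hxT, hi⟩ := hloc W x hx
    refine ⟨T, hT, hxT, ?_⟩
    change Y.res hT (φ W s) ∈ _
    rw [hφ W _ i T hT hi]
    exact (g i).app_odd hi (X.res_odd hT hs)

end Glue

/-! ### The grading defined by an Euler derivation -/

section Grading

open Polynomial

variable {𝕜 : Type} [Field 𝕜]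

theorem _root_.Polynomial.aeval_apply_mem {V : Type*} [AddCommGroup V] [Module 𝕜 V]
    (E : Module.End 𝕜 V) (A : Submodule 𝕜 V) (hA : ∀ v ∈ A, E v ∈ A) (p : 𝕜[X]) {v : V}
    (hv : v ∈ A) : aeval E p v ∈ A := by
  induction p using Polynomial.induction_on' generalizing v with
  | add p q hp hq => rw [map_add]; exact A.add_mem (hp hv) (hq hv)
  | monomial n a =>
    rw [aeval_monomial, Module.End.mul_apply]
    have : (E ^ n) v ∈ A := by
      induction n with
      | zero => exact hv
      | succ n ih => rw [pow_succ']; exact hA _ ih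
    exact A.smul_mem a this

theorem _root_.Polynomial.aeval_apply_comm {V V' : Type*} [AddCommGroup V] [Module 𝕜 V]
    [AddCommGroup V'] [Module 𝕜 V'] (E : Module.End 𝕜 V) (E' : Module.End 𝕜 V') (f : V →ₗ[𝕜] V')
    (hf : ∀ v, E' (f v) = f (E v)) (p : 𝕜[X]) (v : V) :
    aeval E' p (f v) = f (aeval E p v) := by
  induction p using Polynomial.induction_on' generalizing v with
  | add p q hp hq =>
    rw [map_add, map_add, LinearMap.add_apply, LinearMap.add_apply, hp, hq, map_add]
  | monomial n a =>
    rw [aeval_monomial, aeval_monomial, Module.End.mul_apply, Module.End.mul_apply]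
    have : (E' ^ n) (f v) = f ((E ^ n) v) := by
      induction n with
      | zero => rfl
      | succ n ih =>
        rw [pow_succ', pow_succ', Module.End.mul_apply, ih, hf]
        rfl
    rw [this]
    exact (map_smul f a _).symm

/-- `p(E) - p(c)` factors through `E - c`. -/
theorem _root_.Polynomial.exists_aeval_sub {V : Type*} [AddCommGroup V] [Module 𝕜 V]
    (E : Module.End 𝕜 V) (p : 𝕜[X]) (c : 𝕜) :
    ∃ q : 𝕜[X], ∀ v, aeval E p v - p.eval c • v = aeval E q (E v - c • v) := by
  obtain ⟨q, hq⟩ := X_sub_C_dvd_sub_C_eval (a := c) (p := p)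
  refine ⟨q, fun v => ?_⟩
  have h := congrArg (fun r => aeval E r v) ((mul_comm _ _).trans hq.symm)
  simp only [map_mul, map_sub, aeval_X, aeval_C, Module.End.mul_apply, LinearMap.sub_apply,
    Module.algebraMap_end_apply] at h
  rw [map_sub]
  exact h.symm

namespace Euler

variable {M : Type u} [TopologicalSpace M] {X Y : SuperSheaf 𝕜 M} (E : Euler X) {U : Opens M}

theorem aeval_mem_J (p : 𝕜[X]) {k : ℕ} {s : X.Sec U} (hs : s ∈ X.J k U) :
    aeval (E.app U) p s ∈ X.J k U :=
  aeval_apply_mem (E.app U) ((X.J k U).restrictScalars 𝕜) (fun _ h => E.app_mem_J h) p hs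

/-- A polynomial in an Euler derivation acts on `J ^ k / J ^ (k + 1)` by its value at `k`. -/
theorem aeval_sub_eval_mem_J (p : 𝕜[X]) {k : ℕ} {s : X.Sec U} (hs : s ∈ X.J k U) :
    aeval (E.app U) p s - p.eval (k : 𝕜) • s ∈ X.J (k + 1) U := by
  obtain ⟨q, hq⟩ := exists_aeval_sub (E.app U) p (k : 𝕜)
  rw [hq]
  exact E.aeval_mem_J q (E.app_J hs)

theorem aeval_of_eigen (p : 𝕜[X]) {c : 𝕜} {s : X.Sec U} (hs : E.app U s = c • s) :
    aeval (E.app U) p s = p.eval c • s := by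
  obtain ⟨q, hq⟩ := exists_aeval_sub (E.app U) p c
  rw [← sub_eq_zero, hq, hs, sub_self, map_zero]

variable (N : ℕ)

/-- The projection to the sections of weight `k`, as a polynomial in the Euler derivation. -/
def weight (k : ℕ) (U : Opens M) : X.Sec U →ₗ[𝕜] X.Sec U :=
  aeval (E.app U) (Lagrange.basis (Finset.range (N + 1)) (fun j => (j : 𝕜)) k)

theorem weight_res (k : ℕ) {W : Opens M} (h : W ≤ U) (s : X.Sec U) :
    E.weight N k W (X.res h s) = X.res h (E.weight N k U s) :=
  aeval_apply_comm (E.app U) (E.app W) (X.res h).toLinearMap (fun s => E.app_res h s) _ s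

theorem weight_even (k : ℕ) {s : X.Sec U} (hs : s ∈ X.even U) : E.weight N k U s ∈ X.even U :=
  aeval_apply_mem (E.app U) (X.even U) (fun _ h => E.app_even h) _ hs

theorem weight_odd (k : ℕ) {s : X.Sec U} (hs : s ∈ X.odd U) : E.weight N k U s ∈ X.odd U :=
  aeval_apply_mem (E.app U) (X.odd U) (fun _ h => E.app_odd h) _ hs

variable {N}

theorem eval_basis_of_ne {k l : ℕ} (hl : l ≤ N) (h : k ≠ l) :
    (Lagrange.basis (Finset.range (N + 1)) (fun j => (j : 𝕜)) k).eval (l : 𝕜) = 0 :=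
  Lagrange.eval_basis_of_ne (v := fun j : ℕ => (j : 𝕜)) h (Finset.mem_range_succ_iff.2 hl)

theorem weight_of_eigen_ne {k l : ℕ} (hl : l ≤ N) (h : k ≠ l) {s : X.Sec U}
    (hs : E.app U s = (l : 𝕜) • s) : E.weight N k U s = 0 := by
  rw [weight, E.aeval_of_eigen _ hs, eval_basis_of_ne hl h, zero_smul]

/-- As `E - k` maps `J ^ k` to `J ^ (k + 1)`, the product of the `E - k` for `k ≤ N` vanishes. -/
theorem aeval_nodal (hN : ∀ U, X.J (N + 1) U = ⊥) (s : X.Sec U) :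
    aeval (E.app U) (Lagrange.nodal (Finset.range (N + 1)) (fun j => (j : 𝕜))) s = 0 := by
  have : ∀ r : ℕ, aeval (E.app U) (Lagrange.nodal (Finset.range r) (fun j => (j : 𝕜))) s ∈
      X.J r U := by
    intro r
    induction r with
    | zero => exact X.mem_J_zero _
    | succ r ih =>
      unfold Lagrange.nodal at ih ⊢
      rw [Finset.prod_range_succ, mul_comm, map_mul, Module.End.mul_apply]
      rw [map_sub, aeval_X, aeval_C, LinearMap.sub_apply, Module.algebraMap_end_apply]
      exact E.app_J ih
  have h := this (N + 1)
  rwa [hN] at h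

variable [CharZero 𝕜]

/-- An eigensection of weight `k` lies in `J ^ k`. -/
theorem mem_J_of_eigen {k : ℕ} {s : X.Sec U} (hs : E.app U s = (k : 𝕜) • s) : s ∈ X.J k U := by
  have : ∀ l ≤ k, s ∈ X.J l U := by
    intro l hl
    induction l with
    | zero => exact X.mem_J_zero s
    | succ l ih =>
      have h := E.app_J (ih (Nat.le_of_succ_le hl))
      rw [hs, ← sub_smul] at h
      have h2 := smul_mem_J ((k : 𝕜) - l)⁻¹ h
      rwa [smul_smul, inv_mul_cancel₀ (sub_ne_zero.2 (Nat.cast_injective.ne (by omega))),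
        one_smul] at h2
  exact this k le_rfl

variable (hN : ∀ U, X.J (N + 1) U = ⊥)

include hN in
/-- An eigensection of weight `k` in `J ^ (k + 1)` vanishes. -/
theorem eq_zero_of_eigen {k : ℕ} {s : X.Sec U} (hs : E.app U s = (k : 𝕜) • s)
    (hk : s ∈ X.J (k + 1) U) : s = 0 := by
  have : ∀ l, s ∈ X.J (k + 1 + l) U := by
    intro l
    induction l with
    | zero => exact hk
    | succ l ih =>
      have h := E.app_J ih
      rw [hs, ← sub_smul] at h
      have h2 := smul_mem_J ((k : 𝕜) - (k + 1 + l : ℕ))⁻¹ h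
      rwa [smul_smul, inv_mul_cancel₀ (sub_ne_zero.2 (Nat.cast_injective.ne (by omega))),
        one_smul] at h2
  have h := X.J_antitone (by omega : N + 1 ≤ k + 1 + N) (this N)
  rwa [hN] at h

theorem eval_basis_self {k : ℕ} (hk : k ≤ N) :
    (Lagrange.basis (Finset.range (N + 1)) (fun j => (j : 𝕜)) k).eval (k : 𝕜) = 1 :=
  Lagrange.eval_basis_self (Nat.cast_injective.injOn) (Finset.mem_range_succ_iff.2 hk)

theorem weight_of_eigen {k : ℕ} (hk : k ≤ N) {s : X.Sec U} (hs : E.app U s = (k : 𝕜) • s) :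
    E.weight N k U s = s := by
  rw [weight, E.aeval_of_eigen _ hs, eval_basis_self hk, one_smul]

theorem weight_sub_mem_J {k : ℕ} (hk : k ≤ N) {s : X.Sec U} (hs : s ∈ X.J k U) :
    E.weight N k U s - s ∈ X.J (k + 1) U := by
  have := E.aeval_sub_eval_mem_J (Lagrange.basis (Finset.range (N + 1)) (fun j => (j : 𝕜)) k) hs
  rwa [eval_basis_self hk, one_smul] at this

theorem sum_weight (s : X.Sec U) : ∑ k ∈ Finset.range (N + 1), E.weight N k U s = s := by
  have h := Lagrange.sum_basis (s := Finset.range (N + 1)) (v := fun j : ℕ => (j : 𝕜))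
    (Nat.cast_injective.injOn) ⟨0, by simp⟩
  have h2 := congrArg (fun p => aeval (E.app U) p s) h
  simpa [weight] using h2

include hN

/-- The projections to the weight spaces have values in eigensections. -/
theorem app_weight {k : ℕ} (hk : k ≤ N) (s : X.Sec U) :
    E.app U (E.weight N k U s) = (k : 𝕜) • E.weight N k U s := by
  have hk' : k ∈ Finset.range (N + 1) := Finset.mem_range_succ_iff.2 hk
  have h1 : (Polynomial.X - C (k : 𝕜)) *
      Lagrange.basis (Finset.range (N + 1)) (fun j => (j : 𝕜)) k =
      C (Lagrange.nodalWeight (Finset.range (N + 1)) (fun j => (j : 𝕜)) k) *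
        Lagrange.nodal (Finset.range (N + 1)) (fun j => (j : 𝕜)) := by
    rw [Lagrange.basis_eq_prod_sub_inv_mul_nodal_div hk',
      ← Lagrange.nodal_erase_eq_nodal_div hk',
      Lagrange.nodal_eq_mul_nodal_erase hk']
    ring
  have h2 := congrArg (fun p => aeval (E.app U) p s) h1
  simp only [map_mul, map_sub, aeval_X, aeval_C, Module.End.mul_apply, LinearMap.sub_apply,
    Module.algebraMap_end_apply] at h2
  rw [E.aeval_nodal hN, smul_zero] at h2
  exact sub_eq_zero.1 h2

theorem weight_mem_J {k : ℕ} (hk : k ≤ N) (s : X.Sec U) : E.weight N k U s ∈ X.J k U :=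
  E.mem_J_of_eigen (E.app_weight hN hk s)

theorem weight_eq_zero {k : ℕ} (hk : k ≤ N) {s : X.Sec U} (hs : s ∈ X.J (k + 1) U) :
    E.weight N k U s = 0 :=
  E.eq_zero_of_eigen hN (E.app_weight hN hk s) (E.aeval_mem_J _ hs)

theorem weight_congr {k : ℕ} (hk : k ≤ N) {s t : X.Sec U} (h : s - t ∈ X.J (k + 1) U) :
    E.weight N k U s = E.weight N k U t := by
  rw [← sub_eq_zero, ← map_sub, E.weight_eq_zero hN hk h]

end Euler

end Grading

/-! ### Isomorphisms compatible with the gradings -/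

section Theta

variable {𝕜 : Type} [Field 𝕜] {M : Type u} [TopologicalSpace M] {X Y : SuperSheaf 𝕜 M}
  (E : Euler X) (F : Euler Y) {V : Opens M} (χ : IsoOn V X Y) (N : ℕ)

/-- The part of `χ : X|_V ≅ Y|_V` which preserves the gradings defined by the Euler derivations:
the sum of the maps "component of weight `k` of `χ s`" for `s` of weight `k`. -/
def IsoOn.degZero (W : Opens M) (hW : W ≤ V) : X.Sec W →ₗ[𝕜] Y.Sec W :=
  ∑ k ∈ Finset.range (N + 1),
    (F.weight N k W ∘ₗ (χ.app W hW).toLinearMap) ∘ₗ E.weight N k W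

theorem IsoOn.degZero_apply {W : Opens M} (hW : W ≤ V) (s : X.Sec W) :
    χ.degZero E F N W hW s =
      ∑ k ∈ Finset.range (N + 1), F.weight N k W (χ.app W hW (E.weight N k W s)) := by
  rw [IsoOn.degZero, LinearMap.sum_apply]
  rfl

theorem IsoOn.degZero_res {W T : Opens M} (hW : W ≤ V) (h : T ≤ W) (s : X.Sec W) :
    χ.degZero E F N T (h.trans hW) (X.res h s) = Y.res h (χ.degZero E F N W hW s) := by
  rw [IsoOn.degZero_apply, IsoOn.degZero_apply, map_sum]
  refine Finset.sum_congr rfl fun k _ => ?_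
  rw [E.weight_res, χ.app_res hW h, F.weight_res]

theorem IsoOn.degZero_even {W : Opens M} (hW : W ≤ V) {s : X.Sec W} (hs : s ∈ X.even W) :
    χ.degZero E F N W hW s ∈ Y.even W := by
  rw [IsoOn.degZero_apply]
  exact Submodule.sum_mem _ fun k _ => F.weight_even N k (χ.app_even hW (E.weight_even N k hs))

theorem IsoOn.degZero_odd {W : Opens M} (hW : W ≤ V) {s : X.Sec W} (hs : s ∈ X.odd W) :
    χ.degZero E F N W hW s ∈ Y.odd W := by
  rw [IsoOn.degZero_apply]
  exact Submodule.sum_mem _ fun k _ => F.weight_odd N k (χ.app_odd hW (E.weight_odd N k hs))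

variable [CharZero 𝕜] {N}

theorem IsoOn.degZero_of_eigen {W : Opens M} (hW : W ≤ V) {k : ℕ} (hk : k ≤ N) {s : X.Sec W}
    (hs : E.app W s = (k : 𝕜) • s) :
    χ.degZero E F N W hW s = F.weight N k W (χ.app W hW s) := by
  rw [IsoOn.degZero_apply, Finset.sum_eq_single k, E.weight_of_eigen hk hs]
  · intro l _ hl
    rw [E.weight_of_eigen_ne hk hl hs, map_zero, map_zero]
  · intro h
    exact absurd (Finset.mem_range_succ_iff.2 hk) h

theorem IsoOn.degZero_one {W : Opens M} (hW : W ≤ V) : χ.degZero E F N W hW 1 = 1 := by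
  have h0 : ∀ {Z : SuperSheaf 𝕜 M} (G : Euler Z), G.app W 1 = ((0 : ℕ) : 𝕜) • (1 : Z.Sec W) := by
    intro Z G
    have h := G.app_mul (U := W) 1 1
    rw [mul_one, mul_one, one_mul] at h
    rw [Nat.cast_zero, zero_smul]
    exact left_eq_add.1 h
  rw [χ.degZero_of_eigen E F hW (Nat.zero_le N) (h0 E), map_one,
    F.weight_of_eigen (Nat.zero_le N) (h0 F)]

variable (hX : ∀ U, X.J (N + 1) U = ⊥) (hY : ∀ U, Y.J (N + 1) U = ⊥)
include hX hY

/-- On the weight space `k`, both maps agree modulo `J ^ (k + 1)` with `χ` and its inverse, and a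
section of weight `k` is determined by its class modulo `J ^ (k + 1)`. -/
theorem IsoOn.degZero_symm_degZero {W : Opens M} (hW : W ≤ V) (s : X.Sec W) :
    χ.symm.degZero F E N W hW (χ.degZero E F N W hW s) = s := by
  conv_rhs => rw [← E.sum_weight (N := N) s]
  rw [χ.degZero_apply, map_sum]
  refine Finset.sum_congr rfl fun k hk => ?_
  have hk' : k ≤ N := Finset.mem_range_succ_iff.1 hk
  rw [χ.symm.degZero_of_eigen F E hW hk' (F.app_weight hY hk' _)]
  generalize hv : E.weight N k W s = v
  have hv1 : E.app W v = (k : 𝕜) • v := by rw [← hv]; exact E.app_weight hX hk' s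
  have hv2 : v ∈ X.J k W := E.mem_J_of_eigen hv1
  rw [← E.weight_of_eigen hk' hv1, E.weight_of_eigen hk' hv1]
  refine (E.weight_congr hX hk' (t := v) ?_).trans (E.weight_of_eigen hk' hv1)
  have h1 := χ.symm.app_mem_J hW (F.weight_sub_mem_J hk' (χ.app_mem_J hW hv2))
  rw [map_sub] at h1
  have h2 : χ.symm.app W hW (χ.app W hW v) = v := (χ.app W hW).symm_apply_apply v
  rwa [h2] at h1

/-- For `s`, `t` of weights `k`, `l`, both sides have weight `k + l` and agree modulo
`J ^ (k + l + 1)`; if `k + l > N`, both vanish. -/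
theorem IsoOn.degZero_mul {W : Opens M} (hW : W ≤ V) (s t : X.Sec W) :
    χ.degZero E F N W hW (s * t) = χ.degZero E F N W hW s * χ.degZero E F N W hW t := by
  have key : ∀ k ∈ Finset.range (N + 1), ∀ l ∈ Finset.range (N + 1), ∀ v w : X.Sec W,
      E.app W v = (k : 𝕜) • v → E.app W w = (l : 𝕜) • w →
      χ.degZero E F N W hW (v * w) = χ.degZero E F N W hW v * χ.degZero E F N W hW w := by
    intro k hk l hl v w hv hw
    have hk' : k ≤ N := Finset.mem_range_succ_iff.1 hk
    have hl' : l ≤ N := Finset.mem_range_succ_iff.1 hl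
    have hvw : E.app W (v * w) = ((k + l : ℕ) : 𝕜) • (v * w) := by
      rw [E.app_mul, hv, hw, smul_mul_assoc, mul_smul_comm, ← add_smul, Nat.cast_add]
    rw [χ.degZero_of_eigen E F hW hk' hv, χ.degZero_of_eigen E F hW hl' hw]
    have hvJ := χ.app_mem_J hW (E.mem_J_of_eigen hv)
    have hwJ := χ.app_mem_J hW (E.mem_J_of_eigen hw)
    have ha := F.app_weight hY hk' (χ.app W hW v)
    have hb := F.app_weight hY hl' (χ.app W hW w)
    have hav := F.weight_sub_mem_J hk' hvJ
    have hbw := F.weight_sub_mem_J hl' hwJ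
    generalize F.weight N k W (χ.app W hW v) = a at *
    generalize F.weight N l W (χ.app W hW w) = b at *
    have hab : F.app W (a * b) = ((k + l : ℕ) : 𝕜) • (a * b) := by
      rw [F.app_mul, ha, hb, smul_mul_assoc, mul_smul_comm, ← add_smul, Nat.cast_add]
    by_cases hkl : k + l ≤ N
    · rw [χ.degZero_of_eigen E F hW hkl hvw, ← F.weight_of_eigen hkl hab]
      refine (F.weight_congr hY hkl ?_).symm
      have h1 := Y.mul_mem_J hav (F.mem_J_of_eigen hb)
      have h2 := Y.mul_mem_J hvJ hbw
      rw [show k + 1 + l = k + l + 1 by omega] at h1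
      have h3 := add_mem h1 h2
      have e : (a - χ.app W hW v) * b + χ.app W hW v * (b - χ.app W hW w) =
          a * b - χ.app W hW (v * w) := by
        rw [map_mul]; noncomm_ring
      rwa [e] at h3
    · have h1 := X.J_antitone (by omega : N + 1 ≤ k + l) (E.mem_J_of_eigen hvw)
      have h2 := Y.J_antitone (by omega : N + 1 ≤ k + l) (F.mem_J_of_eigen hab)
      rw [hX] at h1
      rw [hY] at h2
      rw [(h1 : v * w = 0), (h2 : a * b = 0), map_zero]
  rw [← E.sum_weight (N := N) s, ← E.sum_weight (N := N) t, Finset.sum_mul_sum, map_sum, map_sum,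
    map_sum, Finset.sum_mul_sum]
  refine Finset.sum_congr rfl fun k hk => ?_
  rw [map_sum]
  exact Finset.sum_congr rfl fun l hl => key k hk l hl _ _
    (E.app_weight hX (Finset.mem_range_succ_iff.1 hk) s)
    (E.app_weight hX (Finset.mem_range_succ_iff.1 hl) t)

/-- The part of an isomorphism preserving the gradings is an isomorphism. -/
def IsoOn.degZeroIso : IsoOn V X Y where
  app W hW :=
    AlgEquiv.ofLinearEquiv
      (LinearEquiv.ofLinearMap (χ.degZero E F N W hW) (χ.symm.degZero F E N W hW)
        (LinearMap.ext fun s => χ.symm.degZero_symm_degZero F E hY hX hW s)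
        (LinearMap.ext fun s => χ.degZero_symm_degZero E F hX hY hW s))
      (χ.degZero_one E F hW) (fun s t => χ.degZero_mul E F hX hY hW s t)
  app_res hW h s := χ.degZero_res E F N hW h s
  app_even hW _ hs := χ.degZero_even E F N hW hs
  app_odd hW _ hs := χ.degZero_odd E F N hW hs

/-- Isomorphisms which induce the same map on the associated graded algebras have the same part of
degree zero. -/
theorem IsoOn.degZero_congr {V' W : Opens M} (χ' : IsoOn V' X Y)
    (hW : W ≤ V) (hW' : W ≤ V') (h : (χ.trans χ' hW hW').ActsTriviallyOnGr) (s : X.Sec W) :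
    χ.degZero E F N W hW s = χ'.degZero E F N W hW' s := by
  rw [χ.degZero_apply, χ'.degZero_apply]
  refine Finset.sum_congr rfl fun k hk => ?_
  have hk' : k ≤ N := Finset.mem_range_succ_iff.1 hk
  refine F.weight_congr hY hk' ?_
  have h1 := h k W le_rfl _ (χ'.app_mem_J hW' (E.weight_mem_J hX hk' s))
  have h2 : (χ.trans χ' hW hW').app W le_rfl (χ'.app W hW' (E.weight N k W s)) =
      χ.app W hW (E.weight N k W s) :=
    congrArg (χ.app W hW) (AlgEquiv.symm_apply_apply _ _)
  rwa [h2] at h1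

include E F in
/-- Two sheaves with Euler derivations are isomorphic if they are locally isomorphic by
isomorphisms which induce the same map on the associated graded algebras. -/
theorem Euler.isIso_of_cover {ι : Type*} {U : ι → Opens M} (hU : ⨆ i, U i = ⊤)
    (g : ∀ i, IsoOn (U i) X Y)
    (hg : ∀ (i j : ι) (W : Opens M) (hi : W ≤ U i) (hj : W ≤ U j),
      ((g i).trans (g j) hi hj).ActsTriviallyOnGr) : IsIso X Y :=
  IsoOn.isIso_of_cover hU (fun i => (g i).degZeroIso E F hX hY) fun i j W hi hj s =>
    (g i).degZero_congr E F hX hY (g j) hi hj (hg i j W hi hj) s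

end Theta

/-- The isomorphism of quotients `O / J ^ k` induced by an isomorphism acting trivially on the
associated graded algebra acts trivially too. -/
theorem IsoOn.ActsTriviallyOnGr.quot_trans {𝕜 : Type} [Field 𝕜] {M : Type u} [TopologicalSpace M]
    {X Y : SuperSheaf 𝕜 M} {U V W : Opens M} {g : IsoOn U X Y} {h : IsoOn V X Y} (hU : W ≤ U)
    (hV : W ≤ V) (hgh : (g.trans h hU hV).ActsTriviallyOnGr) (k : ℕ) :
    ((g.quot k).trans (h.quot k) hU hV).ActsTriviallyOnGr := by
  intro l T hT s hs
  refine (Y.quot k).J_of_locally fun x hx => ?_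
  obtain ⟨R, hR, hxR, r, hr, e⟩ := Y.exists_proj_of_mem_J k l hs x hx
  refine ⟨R, hR, hxR, ?_⟩
  rw [map_sub, ← ((g.quot k).trans (h.quot k) hU hV).app_res hT hR, ← e]
  have h1 : ((h.quot k).app R ((hR.trans hT).trans hV)).symm (Y.proj k R r) =
      X.proj k R ((h.app R ((hR.trans hT).trans hV)).symm r) := by
    rw [AlgEquiv.symm_apply_eq, h.quot_app_proj, AlgEquiv.apply_symm_apply]
  have h2 : ((g.quot k).trans (h.quot k) hU hV).app R (hR.trans hT) (Y.proj k R r) =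
      Y.proj k R ((g.trans h hU hV).app R (hR.trans hT) r) := by
    change (g.quot k).app R ((hR.trans hT).trans hU) (((h.quot k).app R _).symm (Y.proj k R r)) = _
    rw [h1, g.quot_app_proj]
    rfl
  rw [h2, ← map_sub]
  exact Y.proj_mem_J k _ (hgh l R (hR.trans hT) r hr)

end SuperSheaf

section ExteriorBundle

open Bundle

namespace VecBundle

/-! ### Sections of the exterior algebra bundle in a local trivialization -/

section Graded

variable {𝕜 : Type} [RCLike 𝕜] {W W' : Type} [AddCommGroup W] [Module 𝕜 W] [AddCommGroup W']
  [Module 𝕜 W']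

/-- The degree derivation of the exterior algebra, multiplication by `k` on `⋀^k`. -/
def degDer : ExteriorAlgebra 𝕜 W →ₗ[𝕜] ExteriorAlgebra 𝕜 W :=
  DirectSum.toModule 𝕜 ℕ _ (fun k => (k : 𝕜) • (⋀[𝕜]^k W).subtype) ∘ₗ
    (DirectSum.decomposeLinearEquiv (fun i : ℕ => ⋀[𝕜]^i W)).toLinearMap

theorem degDer_of_mem {k : ℕ} {a : ExteriorAlgebra 𝕜 W} (h : a ∈ ⋀[𝕜]^k W) :
    degDer a = (k : 𝕜) • a := by
  rw [degDer, LinearMap.comp_apply]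
  change DirectSum.toModule 𝕜 ℕ _ _ (DirectSum.decompose (fun i : ℕ => ⋀[𝕜]^i W) a) = _
  have h1 := DirectSum.decompose_of_mem (fun i : ℕ => ⋀[𝕜]^i W) h
  rw [h1]
  exact DirectSum.toModule_lof 𝕜 k _

theorem hom_induction {C : ExteriorAlgebra 𝕜 W → Prop} (h0 : C 0)
    (hadd : ∀ a b, C a → C b → C (a + b)) (hh : ∀ (k : ℕ) (a), a ∈ ⋀[𝕜]^k W → C a) (a) : C a := by
  induction a using DirectSum.Decomposition.inductionOn (fun i : ℕ => ⋀[𝕜]^i W) with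
  | zero => exact h0
  | add a b ha hb => exact hadd a b ha hb
  | @homogeneous i a => exact hh i a a.2

theorem degDer_mul (a b : ExteriorAlgebra 𝕜 W) :
    degDer (a * b) = degDer a * b + a * degDer b := by
  induction a using hom_induction with
  | h0 => simp
  | hadd a a' ha ha' => rw [add_mul, map_add, ha, ha', map_add]; noncomm_ring
  | hh k a ha =>
    induction b using hom_induction with
    | h0 => simp
    | hadd b b' hb hb' => rw [mul_add, map_add, hb, hb', map_add]; noncomm_ring
    | hh l b hb =>
      have hab : a * b ∈ ⋀[𝕜]^(k + l) W := SetLike.mul_mem_graded ha hb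
      rw [degDer_of_mem ha, degDer_of_mem hb, degDer_of_mem hab, smul_mul_assoc, mul_smul_comm,
        ← add_smul, Nat.cast_add]

theorem map_mem_exteriorPower (f : W →ₗ[𝕜] W') {k : ℕ} {a : ExteriorAlgebra 𝕜 W}
    (h : a ∈ ⋀[𝕜]^k W) : ExteriorAlgebra.map f a ∈ ⋀[𝕜]^k W' := by
  have := pr_map f k a
  rw [pr_of_mem h] at this
  rw [← this]
  exact pr_mem k _

theorem degDer_map (f : W →ₗ[𝕜] W') (a : ExteriorAlgebra 𝕜 W) :
    degDer (ExteriorAlgebra.map f a) = ExteriorAlgebra.map f (degDer a) := by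
  induction a using hom_induction with
  | h0 => simp
  | hadd a b ha hb => simp only [map_add, ha, hb]
  | hh k a ha => rw [degDer_of_mem ha, degDer_of_mem (map_mem_exteriorPower f ha), map_smul]

theorem pr_degDer (l : ℕ) (a : ExteriorAlgebra 𝕜 W) : pr l (degDer a) = (l : 𝕜) • pr l a := by
  induction a using hom_induction with
  | h0 => simp
  | hadd a b ha hb => simp only [map_add, ha, hb, smul_add]
  | hh k a ha =>
    rw [degDer_of_mem ha, map_smul]
    by_cases h : k = l
    · rw [h]
    · rw [pr_of_mem_ne ha h, smul_zero, smul_zero]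

theorem degDer_mem_evenOdd {i : ZMod 2} {a : ExteriorAlgebra 𝕜 W}
    (ha : a ∈ CliffordAlgebra.evenOdd (0 : QuadraticForm 𝕜 W) i) :
    degDer a ∈ CliffordAlgebra.evenOdd (0 : QuadraticForm 𝕜 W) i := by
  unfold CliffordAlgebra.evenOdd at ha
  induction ha using Submodule.iSup_induction' with
  | mem j x hx =>
    have h1 : degDer x = ((j.1 : ℕ) : 𝕜) • x := degDer_of_mem (k := j.1) hx
    rw [h1]
    exact Submodule.smul_mem _ _ (Submodule.mem_iSup_of_mem j hx)
  | zero => rw [map_zero]; exact zero_mem _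
  | add x y _ _ hx hy => rw [map_add]; exact add_mem hx hy

theorem eq_zero_of_pr {a : ExteriorAlgebra 𝕜 W} (h : ∀ l, pr l a = 0) : a = 0 := by
  apply (DirectSum.decompose (fun i : ℕ => ⋀[𝕜]^i W)).injective
  rw [DirectSum.decompose_zero]
  exact DFinsupp.ext fun l => Subtype.ext (h l)

/-- The exterior algebra of a finite-dimensional space is bounded. -/
theorem exists_pr_eq_zero (q : ℕ) : ∃ N : ℕ, ∀ l, N < l → ∀ a : StdExt 𝕜 q, pr l a = 0 := by
  classical
  let B := Module.finBasis 𝕜 (StdExt 𝕜 q)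
  have h1 : ∀ a : StdExt 𝕜 q, ∃ N : ℕ, ∀ l, N < l → pr l a = 0 := by
    intro a
    induction a using hom_induction with
    | h0 => exact ⟨0, fun l _ => map_zero _⟩
    | hadd a b ha hb =>
      obtain ⟨N, hN⟩ := ha
      obtain ⟨N', hN'⟩ := hb
      refine ⟨max N N', fun l hl => ?_⟩
      rw [map_add, hN l (lt_of_le_of_lt (le_max_left _ _) hl),
        hN' l (lt_of_le_of_lt (le_max_right _ _) hl), add_zero]
    | hh k a ha => exact ⟨k, fun l hl => pr_of_mem_ne ha hl.ne⟩
  choose N hN using h1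
  refine ⟨Finset.univ.sup fun i => N (B i), fun l hl a => ?_⟩
  rw [← B.sum_repr a, map_sum]
  refine Finset.sum_eq_zero fun i _ => ?_
  rw [map_smul, hN (B i) l (lt_of_le_of_lt (Finset.le_sup (f := fun i => N (B i))
    (Finset.mem_univ i)) hl), smul_zero]

end Graded

variable {𝕜 : Type} [RCLike 𝕜] {n : WithTop ℕ∞} {m q : ℕ} {M : Type u} [TopologicalSpace M]
  [ChartedSpace (Std 𝕜 m) M]

section Smooth

theorem SmoothAt.sum {ι : Type*} (t : Finset ι) {a : ι → M → StdExt 𝕜 q} {x : M}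
    (h : ∀ i ∈ t, SmoothAt n m (a i) x) : SmoothAt n m (fun y => ∑ i ∈ t, a i y) x := by
  intro ℓ
  simp only [map_sum]
  exact ContMDiffAt.sum fun i hi => h i hi ℓ

theorem SmoothAt.smul_const {f : M → 𝕜} {x : M} (hf : ContMDiffAt 𝓘(𝕜, Std 𝕜 m) 𝓘(𝕜, 𝕜) n f x)
    (c : StdExt 𝕜 q) : SmoothAt n m (fun y => f y • c) x := by
  intro ℓ
  simp only [map_smul]
  exact hf.smul contMDiffAt_const

theorem SmoothAt.congr {a b : M → StdExt 𝕜 q} {x : M} (ha : SmoothAt n m a x)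
    (h : ∀ᶠ y in 𝓝 x, b y = a y) : SmoothAt n m b x :=
  fun ℓ => (ha ℓ).congr_of_eventuallyEq (h.mono fun _ hy => congrArg ℓ hy)

/-- The exterior powers of a `C^n` family of linear maps are `C^n`. -/
theorem SmoothAt.map {L : M → Module.Dual 𝕜 (Std 𝕜 q) →ₗ[𝕜] Module.Dual 𝕜 (Std 𝕜 q)}
    {a : M → StdExt 𝕜 q} {x : M}
    (hL : ∀ ξ, SmoothAt n m (fun y => ExteriorAlgebra.ι 𝕜 (L y ξ)) x) (ha : SmoothAt n m a x) :
    SmoothAt n m (fun y => ExteriorAlgebra.map (L y) (a y)) x := by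
  -- on constant elements, by induction on generators; in general, by expanding in a basis
  have hc : ∀ c : StdExt 𝕜 q, SmoothAt n m (fun y => ExteriorAlgebra.map (L y) c) x := by
    intro c
    induction c using ExteriorAlgebra.induction with
    | algebraMap r => simp only [AlgHom.commutes]; exact SmoothAt.const _ x
    | ι ξ => simp only [ExteriorAlgebra.map_apply_ι]; exact hL ξ
    | mul a b ha hb => simp only [map_mul]; exact ha.mul hb
    | add a b ha hb => simp only [map_add]; exact ha.add hb
  let B := Module.finBasis 𝕜 (StdExt 𝕜 q)
  have h : (fun y => ExteriorAlgebra.map (L y) (a y)) = fun y =>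
      ∑ i, (B.coord i (a y) • (1 : StdExt 𝕜 q)) * ExteriorAlgebra.map (L y) (B i) := by
    funext y
    conv_lhs => rw [← B.sum_repr (a y), map_sum]
    refine Finset.sum_congr rfl fun i _ => ?_
    rw [map_smul, smul_one_mul]
    rfl
  rw [h]
  exact SmoothAt.sum _ fun i _ => (SmoothAt.smul_const (ha (B.coord i)) 1).mul (hc (B i))

theorem SmoothAt.ι_dualMap {c : M → Std 𝕜 q →L[𝕜] Std 𝕜 q} {x : M}
    (hc : ContMDiffAt 𝓘(𝕜, Std 𝕜 m) 𝓘(𝕜, Std 𝕜 q →L[𝕜] Std 𝕜 q) n c x)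
    (ξ : Module.Dual 𝕜 (Std 𝕜 q)) :
    SmoothAt n m (fun y => ExteriorAlgebra.ι 𝕜 ((c y).toLinearMap.dualMap ξ)) x := by
  let B := Module.finBasis 𝕜 (Std 𝕜 q)
  have h : (fun y => ExteriorAlgebra.ι 𝕜 ((c y).toLinearMap.dualMap ξ)) = fun y =>
      ∑ i, ξ (c y (B i)) • ExteriorAlgebra.ι 𝕜 (B.coord i) := by
    funext y
    have : (c y).toLinearMap.dualMap ξ = ∑ i, ξ (c y (B i)) • B.coord i := by
      refine B.ext fun j => ?_
      rw [LinearMap.sum_apply, Finset.sum_eq_single j]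
      · simp
      · intro i _ hij
        simp [hij.symm]
      · intro h
        exact absurd (Finset.mem_univ j) h
    rw [this, map_sum]
    simp only [map_smul]
  rw [h]
  refine SmoothAt.sum _ fun i _ => SmoothAt.smul_const ?_ _
  have h1 : ContMDiffAt 𝓘(𝕜, Std 𝕜 m) 𝓘(𝕜, Std 𝕜 q) n (fun y => c y (B i)) x :=
    hc.clm_apply contMDiffAt_const
  exact (LinearMap.toContinuousLinearMap ξ).contMDiff.contMDiffAt.comp x h1

end Smooth

variable (V : VecBundle 𝕜 n m q M)

/-- The map `⋀ V_y^∨ → ⋀ (𝕜^q)^∨` induced by a trivialization of `V`. -/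
def coordE (e : Trivialization (Std 𝕜 q) (π (Std 𝕜 q) V.fiber)) [e.IsLinear 𝕜] (y : M) :
    V.Ext y →ₐ[𝕜] StdExt 𝕜 q :=
  ExteriorAlgebra.map (e.symmL 𝕜 y).toLinearMap.dualMap

/-- The inverse of `V.coordE e y`, for `y` in the base set of the trivialization `e`. -/
def cocoordE (e : Trivialization (Std 𝕜 q) (π (Std 𝕜 q) V.fiber)) [e.IsLinear 𝕜] (y : M) :
    StdExt 𝕜 q →ₐ[𝕜] V.Ext y :=
  ExteriorAlgebra.map (e.continuousLinearMapAt 𝕜 y).toLinearMap.dualMap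

section Triv

variable (e e' : Trivialization (Std 𝕜 q) (π (Std 𝕜 q) V.fiber)) [MemTrivializationAtlas e]
  [MemTrivializationAtlas e']

theorem map_map_apply {W W' W'' : Type} [AddCommGroup W] [Module 𝕜 W] [AddCommGroup W']
    [Module 𝕜 W'] [AddCommGroup W''] [Module 𝕜 W''] (f : W →ₗ[𝕜] W') (g : W' →ₗ[𝕜] W'')
    (a : ExteriorAlgebra 𝕜 W) :
    ExteriorAlgebra.map g (ExteriorAlgebra.map f a) = ExteriorAlgebra.map (g ∘ₗ f) a := by
  rw [← ExteriorAlgebra.map_comp_map]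
  rfl

theorem coordE_cocoordE {y : M} (hy : y ∈ e.baseSet) (a : StdExt 𝕜 q) :
    V.coordE e y (V.cocoordE e y a) = a := by
  rw [coordE, cocoordE, map_map_apply]
  have : (e.symmL 𝕜 y).toLinearMap.dualMap ∘ₗ
      (e.continuousLinearMapAt 𝕜 y).toLinearMap.dualMap = LinearMap.id := by
    ext ξ v
    exact congrArg ξ (e.continuousLinearMapAt_symmL hy v)
  rw [this, ExteriorAlgebra.map_id]
  rfl

theorem cocoordE_coordE {y : M} (hy : y ∈ e.baseSet) (a : V.Ext y) :
    V.cocoordE e y (V.coordE e y a) = a := by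
  rw [coordE, cocoordE, map_map_apply]
  have : (e.continuousLinearMapAt 𝕜 y).toLinearMap.dualMap ∘ₗ
      (e.symmL 𝕜 y).toLinearMap.dualMap = LinearMap.id := by
    ext ξ v
    exact congrArg ξ (e.symmL_continuousLinearMapAt hy v)
  rw [this, ExteriorAlgebra.map_id]
  rfl

theorem coordE_change {y : M} (hy : y ∈ e.baseSet) (hy' : y ∈ e'.baseSet) (a : V.Ext y) :
    V.coordE e' y a = ExteriorAlgebra.map
      ((e'.coordChangeL 𝕜 e y : Std 𝕜 q →L[𝕜] Std 𝕜 q).toLinearMap.dualMap) (V.coordE e y a) := by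
  rw [coordE, coordE, map_map_apply]
  congr 2
  ext ξ v
  have h := e'.coordChangeL_apply (R := 𝕜) e ⟨hy', hy⟩ v
  change ξ (e'.symmL 𝕜 y v) = ξ (e.symmL 𝕜 y (e'.coordChangeL 𝕜 e y v))
  rw [h, e'.symmL_apply hy', e.symmL_apply hy]
  exact congrArg ξ (e.symm_apply_apply_mk hy (e'.symm y v)).symm

variable {V}

theorem regularAt_of_coordE {U : Opens M} {s : ∀ y : U, V.Ext y} {x : M} (hx : x ∈ e.baseSet)
    (hx' : x ∈ e'.baseSet)
    (h : ∃ a : M → StdExt 𝕜 q, SmoothAt n m a x ∧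
      ∀ᶠ y in 𝓝 x, ∀ hy : y ∈ U, V.coordE e y (s ⟨y, hy⟩) = a y) :
    ∃ a : M → StdExt 𝕜 q, SmoothAt n m a x ∧
      ∀ᶠ y in 𝓝 x, ∀ hy : y ∈ U, V.coordE e' y (s ⟨y, hy⟩) = a y := by
  obtain ⟨a, ha, hs⟩ := h
  refine ⟨fun y => ExteriorAlgebra.map
    ((e'.coordChangeL 𝕜 e y : Std 𝕜 q →L[𝕜] Std 𝕜 q).toLinearMap.dualMap) (a y),
    SmoothAt.map (fun ξ => SmoothAt.ι_dualMap (contMDiffAt_coordChangeL hx' hx) ξ) ha, ?_⟩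
  filter_upwards [hs, e.open_baseSet.mem_nhds hx, e'.open_baseSet.mem_nhds hx'] with y h1 h2 h3 hy
  rw [V.coordE_change e e' h2 h3, h1 hy]

/-- Regularity may be tested in any trivialization of the atlas. -/
theorem regularAt_iff {U : Opens M} {s : ∀ y : U, V.Ext y} {x : M} (hx : x ∈ e.baseSet) :
    V.RegularAt s x ↔ ∃ a : M → StdExt 𝕜 q, SmoothAt n m a x ∧
      ∀ᶠ y in 𝓝 x, ∀ hy : y ∈ U, V.coordE e y (s ⟨y, hy⟩) = a y :=
  ⟨fun h => regularAt_of_coordE (trivializationAt (Std 𝕜 q) V.fiber x) e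
      (FiberBundle.mem_baseSet_trivializationAt' x) hx h,
    fun h => regularAt_of_coordE e (trivializationAt (Std 𝕜 q) V.fiber x) hx
      (FiberBundle.mem_baseSet_trivializationAt' x) h⟩

/-- The coordinates of a section of `⋀ V^∨` in a trivialization, extended by zero. -/
def coords {U : Opens M} (s : ∀ y : U, V.Ext y) (y : M) : StdExt 𝕜 q :=
  open scoped Classical in if hy : y ∈ U then V.coordE e y (s ⟨y, hy⟩) else 0

theorem coords_apply {U : Opens M} (s : ∀ y : U, V.Ext y) (y : U) :
    coords e s y = V.coordE e y (s y) :=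
  dif_pos y.2

theorem smoothAt_coords {U : Opens M} {s : ∀ y : U, V.Ext y} (hs : s ∈ V.sections U) {x : M}
    (hx : x ∈ U) (hxe : x ∈ e.baseSet) : SmoothAt n m (coords e s) x := by
  obtain ⟨a, ha, h⟩ := (regularAt_iff e hxe).1 (hs x hx)
  refine ha.congr ?_
  filter_upwards [h, U.isOpen.mem_nhds hx] with y hy hyU
  rw [← hy hyU]
  exact coords_apply e s ⟨y, hyU⟩

theorem cocoordE_mem_sections {U : Opens M} (hU : ∀ y ∈ U, y ∈ e.baseSet) {a : M → StdExt 𝕜 q}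
    (ha : ∀ x ∈ U, SmoothAt n m a x) : (fun y : U => V.cocoordE e y (a y)) ∈ V.sections U := by
  intro x hx
  refine (regularAt_iff e (hU x hx)).2 ⟨a, ha x hx, ?_⟩
  exact Filter.Eventually.of_forall fun y hy => V.coordE_cocoordE e (hU y hy) _

end Triv

/-! ### The powers of the odd ideal of a split supermanifold -/

variable {𝕜 : Type} [RCLike 𝕜] {n : WithTop ℕ∞} {m q : ℕ} {M : Type u} [TopologicalSpace M]
  [ChartedSpace (Std 𝕜 m) M]

section Triv

variable {V : VecBundle 𝕜 n m q M} (e : Trivialization (Std 𝕜 q) (π (Std 𝕜 q) V.fiber))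
  [MemTrivializationAtlas e]

/-- The sections with constant coordinates in a trivialization. -/
def constSec {W : Opens M} (hW : ∀ y ∈ W, y ∈ e.baseSet) : StdExt 𝕜 q →ₐ[𝕜] V.sections W where
  toFun z := ⟨fun y => V.cocoordE e y z, cocoordE_mem_sections e hW fun x _ => SmoothAt.const z x⟩
  map_one' := Subtype.ext (funext fun _ => map_one _)
  map_mul' a b := Subtype.ext (funext fun _ => map_mul _ a b)
  map_zero' := Subtype.ext (funext fun _ => map_zero _)
  map_add' a b := Subtype.ext (funext fun _ => map_add _ a b)
  commutes' r := Subtype.ext (funext fun _ => AlgHom.commutes _ r)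

theorem constSec_mem_oddIdeal_pow {W : Opens M} (hW : ∀ y ∈ W, y ∈ e.baseSet) {l : ℕ}
    {z : StdExt 𝕜 q} (hz : z ∈ ⋀[𝕜]^l (Module.Dual 𝕜 (Std 𝕜 q))) :
    (constSec e hW z : V.split.Sec W) ∈ V.split.oddIdeal W ^ l := by
  induction l generalizing z with
  | zero => rw [Submodule.pow_zero, Ideal.one_eq_top]; trivial
  | succ l ih =>
    rw [ExteriorAlgebra.exteriorPower, pow_succ] at hz
    rw [Submodule.pow_succ]
    induction hz using Submodule.mul_induction_on' with
    | mem_mul_mem a ha b hb =>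
      have h : (constSec e hW (a * b) : V.split.Sec W) =
        (constSec e hW a : V.split.Sec W) * (constSec e hW b : V.split.Sec W) := map_mul _ a b
      rw [h]
      refine Ideal.mul_mem_mul (ih ha) (Ideal.subset_span fun y => ?_)
      obtain ⟨ξ, rfl⟩ := hb
      have h1 : V.cocoordE e y (ExteriorAlgebra.ι 𝕜 ξ) = ExteriorAlgebra.ι 𝕜 _ :=
        ExteriorAlgebra.map_apply_ι _ ξ
      change V.cocoordE e y (ExteriorAlgebra.ι 𝕜 ξ) ∈ _
      rw [h1]
      exact CliffordAlgebra.ι_mem_evenOdd_one _ _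
    | add a _ b _ ha hb =>
      have h : (constSec e hW (a + b) : V.split.Sec W) =
        (constSec e hW a : V.split.Sec W) + (constSec e hW b : V.split.Sec W) := map_add _ a b
      rw [h]
      exact add_mem ha hb

theorem constSec_sub_mem_oddIdeal_pow {W : Opens M} (hW : ∀ y ∈ W, y ∈ e.baseSet) (k : ℕ)
    (z : StdExt 𝕜 q) : (constSec e hW (z - ∑ l ∈ Finset.range k, pr l z) : V.split.Sec W) ∈
      V.split.oddIdeal W ^ k := by
  induction z using hom_induction with
  | h0 =>
    have : (0 : StdExt 𝕜 q) - ∑ l ∈ Finset.range k, pr l (0 : StdExt 𝕜 q) = 0 := by simp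
    rw [this]
    exact (congrArg (· ∈ V.split.oddIdeal W ^ k) (map_zero (constSec e hW))).mpr (zero_mem _)
  | hadd a b ha hb =>
    have : a + b - ∑ l ∈ Finset.range k, pr l (a + b) = (a - ∑ l ∈ Finset.range k, pr l a) +
        (b - ∑ l ∈ Finset.range k, pr l b) := by
      simp only [map_add, Finset.sum_add_distrib]; abel
    rw [this]
    exact (congrArg (· ∈ V.split.oddIdeal W ^ k) (map_add (constSec e hW) _ _)).mpr (add_mem ha hb)
  | hh j a ha =>
    by_cases hj : j < k
    · have : a - ∑ l ∈ Finset.range k, pr l a = 0 := by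
        rw [Finset.sum_eq_single j (fun l _ h => pr_of_mem_ne ha h.symm)
          (fun h => absurd (Finset.mem_range.2 hj) h), pr_of_mem ha, sub_self]
      rw [this]
      exact (congrArg (· ∈ V.split.oddIdeal W ^ k) (map_zero (constSec e hW))).mpr (zero_mem _)
    · have : a - ∑ l ∈ Finset.range k, pr l a = a := by
        rw [Finset.sum_eq_zero, sub_zero]
        intro l hl
        exact pr_of_mem_ne ha fun h => hj (h ▸ Finset.mem_range.1 hl)
      rw [this]
      exact Ideal.pow_le_pow_right (not_lt.1 hj) (constSec_mem_oddIdeal_pow e hW ha)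

end Triv

variable (V : VecBundle 𝕜 n m q M)

/-- The sections of `J ^ k` are those whose components of degree less than `k` vanish. -/
theorem mem_J_of_pr {U : Opens M} {k : ℕ} {s : V.sections U}
    (hs : ∀ l < k, ∀ y : U, pr l (s.1 y) = 0) : (s : V.split.Sec U) ∈ V.split.J k U := by
  intro x hx
  let e := trivializationAt (Std 𝕜 q) V.fiber x
  let W : Opens M := U ⊓ ⟨e.baseSet, e.open_baseSet⟩
  have hW : ∀ y ∈ W, y ∈ e.baseSet := fun y hy => hy.2
  have hWU : W ≤ U := inf_le_left
  refine ⟨W, hWU, ⟨hx, FiberBundle.mem_baseSet_trivializationAt' x⟩, ?_⟩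
  let B := Module.finBasis 𝕜 (StdExt 𝕜 q)
  let c : ∀ i, V.sections W := fun i =>
    ⟨fun y => V.cocoordE e y (B.coord i (coords e s.1 y) • 1), cocoordE_mem_sections e hW
      fun y hy => SmoothAt.smul_const (smoothAt_coords e s.2 (hWU hy) (hW y hy) (B.coord i)) 1⟩
  have h : (V.split.res hWU s : V.split.Sec W) = ∑ i, (c i : V.split.Sec W) *
      (constSec e hW (B i - ∑ l ∈ Finset.range k, pr l (B i)) : V.split.Sec W) := by
    apply Subtype.ext
    funext y
    have h1 : ((∑ i, (c i : V.split.Sec W) *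
      (constSec e hW (B i - ∑ l ∈ Finset.range k, pr l (B i)) : V.split.Sec W) :
        V.split.Sec W) : V.sections W).1 y = ∑ i, V.cocoordE e y (B.coord i (coords e s.1 y) • 1) *
        V.cocoordE e y (B i - ∑ l ∈ Finset.range k, pr l (B i)) := by
      have h2 : ((∑ i, c i * constSec e hW (B i - ∑ l ∈ Finset.range k, pr l (B i)) :
        V.sections W)).1 y = ∑ i, (c i * constSec e hW (B i - ∑ l ∈ Finset.range k, pr l (B i)) :
        V.sections W).1 y := by
        rw [AddSubmonoidClass.coe_finsetSum, Finset.sum_apply]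
      exact h2
    refine Eq.trans ?_ h1.symm
    have h3 : ∑ i, B.coord i (coords e s.1 y) • (B i - ∑ l ∈ Finset.range k, pr l (B i)) =
        coords e s.1 y := by
      have h4 : ∑ i, B.coord i (coords e s.1 y) • B i = coords e s.1 y := B.sum_repr _
      simp only [smul_sub, Finset.sum_sub_distrib, Finset.smul_sum, ← map_smul]
      rw [Finset.sum_comm, h4]
      simp only [← map_sum, h4]
      rw [sub_eq_self]
      refine Finset.sum_eq_zero fun l hl => ?_
      rw [coords_apply e s.1 ⟨y, hWU y.2⟩, coordE, pr_map, hs l (Finset.mem_range.1 hl), map_zero]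
    simp only [← map_mul, smul_one_mul]
    rw [← map_sum, h3, coords_apply e s.1 ⟨y, hWU y.2⟩]
    exact (V.cocoordE_coordE e (hW y y.2) _).symm
  rw [h]
  exact sum_mem fun i _ => Ideal.mul_mem_left _ _ (constSec_sub_mem_oddIdeal_pow e hW k (B i))

theorem exists_J_eq_bot :
    ∃ N : ℕ, ∀ (V : VecBundle 𝕜 n m q M) (U : Opens M), V.split.J (N + 1) U = ⊥ := by
  obtain ⟨N, hN⟩ := exists_pr_eq_zero (𝕜 := 𝕜) q
  refine ⟨N, fun V U => ?_⟩
  rw [eq_bot_iff]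
  intro s hs
  refine (Submodule.mem_bot _).2 (Subtype.ext (funext fun y => eq_zero_of_pr fun l => ?_))
  by_cases hl : l < N + 1
  · exact V.pr_of_mem_J hs y hl
  · let e := trivializationAt (Std 𝕜 q) V.fiber y.1
    have hy : y.1 ∈ e.baseSet := FiberBundle.mem_baseSet_trivializationAt' y.1
    rw [← V.cocoordE_coordE e hy (((s : V.sections U)).1 y), cocoordE, pr_map,
      hN l (by omega), map_zero]

/-- The derivation of the sheaf of sections of `⋀ V^∨` which is multiplication by `k` on
`⋀^k V^∨`. -/
def degSec (U : Opens M) : V.sections U →ₗ[𝕜] V.sections U where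
  toFun s := ⟨fun y => degDer (s.1 y), fun x hx => by
    obtain ⟨a, ha, ha'⟩ := s.2 x hx
    refine ⟨_, ha.linear degDer, ?_⟩
    filter_upwards [ha'] with y hy hyU
    rw [← hy hyU, coord, degDer_map]⟩
  map_add' s t := Subtype.ext (funext fun y => map_add degDer (s.1 y) (t.1 y))
  map_smul' c s := Subtype.ext (funext fun y => map_smul degDer c (s.1 y))

/-- A split supermanifold has an Euler derivation. -/
def splitEuler : SuperSheaf.Euler V.split where
  app U := V.degSec U
  app_res _ _ := rfl
  app_mul s t := Subtype.ext (funext fun y =>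
    degDer_mul ((s : V.sections _).1 y) ((t : V.sections _).1 y))
  app_even hs y := degDer_mem_evenOdd (hs y)
  app_odd hs y := degDer_mem_evenOdd (hs y)
  app_J {U k s} hs := by
    obtain ⟨t, ht⟩ : ∃ t : V.sections U, t = s := ⟨s, rfl⟩
    subst ht
    refine V.mem_J_of_pr (s := V.degSec U t - (k : 𝕜) • t) fun l hl y => ?_
    change pr l (degDer (t.1 y) - (k : 𝕜) • t.1 y) = 0
    rw [map_sub, pr_degDer, map_smul]
    rcases Nat.lt_succ_iff_lt_or_eq.1 hl with h | rfl
    · rw [V.pr_of_mem_J hs y h, smul_zero, smul_zero, sub_zero]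
    · exact sub_self _

/-! ### The linear part of an automorphism of a split supermanifold -/

section Graded

variable {𝕜 : Type} [RCLike 𝕜] {W W' : Type} [AddCommGroup W] [Module 𝕜 W] [AddCommGroup W']
  [Module 𝕜 W']

theorem algebraMapInv_of_mem {k : ℕ} (hk : k ≠ 0) {a : ExteriorAlgebra 𝕜 W} (h : a ∈ ⋀[𝕜]^k W) :
    ExteriorAlgebra.algebraMapInv a = 0 := by
  obtain ⟨k, rfl⟩ := Nat.exists_eq_succ_of_ne_zero hk
  rw [ExteriorAlgebra.exteriorPower, pow_succ] at h
  induction h using Submodule.mul_induction_on' with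
  | mem_mul_mem a _ b hb =>
    obtain ⟨ξ, rfl⟩ := hb
    rw [map_mul]
    simp [ExteriorAlgebra.algebraMapInv]
  | add a _ b _ ha hb => rw [map_add, ha, hb, add_zero]

theorem pr_zero (a : ExteriorAlgebra 𝕜 W) :
    pr 0 a = algebraMap 𝕜 _ (ExteriorAlgebra.algebraMapInv a) := by
  induction a using hom_induction with
  | h0 => simp
  | hadd a b ha hb => simp only [map_add, ha, hb]
  | hh k a ha =>
    by_cases hk : k = 0
    · subst hk
      rw [pr_of_mem ha]
      rw [ExteriorAlgebra.exteriorPower, pow_zero] at ha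
      obtain ⟨c, rfl⟩ := Submodule.mem_one.1 ha
      rw [ExteriorAlgebra.algebraMap_leftInverse]
    · rw [pr_of_mem_ne ha hk, algebraMapInv_of_mem hk ha, map_zero]

theorem pr_zero_eq_zero_iff (a : ExteriorAlgebra 𝕜 W) :
    pr 0 a = 0 ↔ ExteriorAlgebra.algebraMapInv a = 0 := by
  rw [pr_zero, ExteriorAlgebra.algebraMap_eq_zero_iff]

theorem algebraMapInv_map (f : W →ₗ[𝕜] W') (a : ExteriorAlgebra 𝕜 W) :
    ExteriorAlgebra.algebraMapInv (ExteriorAlgebra.map f a) = ExteriorAlgebra.algebraMapInv a := by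
  have h : (ExteriorAlgebra.algebraMapInv.comp (ExteriorAlgebra.map f)) =
      (ExteriorAlgebra.algebraMapInv : ExteriorAlgebra 𝕜 W →ₐ[𝕜] 𝕜) := by
    ext v
    simp [ExteriorAlgebra.algebraMapInv]
  exact congrArg (fun g => g a) h

/-- The component of degree `1`, as a vector. -/
def linComp : ExteriorAlgebra 𝕜 W →ₗ[𝕜] W :=
  ExteriorAlgebra.ιInv ∘ₗ pr 1

theorem ι_linComp (a : ExteriorAlgebra 𝕜 W) : ExteriorAlgebra.ι 𝕜 (linComp a) = pr 1 a := by
  have h := pr_mem 1 a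
  rw [ExteriorAlgebra.exteriorPower, pow_one] at h
  obtain ⟨v, hv⟩ := h
  rw [linComp, LinearMap.comp_apply, ← hv, ExteriorAlgebra.ι_leftInverse]

theorem ι_mem (v : W) : ExteriorAlgebra.ι 𝕜 v ∈ ⋀[𝕜]^1 W := by
  rw [ExteriorAlgebra.exteriorPower, pow_one]
  exact ⟨v, rfl⟩

theorem linComp_ι (v : W) : linComp (ExteriorAlgebra.ι 𝕜 v) = v := by
  rw [linComp, LinearMap.comp_apply, pr_of_mem (ι_mem v), ExteriorAlgebra.ι_leftInverse]

theorem linComp_map (f : W →ₗ[𝕜] W') (a : ExteriorAlgebra 𝕜 W) :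
    linComp (ExteriorAlgebra.map f a) = f (linComp a) := by
  rw [linComp, LinearMap.comp_apply, pr_map, ← ι_linComp, ExteriorAlgebra.map_apply_ι,
    ExteriorAlgebra.ι_leftInverse]

theorem linComp_eq_zero_of_pr {a : ExteriorAlgebra 𝕜 W} (h : pr 1 a = 0) : linComp a = 0 := by
  rw [linComp, LinearMap.comp_apply, h, map_zero]

theorem linComp_mul_of_pr {a b : ExteriorAlgebra 𝕜 W} (h : pr 0 b = 0) :
    linComp (a * b) = ExteriorAlgebra.algebraMapInv a • linComp b := by
  rw [linComp, LinearMap.comp_apply, pr_mul, Finset.Nat.sum_antidiagonal_eq_sum_range_succ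
    (fun i j => pr i a * pr j b), Finset.sum_range_succ, Finset.sum_range_one, Nat.sub_self, h,
    mul_zero, add_zero, pr_zero, ← Algebra.smul_def, map_smul]
  rfl

theorem map_mem_evenOdd (f : W →ₗ[𝕜] W') {i : ZMod 2} {a : ExteriorAlgebra 𝕜 W}
    (ha : a ∈ CliffordAlgebra.evenOdd (0 : QuadraticForm 𝕜 W) i) :
    ExteriorAlgebra.map f a ∈ CliffordAlgebra.evenOdd (0 : QuadraticForm 𝕜 W') i := by
  unfold CliffordAlgebra.evenOdd at ha
  induction ha using Submodule.iSup_induction' with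
  | mem j x hx =>
    have h1 : ExteriorAlgebra.map f x ∈ ⋀[𝕜]^j.1 W' := map_mem_exteriorPower f (k := j.1) hx
    exact Submodule.mem_iSup_of_mem j h1
  | zero => rw [map_zero]; exact zero_mem _
  | add x y _ _ hx hy => rw [map_add]; exact add_mem hx hy

end Graded

variable {𝕜 : Type} [RCLike 𝕜] {n : WithTop ℕ∞} {m q : ℕ} {M : Type u} [TopologicalSpace M]
  [ChartedSpace (Std 𝕜 m) M]

section Functions

variable (V : VecBundle 𝕜 n m q M)

/-- A function of class `C^n`, as a section of `⋀ V^∨`. -/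
def fnSec {U : Opens M} (c : M → 𝕜)
    (hc : ∀ x ∈ U, ContMDiffAt 𝓘(𝕜, Std 𝕜 m) 𝓘(𝕜, 𝕜) n c x) : V.sections U where
  val y := algebraMap 𝕜 _ (c y)
  property x hx := ⟨fun y => c y • 1, SmoothAt.smul_const (hc x hx) 1,
    Filter.Eventually.of_forall fun y _ => by
      rw [AlgHom.commutes, Algebra.algebraMap_eq_smul_one]⟩

/-- The function underlying a section of `⋀ V^∨`, extended by zero. -/
def body {U : Opens M} (s : V.sections U) (y : M) : 𝕜 :=
  open scoped Classical in
  if hy : y ∈ U then ExteriorAlgebra.algebraMapInv (s.1 ⟨y, hy⟩) else 0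

variable {V}

theorem body_apply {U : Opens M} (s : V.sections U) (y : U) :
    V.body s y = ExteriorAlgebra.algebraMapInv (s.1 y) :=
  dif_pos y.2

theorem contMDiffAt_body {U : Opens M} (s : V.sections U) {x : M} (hx : x ∈ U) :
    ContMDiffAt 𝓘(𝕜, Std 𝕜 m) 𝓘(𝕜, 𝕜) n (V.body s) x := by
  obtain ⟨a, ha, ha'⟩ := s.2 x hx
  refine (ha ExteriorAlgebra.algebraMapInv.toLinearMap).congr_of_eventuallyEq ?_
  filter_upwards [ha', U.isOpen.mem_nhds hx] with y hy hyU
  rw [body_apply s ⟨y, hyU⟩, ← hy hyU, coord]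
  exact (algebraMapInv_map _ _).symm

/-- Automorphisms of a split supermanifold preserve the functions underlying sections: if `g f`
took a value `d ≠ f y` at `y`, then `g (f - d)` would vanish at `y`, although `f - d` is
invertible near `y`. -/
theorem algebraMapInv_app {U : Opens M} (g : SuperSheaf.IsoOn U V.split V.split) {W : Opens M}
    (hW : W ≤ U) (s : V.sections W) (y : W) :
    ExteriorAlgebra.algebraMapInv ((g.app W hW s : V.sections W).1 y) =
      ExteriorAlgebra.algebraMapInv (s.1 y) := by
  by_contra hne
  set d := ExteriorAlgebra.algebraMapInv ((g.app W hW s : V.sections W).1 y) with hd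
  let c : M → 𝕜 := fun x => V.body s x - d
  have hc : ∀ x ∈ W, ContMDiffAt 𝓘(𝕜, Std 𝕜 m) 𝓘(𝕜, 𝕜) n c x :=
    fun x hx => (contMDiffAt_body s hx).sub contMDiffAt_const
  have hcy : c y ≠ 0 := by
    change V.body s y - d ≠ 0
    rw [body_apply s y]
    exact sub_ne_zero.2 (Ne.symm hne)
  obtain ⟨T, hT, hTo, hyT⟩ := eventually_nhds_iff.1
    (((hc y y.2).continuousAt.eventually_ne hcy).and (W.isOpen.mem_nhds y.2))
  let T' : Opens M := ⟨T, hTo⟩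
  have hTW : T' ≤ W := fun x hx => (hT x hx).2
  have hinv : ∀ x ∈ T', ContMDiffAt 𝓘(𝕜, Std 𝕜 m) 𝓘(𝕜, 𝕜) n (fun x => (c x)⁻¹) x := fun x hx =>
    (contDiffAt_inv 𝕜 (hT x hx).1).contMDiffAt.comp x (hc x (hTW hx))
  -- `r` is `s - d` up to nilpotents, and `t` its inverse
  let r : V.sections T' := V.fnSec c fun x hx => hc x (hTW hx)
  let t : V.sections T' := V.fnSec _ hinv
  have hrt : r * t = 1 := by
    refine Subtype.ext (funext fun x => ?_)
    change algebraMap 𝕜 (V.Ext x) (c x) * algebraMap 𝕜 (V.Ext x) (c x)⁻¹ = 1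
    rw [← map_mul, mul_inv_cancel₀ (hT x x.2).1, map_one]
  let s' : V.sections T' := ⟨fun x => s.1 ⟨x, hTW x.2⟩, V.sections_res hTW s.2⟩
  have hnil : (s' - algebraMap 𝕜 _ d - r : V.sections T') ∈ V.split.J 1 T' := by
    refine V.mem_J_of_pr fun l hl x => ?_
    obtain rfl : l = 0 := by omega
    rw [pr_zero_eq_zero_iff]
    change ExteriorAlgebra.algebraMapInv (s.1 ⟨x, hTW x.2⟩ - algebraMap 𝕜 _ d -
      algebraMap 𝕜 _ (V.body s x - d)) = 0
    rw [map_sub, map_sub, ExteriorAlgebra.algebraMap_leftInverse,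
      ExteriorAlgebra.algebraMap_leftInverse, body_apply s ⟨x, hTW x.2⟩, sub_self]
  let G : V.sections T' →ₐ[𝕜] V.sections T' := (g.app T' (hTW.trans hW)).toAlgHom
  have h1 : G (s' - algebraMap 𝕜 _ d - r) ∈ V.split.J 1 T' := g.app_mem_J (hTW.trans hW) hnil
  have h2 := V.pr_of_mem_J h1 ⟨y, hyT⟩ Nat.zero_lt_one
  rw [pr_zero_eq_zero_iff, map_sub, map_sub, AlgHom.commutes] at h2
  have h3 : (G s').1 ⟨y, hyT⟩ = (g.app W hW s : V.sections W).1 y :=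
    congrArg (fun a : V.sections T' => a.1 ⟨y, hyT⟩) (g.app_res hW hTW s)
  have h4 : ExteriorAlgebra.algebraMapInv ((G s').1 ⟨y, hyT⟩ - algebraMap 𝕜 _ d -
    (G r).1 ⟨y, hyT⟩) = 0 := h2
  rw [h3, map_sub, map_sub, ExteriorAlgebra.algebraMap_leftInverse, ← hd, sub_self, zero_sub,
    neg_eq_zero] at h4
  have h6 := congrArg G hrt
  rw [map_mul, map_one] at h6
  have h7 : (G r).1 ⟨y, hyT⟩ * (G t).1 ⟨y, hyT⟩ = 1 :=
    congrArg (fun a : V.sections T' => a.1 ⟨y, hyT⟩) h6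
  have h8 := congrArg ExteriorAlgebra.algebraMapInv h7
  rw [map_mul, map_one, h4, zero_mul] at h8
  exact zero_ne_one h8

end Functions

section LinPart

variable {V : VecBundle 𝕜 n m q M} (e : Trivialization (Std 𝕜 q) (π (Std 𝕜 q) V.fiber))
  [MemTrivializationAtlas e] {U : Opens M} (hU : ∀ y ∈ U, y ∈ e.baseSet)
  (g : SuperSheaf.IsoOn U V.split V.split)

/-- The action of an automorphism of `S(M, V)` on the fibre of `J / J ^ 2 = V^∨` at `y`, in the
coordinates of a trivialization of `V`; zero outside `U`. -/
def linPart (y : M) : Module.Dual 𝕜 (Std 𝕜 q) →ₗ[𝕜] Module.Dual 𝕜 (Std 𝕜 q) where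
  toFun ξ := linComp (coords e
    (g.app U le_rfl (constSec e hU (ExteriorAlgebra.ι 𝕜 ξ)) : V.sections U).1 y)
  map_add' ξ ξ' := by
    by_cases hy : y ∈ U
    · have h1 : (g.app U le_rfl (constSec e hU (ExteriorAlgebra.ι 𝕜 (ξ + ξ'))) : V.sections U) =
          (g.app U le_rfl (constSec e hU (ExteriorAlgebra.ι 𝕜 ξ)) : V.sections U) +
          (g.app U le_rfl (constSec e hU (ExteriorAlgebra.ι 𝕜 ξ')) : V.sections U) := by
        rw [map_add, map_add]
        exact map_add (g.app U le_rfl) _ _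
      simp only [coords, dif_pos hy]
      rw [h1, ← map_add, ← map_add]
      rfl
    · simp only [coords, dif_neg hy, map_zero, add_zero]
  map_smul' c ξ := by
    by_cases hy : y ∈ U
    · have h1 : (g.app U le_rfl (constSec e hU (ExteriorAlgebra.ι 𝕜 (c • ξ))) : V.sections U) =
          c • (g.app U le_rfl (constSec e hU (ExteriorAlgebra.ι 𝕜 ξ)) : V.sections U) := by
        rw [map_smul, map_smul]
        exact map_smul (g.app U le_rfl) _ _
      simp only [coords, dif_pos hy]
      rw [h1, RingHom.id_apply, ← map_smul, ← map_smul]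
      rfl
    · simp only [coords, dif_neg hy, map_zero, smul_zero]

theorem linPart_apply (ξ : Module.Dual 𝕜 (Std 𝕜 q)) {W : Opens M} (hW : W ≤ U) (y : W) :
    linPart e hU g y ξ = linComp (V.coordE e y ((g.app W hW
      (constSec e (fun y hy => hU y (hW hy)) (ExteriorAlgebra.ι 𝕜 ξ)) : V.sections W).1 y)) := by
  change linComp (coords e _ y.1) = _
  rw [coords_apply e _ ⟨y.1, hW y.2⟩]
  have h := g.app_res le_rfl hW (constSec e hU (ExteriorAlgebra.ι 𝕜 ξ))
  have h2 : (g.app W hW (constSec e (fun y hy => hU y (hW hy)) (ExteriorAlgebra.ι 𝕜 ξ)) :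
    V.sections W).1 y = (g.app U le_rfl (constSec e hU (ExteriorAlgebra.ι 𝕜 ξ)) :
      V.sections U).1 ⟨y.1, hW y.2⟩ := congrArg (fun t : V.sections W => t.1 y) h
  rw [h2]

/-- An automorphism acts on `J / J ^ 2` through its linear part. -/
theorem linComp_app {W : Opens M} (hW : W ≤ U) {s : V.sections W}
    (hs : ∀ y, pr 0 (s.1 y) = 0) (y : W) :
    linComp (V.coordE e y ((g.app W hW s : V.sections W).1 y)) =
      linPart e hU g y (linComp (V.coordE e y (s.1 y))) := by
  have hWe : ∀ y ∈ W, y ∈ e.baseSet := fun y hy => hU y (hW hy)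
  let B := Module.finBasis 𝕜 (Module.Dual 𝕜 (Std 𝕜 q))
  let κ : ∀ i, V.sections W := fun i => constSec e hWe (ExteriorAlgebra.ι 𝕜 (B i))
  let c : ∀ i, M → 𝕜 := fun i y => B.coord i (linComp (coords e s.1 y))
  have hc : ∀ i, ∀ x ∈ W, ContMDiffAt 𝓘(𝕜, Std 𝕜 m) 𝓘(𝕜, 𝕜) n (c i) x := fun i x hx =>
    smoothAt_coords e s.2 hx (hWe x hx) (B.coord i ∘ₗ linComp)
  let f : ∀ i, V.sections W := fun i => V.fnSec (c i) (hc i)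
  have hsum : ∀ x : W, ∑ i, algebraMap 𝕜 _ (c i x) * V.cocoordE e x (ExteriorAlgebra.ι 𝕜 (B i)) =
      V.cocoordE e x (ExteriorAlgebra.ι 𝕜 (linComp (V.coordE e x (s.1 x)))) := by
    intro x
    conv_rhs => rw [← B.sum_repr (linComp (V.coordE e x (s.1 x))), map_sum, map_sum]
    refine Finset.sum_congr rfl fun i _ => ?_
    rw [map_smul, map_smul, ← Algebra.smul_def]
    change B.coord i (linComp (coords e s.1 x)) • _ = _
    rw [coords_apply]
    rfl
  have hval : ∀ (a : Fin (Module.finrank 𝕜 (Module.Dual 𝕜 (Std 𝕜 q))) → V.sections W)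
      (x : W), (∑ i, a i : V.sections W).1 x = ∑ i, (a i).1 x := by
    intro a x
    rw [AddSubmonoidClass.coe_finsetSum, Finset.sum_apply]
  -- modulo `J ^ 2`, the section `s` is a combination of the constant sections `κ i`; the
  -- automorphism preserves `J ^ 2` and the values of the coefficients `f i`
  have hJ : (s - ∑ i, f i * κ i : V.sections W) ∈ V.split.J 2 W := by
    refine V.mem_J_of_pr fun l hl x => ?_
    have h1 : (s - ∑ i, f i * κ i : V.sections W).1 x =
        s.1 x - V.cocoordE e x (ExteriorAlgebra.ι 𝕜 (linComp (V.coordE e x (s.1 x)))) := by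
      rw [← hsum x]
      change s.1 x - (∑ i, f i * κ i : V.sections W).1 x = _
      rw [hval]
      rfl
    rw [h1, map_sub, cocoordE, pr_map, ι_linComp]
    have h2 : l = 0 ∨ l = 1 := by omega
    rcases h2 with rfl | rfl
    · rw [hs x, pr_of_mem_ne (pr_mem 1 _) one_ne_zero, map_zero, sub_zero]
    · rw [pr_of_mem (pr_mem 1 _), coordE, pr_map]
      exact sub_eq_zero.2 (V.cocoordE_coordE e (hWe x x.2) _).symm
  let G : V.sections W →ₐ[𝕜] V.sections W := (g.app W hW).toAlgHom
  have h1 : pr 1 ((G (s - ∑ i, f i * κ i)).1 y) = 0 :=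
    V.pr_of_mem_J (g.app_mem_J hW hJ) y Nat.one_lt_two
  have h2 : (G (s - ∑ i, f i * κ i)).1 y = (g.app W hW s : V.sections W).1 y -
      ∑ i, (g.app W hW (f i) : V.sections W).1 y * (g.app W hW (κ i) : V.sections W).1 y := by
    rw [map_sub, map_sum]
    simp only [map_mul]
    exact congrArg (fun t => (g.app W hW s : V.sections W).1 y - t)
      (hval (fun i => G (f i) * G (κ i)) y)
  rw [h2] at h1
  have h3 := congrArg (V.coordE e y) h1
  rw [map_zero, coordE, ← pr_map, ← coordE] at h3
  have h4 := linComp_eq_zero_of_pr h3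
  rw [map_sub, map_sub, sub_eq_zero] at h4
  rw [h4, map_sum, map_sum]
  conv_rhs => rw [← B.sum_repr (linComp (V.coordE e y (s.1 y))), map_sum]
  refine Finset.sum_congr rfl fun i _ => ?_
  have hκ : pr 0 (V.coordE e y ((g.app W hW (κ i) : V.sections W).1 y)) = 0 := by
    rw [pr_zero_eq_zero_iff, coordE, algebraMapInv_map, algebraMapInv_app g hW]
    change ExteriorAlgebra.algebraMapInv (V.cocoordE e y (ExteriorAlgebra.ι 𝕜 (B i))) = 0
    rw [cocoordE, algebraMapInv_map]
    exact algebraMapInv_of_mem one_ne_zero (ι_mem _)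
  rw [map_mul, linComp_mul_of_pr hκ, map_smul, linPart_apply e hU g (B i) hW y]
  congr 1
  rw [coordE, algebraMapInv_map, algebraMapInv_app g hW]
  change ExteriorAlgebra.algebraMapInv (algebraMap 𝕜 _ (c i y)) = _
  rw [ExteriorAlgebra.algebraMap_leftInverse]
  change B.coord i (linComp (coords e s.1 y)) = _
  rw [coords_apply]
  rfl

end LinPart

end VecBundle

/-! ### Every supermanifold has a graded atlas -/

/-- An automorphism acts trivially on the associated graded algebra if it does so in degrees `0`
and `1`. -/
theorem SuperSheaf.IsoOn.actsTriviallyOnGr_of_low {𝕜 : Type} [Field 𝕜] {M : Type u}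
    [TopologicalSpace M] {X : SuperSheaf 𝕜 M} {U : Opens M} (g : SuperSheaf.IsoOn U X X)
    (h0 : ∀ (W : Opens M) (hW : W ≤ U) (s : X.Sec W), g.app W hW s - s ∈ X.J 1 W)
    (h1 : ∀ (W : Opens M) (hW : W ≤ U) (s : X.Sec W), s ∈ X.J 1 W → g.app W hW s - s ∈ X.J 2 W) :
    g.ActsTriviallyOnGr := by
  have key : ∀ (k : ℕ) (W : Opens M) (hW : W ≤ U), ∀ s ∈ X.oddIdeal W ^ k,
      g.app W hW s - s ∈ X.J (k + 1) W := by
    intro k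
    induction k with
    | zero => exact fun W hW s _ => h0 W hW s
    | succ k ih =>
      intro W hW s hs
      rw [Submodule.pow_succ] at hs
      refine Submodule.smul_induction_on (p := fun s => g.app W hW s - s ∈ X.J (k + 1 + 1) W) hs
        ?_ ?_
      · intro a ha b hb
        have hb1 : b ∈ X.J 1 W :=
          X.mem_J_of_mem_oddIdeal_pow (by rw [Submodule.pow_one]; exact hb)
        have e : g.app W hW (a • b) - a • b =
            g.app W hW a * (g.app W hW b - b) + (g.app W hW a - a) * b := by
          rw [smul_eq_mul, map_mul]; noncomm_ring
        rw [e]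
        exact add_mem (X.mul_mem_J (k := k) (l := 2)
          (g.app_mem_J hW (X.mem_J_of_mem_oddIdeal_pow ha)) (h1 W hW b hb1)) (X.mul_mem_J (ih W hW a ha) hb1)
      · intro a b ha hb
        rw [map_add, add_sub_add_comm]
        exact add_mem ha hb
  intro k W hW s hs
  refine X.J_of_locally fun x hx => ?_
  obtain ⟨T, hT, hxT, h⟩ := hs x hx
  refine ⟨T, hT, hxT, ?_⟩
  rw [map_sub, ← g.app_res hW hT]
  exact key k T (hT.trans hW) _ h

namespace VecBundle

variable {𝕜 : Type} [RCLike 𝕜] {n : WithTop ℕ∞} {m q : ℕ} {M : Type u} [TopologicalSpace M]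
  [ChartedSpace (Std 𝕜 m) M]

section TrivIso

variable {V V' : VecBundle 𝕜 n m q M} (e : Trivialization (Std 𝕜 q) (π (Std 𝕜 q) V.fiber))
  [MemTrivializationAtlas e] (e' : Trivialization (Std 𝕜 q) (π (Std 𝕜 q) V'.fiber))
  [MemTrivializationAtlas e']

/-- Sections of `⋀ V^∨` as sections of `⋀ V'^∨` with the same coordinates. -/
def transfer {W : Opens M} (hW : ∀ y ∈ W, y ∈ e.baseSet ∧ y ∈ e'.baseSet) :
    V.sections W →ₐ[𝕜] V'.sections W where
  toFun s := ⟨fun y => V'.cocoordE e' y (V.coordE e y (s.1 y)), by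
    have h := cocoordE_mem_sections e' (fun y hy => (hW y hy).2)
      (fun x hx => smoothAt_coords e s.2 hx (hW x hx).1)
    simpa only [coords_apply] using h⟩
  map_one' := Subtype.ext (funext fun y =>
    (congrArg (V'.cocoordE e' y) (map_one (V.coordE e y))).trans (map_one _))
  map_mul' a b := Subtype.ext (funext fun y =>
    (congrArg (V'.cocoordE e' y) (map_mul (V.coordE e y) _ _)).trans (map_mul _ _ _))
  map_zero' := Subtype.ext (funext fun y =>
    (congrArg (V'.cocoordE e' y) (map_zero (V.coordE e y))).trans (map_zero _))
  map_add' a b := Subtype.ext (funext fun y =>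
    (congrArg (V'.cocoordE e' y) (map_add (V.coordE e y) _ _)).trans (map_add _ _ _))
  commutes' r := Subtype.ext (funext fun y =>
    (congrArg (V'.cocoordE e' y) (AlgHom.commutes (V.coordE e y) r)).trans (AlgHom.commutes _ r))

theorem transfer_transfer {W : Opens M} (hW : ∀ y ∈ W, y ∈ e.baseSet ∧ y ∈ e'.baseSet)
    (s : V.sections W) : transfer e' e (fun y hy => (hW y hy).symm) (transfer e e' hW s) = s := by
  refine Subtype.ext (funext fun y => ?_)
  change V.cocoordE e y (V'.coordE e' y (V'.cocoordE e' y (V.coordE e y (s.1 y)))) = s.1 y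
  rw [coordE_cocoordE _ _ (hW y y.2).2, cocoordE_coordE _ _ (hW y y.2).1]

/-- Trivializations of `V` and `V'` over `U` induce an isomorphism of `S(M, V)` and `S(M, V')`
over `U`. -/
def trivIso {U : Opens M} (hU : ∀ y ∈ U, y ∈ e.baseSet ∧ y ∈ e'.baseSet) :
    SuperSheaf.IsoOn U V.split V'.split where
  app _ hW := AlgEquiv.ofAlgHom (transfer e e' fun y hy => hU y (hW hy))
    (transfer e' e fun y hy => (hU y (hW hy)).symm)
    (AlgHom.ext fun s => transfer_transfer e' e (fun y hy => (hU y (hW hy)).symm) s)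
    (AlgHom.ext fun s => transfer_transfer e e' (fun y hy => hU y (hW hy)) s)
  app_res _ _ _ := rfl
  app_even _ _ hs y := map_mem_evenOdd _ (map_mem_evenOdd _ (hs y))
  app_odd _ _ hs y := map_mem_evenOdd _ (map_mem_evenOdd _ (hs y))

end TrivIso

section Core

/-- The endomorphism of `𝕜^q` whose transpose is `A`. -/
def transposeCLM (A : Module.Dual 𝕜 (Std 𝕜 q) →ₗ[𝕜] Module.Dual 𝕜 (Std 𝕜 q)) :
    Std 𝕜 q →L[𝕜] Std 𝕜 q :=
  ∑ k, ∑ l, A ((Module.finBasis 𝕜 (Std 𝕜 q)).coord k) (Module.finBasis 𝕜 (Std 𝕜 q) l) •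
    (LinearMap.toContinuousLinearMap ((Module.finBasis 𝕜 (Std 𝕜 q)).coord l)).smulRight
      (Module.finBasis 𝕜 (Std 𝕜 q) k)

theorem apply_transposeCLM (A : Module.Dual 𝕜 (Std 𝕜 q) →ₗ[𝕜] Module.Dual 𝕜 (Std 𝕜 q))
    (ξ : Module.Dual 𝕜 (Std 𝕜 q)) (v : Std 𝕜 q) : ξ (transposeCLM A v) = A ξ v := by
  let B := Module.finBasis 𝕜 (Std 𝕜 q)
  have hξ : ξ = ∑ k, ξ (B k) • B.coord k := (B.sum_dual_apply_smul_coord ξ).symm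
  have hv : v = ∑ l, B.coord l v • B l := (B.sum_repr v).symm
  have h1 : A ξ v = ∑ k, ∑ l, ξ (B k) * (B.coord l v * A (B.coord k) (B l)) := by
    conv_lhs => rw [hξ, hv]
    simp only [map_sum, map_smul, LinearMap.sum_apply, LinearMap.smul_apply, smul_eq_mul,
      Finset.mul_sum]
    rw [Finset.sum_comm]
    exact Finset.sum_congr rfl fun k _ => Finset.sum_congr rfl fun l _ => by ring
  rw [h1, transposeCLM]
  simp only [sum_apply, smul_apply,
    ContinuousLinearMap.smulRight_apply, map_sum, map_smul, smul_eq_mul]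
  refine Finset.sum_congr rfl fun k _ => Finset.sum_congr rfl fun l _ => ?_
  change A (B.coord k) (B l) * (B.coord l v * ξ (B k)) = _
  ring

theorem eq_of_forall_dual {v w : Std 𝕜 q} (h : ∀ ξ : Module.Dual 𝕜 (Std 𝕜 q), ξ v = ξ w) : v = w :=
  (Module.finBasis 𝕜 (Std 𝕜 q)).ext_elem fun i => h ((Module.finBasis 𝕜 (Std 𝕜 q)).coord i)

/-- A `C^n` cocycle of automorphisms of `(𝕜^q)^∨` defines a vector bundle `V` such that `V^∨` has
this cocycle as coordinate changes. -/
theorem exists_of_cocycle (U : M → Opens M) (hU : ∀ x, x ∈ U x)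
    (A : M → M → M → Module.Dual 𝕜 (Std 𝕜 q) →ₗ[𝕜] Module.Dual 𝕜 (Std 𝕜 q))
    (hA : ∀ i j ξ v, ∀ y ∈ U i ⊓ U j,
      ContMDiffAt 𝓘(𝕜, Std 𝕜 m) 𝓘(𝕜, 𝕜) n (fun y => A i j y ξ v) y)
    (hself : ∀ i, ∀ y ∈ U i, ∀ ξ, A i i y ξ = ξ)
    (hcomp : ∀ i j k, ∀ y ∈ U i ⊓ U j ⊓ U k, ∀ ξ, A i j y (A j k y ξ) = A i k y ξ) :
    ∃ (V : VecBundle 𝕜 n m q M) (e : M → Trivialization (Std 𝕜 q) (π (Std 𝕜 q) V.fiber))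
      (_ : ∀ i, MemTrivializationAtlas (e i)), (∀ i, ∀ y ∈ U i, y ∈ (e i).baseSet) ∧
      ∀ i j, ∀ y ∈ U i ⊓ U j, ∀ a : V.Ext y,
        V.coordE (e i) y a = ExteriorAlgebra.map (A i j y) (V.coordE (e j) y a) := by
  have hsmooth : ∀ i j, ContMDiffOn 𝓘(𝕜, Std 𝕜 m) 𝓘(𝕜, Std 𝕜 q →L[𝕜] Std 𝕜 q) n
      (fun y => transposeCLM (A i j y)) ((U i : Set M) ∩ U j) := by
    intro i j y hy
    refine ContMDiffAt.contMDiffWithinAt ?_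
    unfold transposeCLM
    exact ContMDiffAt.sum fun k _ => ContMDiffAt.sum fun l _ =>
      (hA i j _ _ y hy).smul contMDiffAt_const
  let Z : VectorBundleCore 𝕜 M (Std 𝕜 q) M :=
    { baseSet := fun i => U i
      isOpen_baseSet := fun i => (U i).isOpen
      indexAt := id
      mem_baseSet_at := hU
      coordChange := fun i j y => transposeCLM (A i j y)
      coordChange_self := fun i y hy v => eq_of_forall_dual fun ξ => by
        rw [apply_transposeCLM, hself i y hy]
      continuousOn_coordChange := fun i j => (hsmooth i j).continuousOn
      coordChange_comp := fun i j k y hy v => eq_of_forall_dual fun ξ => by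
        rw [apply_transposeCLM, apply_transposeCLM, apply_transposeCLM, hcomp i j k y hy] }
  have : Z.IsContMDiff 𝓘(𝕜, Std 𝕜 m) n := ⟨hsmooth⟩
  let V : VecBundle 𝕜 n m q M := { fiber := Z.Fiber }
  refine ⟨V, fun i => Z.localTriv i, fun i => ⟨i, rfl⟩, fun i y hy => hy, fun i j y hy a => ?_⟩
  have h1 : MemTrivializationAtlas (F := Std 𝕜 q) (E := V.fiber) (Z.localTriv i) :=
    ⟨i, rfl⟩
  have h2 : MemTrivializationAtlas (F := Std 𝕜 q) (E := V.fiber) (Z.localTriv j) :=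
    ⟨j, rfl⟩
  refine (V.coordE_change (Z.localTriv j) (Z.localTriv i) hy.2 hy.1 a).trans ?_
  congr 2
  ext ξ v
  refine Eq.trans ?_ (apply_transposeCLM (A i j y) ξ v)
  exact congrArg ξ (Z.localTriv_coordChange_eq i j hy v)

end Core

/-- The trivial bundle has a global trivialization. -/
theorem exists_trivialization : ∃ (e : Trivialization (Std 𝕜 q)
    (π (Std 𝕜 q) (VecBundle.trivial n q M : VecBundle 𝕜 n m q M).fiber))
    (_ : MemTrivializationAtlas e), ∀ y, y ∈ e.baseSet :=
  ⟨Bundle.Trivial.trivialization M (Std 𝕜 q), ⟨rfl⟩, fun y => Set.mem_univ y⟩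

end VecBundle

variable {𝕜 : Type} [RCLike 𝕜] {n : WithTop ℕ∞} {m q : ℕ} {M : Type u} [TopologicalSpace M]
  [ChartedSpace (Std 𝕜 m) M]

open VecBundle in
/-- The linear parts of the transition automorphisms of a supermanifold form a cocycle of a vector
bundle `V`, and composing the local isomorphisms with the trivializations of `V` makes their
transition automorphisms act trivially on the associated graded algebra. -/
theorem SuperSheaf.IsSupermanifold.nonempty_gradedAtlas {S : SuperSheaf 𝕜 M}
    (hS : S.IsSupermanifold n m q) : Nonempty (GradedAtlas n m q S) := by
  let X : VecBundle 𝕜 n m q M := VecBundle.trivial n q M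
  obtain ⟨e, he, hbase⟩ : ∃ (e : Trivialization (Std 𝕜 q) (π (Std 𝕜 q) X.fiber))
    (_ : MemTrivializationAtlas e), ∀ y, y ∈ e.baseSet := exists_trivialization
  choose U hxU hφ using hS
  let φ : ∀ i, SuperSheaf.IsoOn (U i) S X.split := fun i => (hφ i).some
  let g : ∀ i j, SuperSheaf.IsoOn (U i ⊓ U j) X.split X.split := fun i j =>
    (φ i).trans (φ j) inf_le_left inf_le_right
  let A := fun i j y => linPart e (fun y _ => hbase y) (g i j) y
  have hval : ∀ (i j : M) (W : Opens M) (hW : W ≤ U i ⊓ U j) (s : X.sections W) (y : W),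
      ExteriorAlgebra.algebraMapInv (((g i j).app W hW s : X.sections W).1 y) =
        ExteriorAlgebra.algebraMapInv (s.1 y) := fun i j W hW s y => algebraMapInv_app _ hW s y
  obtain ⟨V, e', he', hbase', hA⟩ := exists_of_cocycle U hxU A
    (fun i j ξ v y hy => smoothAt_coords e (((g i j).app _ le_rfl
      (constSec e (fun y _ => hbase y) (ExteriorAlgebra.ι 𝕜 ξ)) : X.sections _)).2 hy (hbase y)
      ((LinearMap.applyₗ v : Module.Dual 𝕜 (Std 𝕜 q) →ₗ[𝕜] 𝕜) ∘ₗ linComp))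
    (fun i y hy ξ => by
      change linPart e (fun y _ => hbase y) (g i i) y ξ = ξ
      rw [linPart_apply e (fun y _ => hbase y) (g i i) ξ le_rfl ⟨y, hy, hy⟩]
      have h : (g i i).app (U i ⊓ U i) le_rfl
          (constSec e (fun y _ => hbase y) (ExteriorAlgebra.ι 𝕜 ξ) : X.sections _) =
          (constSec e (fun y _ => hbase y) (ExteriorAlgebra.ι 𝕜 ξ) : X.sections _) :=
        AlgEquiv.apply_symm_apply ((φ i).app (U i ⊓ U i) inf_le_left) _
      rw [h]
      change linComp (X.coordE e y (X.cocoordE e y (ExteriorAlgebra.ι 𝕜 ξ))) = ξ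
      rw [X.coordE_cocoordE e (hbase y), linComp_ι])
    (fun i j k y hy ξ => by
      let W := U i ⊓ U j ⊓ U k
      have hij : W ≤ U i ⊓ U j := inf_le_left
      have hjk : W ≤ U j ⊓ U k := le_inf (inf_le_left.trans inf_le_right) inf_le_right
      have hik : W ≤ U i ⊓ U k := le_inf (inf_le_left.trans inf_le_left) inf_le_right
      let κ : X.sections W := constSec e (fun y _ => hbase y) (ExteriorAlgebra.ι 𝕜 ξ)
      let s : X.sections W := (g j k).app W hjk κ
      have h1 : A j k y ξ = linComp (X.coordE e y (s.1 ⟨y, hy⟩)) :=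
        linPart_apply e (fun y _ => hbase y) (g j k) ξ hjk ⟨y, hy⟩
      have h2 : A i k y ξ = linComp (X.coordE e y
          (((g i k).app W hik κ : X.sections W).1 ⟨y, hy⟩)) :=
        linPart_apply e (fun y _ => hbase y) (g i k) ξ hik ⟨y, hy⟩
      have h3 : (g i j).app W hij s = (g i k).app W hik κ :=
        congrArg ((φ i).app W _) (AlgEquiv.symm_apply_apply ((φ j).app W _) _)
      rw [h1, h2, ← h3]
      refine (linComp_app e (fun y _ => hbase y) (g i j) hij (fun x => ?_) ⟨y, hy⟩).symm
      rw [pr_zero_eq_zero_iff, hval j k]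
      change ExteriorAlgebra.algebraMapInv (X.cocoordE e x (ExteriorAlgebra.ι 𝕜 ξ)) = 0
      rw [cocoordE, algebraMapInv_map]
      exact algebraMapInv_of_mem one_ne_zero (ι_mem _))
  let ψ : ∀ i, SuperSheaf.IsoOn (U i) X.split V.split := fun i =>
    trivIso e (e' i) fun y hy => ⟨hbase y, hbase' i y hy⟩
  refine ⟨⟨V, M, U, ?_, fun i => (ψ i).comp (φ i), fun i j T h h' => ?_⟩⟩
  · exact eq_top_iff.2 fun x _ => Opens.mem_iSup.2 ⟨x, hxU x⟩
  -- the transition automorphism is the conjugate of `g i j` by the changes of trivialization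
  let τ : SuperSheaf.IsoOn T V.split V.split := ((ψ i).comp (φ i)).trans ((ψ j).comp (φ j)) h h'
  have happ : ∀ (W : Opens M) (hW : W ≤ T) (s : V.sections W) (y : W),
      (τ.app W hW s : V.sections W).1 y =
        V.cocoordE (e' i) y (X.coordE e y (((g i j).app W (le_inf (hW.trans h) (hW.trans h'))
          (transfer (e' j) e (fun y hy => ⟨hbase' j y (h' (hW hy)), hbase y⟩) s) :
            X.sections W).1 y)) := fun _ _ _ _ => rfl
  have hinv : ∀ (W : Opens M) (hW : W ≤ T) (s : V.sections W) (y : W),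
      ExteriorAlgebra.algebraMapInv ((τ.app W hW s : V.sections W).1 y) =
        ExteriorAlgebra.algebraMapInv (s.1 y) := by
    intro W hW s y
    rw [happ, cocoordE, algebraMapInv_map, coordE, algebraMapInv_map, hval i j]
    change ExteriorAlgebra.algebraMapInv (X.cocoordE e y (V.coordE (e' j) y (s.1 y))) = _
    rw [cocoordE, algebraMapInv_map, coordE, algebraMapInv_map]
  refine SuperSheaf.IsoOn.actsTriviallyOnGr_of_low τ (fun W hW (s : V.sections W) => ?_)
    (fun W hW (s : V.sections W) hs => ?_)
  · let u : V.sections W := τ.app W hW s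
    refine V.mem_J_of_pr (s := u - s) fun l hl y => ?_
    obtain rfl : l = 0 := by omega
    rw [pr_zero_eq_zero_iff]
    change ExteriorAlgebra.algebraMapInv ((τ.app W hW s : V.sections W).1 y - s.1 y) = 0
    rw [map_sub, hinv, sub_self]
  · let u : V.sections W := τ.app W hW s
    refine V.mem_J_of_pr (s := u - s) fun l hl y => ?_
    have hl' : l = 0 ∨ l = 1 := by omega
    change pr l ((τ.app W hW s : V.sections W).1 y - s.1 y) = 0
    rcases hl' with rfl | rfl
    · rw [pr_zero_eq_zero_iff, map_sub, hinv, sub_self]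
    have hyi : y.1 ∈ U i := h (hW y.2)
    have hyj : y.1 ∈ U j := h' (hW y.2)
    let t : X.sections W := transfer (e' j) e (fun y hy => ⟨hbase' j y (h' (hW hy)), hbase y⟩) s
    have ht : X.coordE e y (t.1 y) = V.coordE (e' j) y (s.1 y) := X.coordE_cocoordE e (hbase y) _
    have ht0 : ∀ x, pr 0 (t.1 x) = 0 := by
      intro x
      have h0 := V.pr_of_mem_J hs x Nat.zero_lt_one
      rw [pr_zero_eq_zero_iff] at h0 ⊢
      change ExteriorAlgebra.algebraMapInv (X.cocoordE e x (V.coordE (e' j) x (s.1 x))) = 0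
      rw [cocoordE, algebraMapInv_map, coordE, algebraMapInv_map, h0]
    have h1 := linComp_app e (fun y _ => hbase y) (g i j) (le_inf (hW.trans h) (hW.trans h')) ht0 y
    have h2 : linPart e (fun y _ => hbase y) (g i j) y (linComp (X.coordE e y (t.1 y))) =
        linComp (V.coordE (e' i) y (s.1 y)) := by
      rw [hA i j y ⟨hyi, hyj⟩, linComp_map, ht]
    rw [map_sub, happ, cocoordE, pr_map, ← ι_linComp, h1.trans h2, ι_linComp, coordE, ← pr_map,
      sub_eq_zero]
    exact congrArg (pr 1) (V.cocoordE_coordE (e' i) (hbase' i y hyi) (s.1 y))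

end ExteriorBundle

namespace SuperSheaf

variable {𝕜 : Type} [RCLike 𝕜] {n : WithTop ℕ∞} {m q : ℕ} {M : Type u} [TopologicalSpace M]
  [ChartedSpace (Std 𝕜 m) M] {S : SuperSheaf 𝕜 M}

/-! ### Splittings and Euler derivations -/

theorem IsSupermanifold.exists_J_eq_bot (hS : S.IsSupermanifold n m q) :
    ∃ N : ℕ, (∀ U, S.J (N + 1) U = ⊥) ∧
      ∀ (V : VecBundle 𝕜 n m q M) (U), V.split.J (N + 1) U = ⊥ := by
  obtain ⟨N, hN⟩ := VecBundle.exists_J_eq_bot (𝕜 := 𝕜) (n := n) (m := m) (q := q) (M := M)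
  refine ⟨N, fun U => eq_bot_iff.2 fun s hs => (Submodule.mem_bot _).2 ?_, hN⟩
  refine S.sec_ext fun x hx => ?_
  obtain ⟨U', hxU', ⟨g⟩⟩ := hS x
  refine ⟨U ⊓ U', inf_le_left, ⟨hx, hxU'⟩, ?_⟩
  have h := g.app_mem_J inf_le_right (S.res_mem_J (inf_le_left : U ⊓ U' ≤ U) hs)
  rw [hN] at h
  rw [map_zero]
  exact (map_eq_zero_iff _ (g.app (U ⊓ U') inf_le_right).injective).1 h

/-- A supermanifold is split if and only if it has an Euler derivation. -/
theorem IsSupermanifold.isSplit_iff (hS : S.IsSupermanifold n m q) :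
    S.IsSplit n m q ↔ Nonempty (Euler S) := by
  constructor
  · rintro ⟨V, ⟨g⟩⟩
    exact Euler.nonempty_pull g.symm.toLocIso isLocalHomeomorph_id V.splitEuler
  · rintro ⟨E⟩
    obtain ⟨A⟩ := hS.nonempty_gradedAtlas
    obtain ⟨N, hSN, hVN⟩ := hS.exists_J_eq_bot
    exact ⟨A.V, Euler.isIso_of_cover E A.V.splitEuler hSN (hVN A.V) A.cover A.iso A.compat⟩

/-- `S^(i)` is split if and only if it has an Euler derivation: the quotients of a graded atlas of
`S` identify `S^(i)` locally with the truncation of the same `S(M, V)`. -/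
theorem IsSupermanifold.isSplitTrunc_iff (hS : S.IsSupermanifold n m q) (i : ℕ) :
    S.IsSplitTrunc n m q i ↔ Nonempty (Euler (S.trunc i)) := by
  constructor
  · rintro ⟨V, ⟨g⟩⟩
    obtain ⟨F⟩ := V.splitEuler.nonempty_quot (i + 1)
    exact Euler.nonempty_pull g.symm.toLocIso isLocalHomeomorph_id F
  · rintro ⟨E⟩
    obtain ⟨A⟩ := hS.nonempty_gradedAtlas
    obtain ⟨F⟩ := A.V.splitEuler.nonempty_quot (i + 1)
    exact ⟨A.V, Euler.isIso_of_cover E F (S.quot_J_eq_bot (i + 1))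
      (A.V.split.quot_J_eq_bot (i + 1)) A.cover (fun j => (A.iso j).quot (i + 1))
      fun j k T hj hk => (A.compat j k T hj hk).quot_trans hj hk (i + 1)⟩

/-! ### The class `ω₂` of a projected supermanifold -/

section Projected

variable {V : VecBundle 𝕜 n m q M} {U : Opens M} (g : IsoOn U S V.split) (σ : Hom (S.trunc 0) S)

/-- The endomorphism `g ∘ σ ∘ (O → O / J) ∘ g⁻¹` of the sheaf of sections of `⋀ V^∨` over `U`,
for a local isomorphism `g` of `S` with `S(M, V)` and a morphism `σ : O / J → O`. -/
def projLift {W : Opens M} (hW : W ≤ U) : V.sections W →ₐ[𝕜] V.sections W :=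
  ((g.app W hW).toAlgHom.comp ((σ.app W).comp ((S.quotHom 1).app W))).comp
    (g.app W hW).symm.toAlgHom

theorem projLift_res {W T : Opens M} (hW : W ≤ U) (h : T ≤ W) (s : V.sections W) :
    projLift g σ (h.trans hW) (V.split.res h s) = V.split.res h (projLift g σ hW s) := by
  change g.app T _ (σ.app T ((S.quotHom 1).app T ((g.app T _).symm (V.split.res h s)))) =
    V.split.res h (g.app W hW (σ.app W ((S.quotHom 1).app W ((g.app W hW).symm s))))
  have h1 : (g.app T (h.trans hW)).symm (V.split.res h s) = S.res h ((g.app W hW).symm s) :=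
    g.symm.app_res hW h s
  have h2 : σ.app T ((S.quotHom 1).app T (S.res h ((g.app W hW).symm s))) =
      S.res h (σ.app W ((S.quotHom 1).app W ((g.app W hW).symm s))) :=
    (congrArg (σ.app T) ((S.quotHom 1).app_res h _)).trans (σ.app_res h _)
  rw [h1, h2, g.app_res hW h]

variable {σ} (hσ : ∀ (U : Opens M) (s : (S.trunc 0).Sec U), (S.quotHom 1).app U (σ.app U s) = s)

include hσ in
theorem projLift_sub_mem_J {W : Opens M} (hW : W ≤ U) (f : V.deg 0 W) :
    (projLift g σ hW f.1 - f.1 : V.sections W) ∈ V.split.J 2 W := by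
  obtain ⟨r, hr⟩ : ∃ r : V.split.Sec W, r = f.1 := ⟨_, rfl⟩
  have he : r ∈ V.split.even W := hr ▸ V.deg_zero_le_even f
  rw [← hr]
  have h1 : σ.app W ((S.quotHom 1).app W ((g.app W hW).symm r)) - (g.app W hW).symm r ∈
      S.J 1 W := (S.toQuot_eq_iff 1 _ _).1 (hσ W _)
  have h2 := g.app_mem_J hW h1
  rw [map_sub, AlgEquiv.apply_symm_apply] at h2
  refine V.split.even_mem_J_two (sub_mem (g.app_even hW (σ.app_even ((S.quotHom 1).app_even
    (g.symm_app_even hW he)))) he) h2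

include hσ in
theorem pr_projLift {W : Opens M} (hW : W ≤ U) (f : V.deg 0 W) (y : W) :
    VecBundle.pr 0 ((projLift g σ hW f.1).1 y) = f.1.1 y ∧
      VecBundle.pr 1 ((projLift g σ hW f.1).1 y) = 0 := by
  have h := projLift_sub_mem_J g hσ hW f
  have h0 : VecBundle.pr 0 ((projLift g σ hW f.1).1 y - f.1.1 y) = 0 :=
    V.pr_of_mem_J h y Nat.zero_lt_two
  have h1 : VecBundle.pr 1 ((projLift g σ hW f.1).1 y - f.1.1 y) = 0 :=
    V.pr_of_mem_J h y Nat.one_lt_two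
  rw [map_sub, VecBundle.pr_of_mem (f.2 y), sub_eq_zero] at h0
  rw [map_sub, VecBundle.pr_of_mem_ne (f.2 y) zero_ne_one, sub_zero] at h1
  exact ⟨h0, h1⟩

include hσ in
theorem pr_two_projLift_mul {W : Opens M} (hW : W ≤ U) (f f' : V.deg 0 W) (y : W) :
    VecBundle.pr 2 ((projLift g σ hW (f.1 * f'.1)).1 y) =
      f.1.1 y * VecBundle.pr 2 ((projLift g σ hW f'.1).1 y) +
        VecBundle.pr 2 ((projLift g σ hW f.1).1 y) * f'.1.1 y := by
  obtain ⟨h0, h1⟩ := pr_projLift g hσ hW f y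
  obtain ⟨h0', -⟩ := pr_projLift g hσ hW f' y
  have h : (projLift g σ hW (f.1 * f'.1)).1 y =
      (projLift g σ hW f.1).1 y * (projLift g σ hW f'.1).1 y :=
    congrArg (fun t : V.sections W => t.1 y) (map_mul (projLift g σ hW) _ _)
  rw [h]
  generalize (projLift g σ hW f.1).1 y = a at *
  generalize (projLift g σ hW f'.1).1 y = b at *
  rw [VecBundle.pr_mul, Finset.Nat.sum_antidiagonal_eq_sum_range_succ
    (fun i j => VecBundle.pr i a * VecBundle.pr j b), Finset.sum_range_succ, Finset.sum_range_succ,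
    Finset.sum_range_one, h0, h1, zero_mul, add_zero]
  exact congrArg (fun t => _ + _ * t) h0'

/-- The derivation measuring how far `g` is from identifying `σ` with the inclusion of the
functions into the sections of `⋀ V^∨`. -/
def projTerm : V.der U where
  val W f y := VecBundle.pr 2 ((projLift g σ W.2 f.1).1 y)
  property :=
    { mem := fun W f => V.pr_mem_sections 2 (projLift g σ W.2 f.1).2
      mem_two := fun _ _ _ => VecBundle.pr_mem 2 _
      res := fun W T h f y => by
        have := projLift_res g σ W.2 h f.1
        exact congrArg (fun t : V.sections T.1 => VecBundle.pr 2 (t.1 y)) this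
      add := fun W f f' y => by
        have h : (projLift g σ W.2 (f.1 + f'.1)).1 y =
          (projLift g σ W.2 f.1).1 y + (projLift g σ W.2 f'.1).1 y :=
          congrArg (fun t : V.sections W.1 => t.1 y) (map_add (projLift g σ W.2) _ _)
        exact (congrArg (VecBundle.pr 2) h).trans (map_add _ _ _)
      smul := fun W c f y => by
        have h : (projLift g σ W.2 (c • f.1)).1 y = c • (projLift g σ W.2 f.1).1 y :=
          congrArg (fun t : V.sections W.1 => t.1 y) (map_smul (projLift g σ W.2) _ _)
        exact (congrArg (VecBundle.pr 2) h).trans (map_smul _ _ _)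
      mul := fun W f f' y => pr_two_projLift_mul g hσ W.2 f f' y }

end Projected

/-- If `S` is projected, the cocycle of leading terms is the coboundary of the derivations
`projTerm`. -/
theorem IsProjected.omegaTwo_eq_one (h : S.IsProjected) (A : GradedAtlas n m q S) :
    A.omegaTwo = 1 := by
  obtain ⟨σ, hσ⟩ := h
  have hrel : PresheafOfGroups.OneCohomologyRelation (1 : PresheafOfGroups.OneCochain
      A.V.derPresheaf A.U) A.cocycle.toOneCochain
      (fun i => Multiplicative.ofAdd (projTerm (A.iso i) hσ)) := by
    intro i j T a b
    refine (mul_one _).trans ?_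
    refine congrArg (Multiplicative.ofAdd (α := A.V.der T)) (Subtype.ext ?_)
    funext W f y
    have hi : W.1 ≤ A.U i := W.2.trans (leOfHom a)
    have hj : W.1 ≤ A.U j := W.2.trans (leOfHom b)
    let τ := (A.iso i).trans (A.iso j) (leOfHom a) (leOfHom b)
    have hτ : τ.ActsTriviallyOnGr := A.compat i j T _ _
    change VecBundle.pr 2 ((projLift (A.iso i) σ hi f.1).1 y) =
      VecBundle.pr 2 ((τ.app W.1 W.2 f.1 : A.V.sections W.1).1 y) +
        VecBundle.pr 2 ((projLift (A.iso j) σ hj f.1).1 y)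
    -- the two lifts of `f` differ by the transition automorphism only
    have h1 : ∀ r : A.V.split.Sec W.1,
        projLift (A.iso i) σ hi r = τ.app W.1 W.2 (projLift (A.iso j) σ hj r) := by
      intro r
      have h2 := hτ 0 W.1 W.2 _ (A.V.split.mem_J_zero
        ((τ.app W.1 W.2).symm r))
      rw [AlgEquiv.apply_symm_apply] at h2
      have h3 := (A.iso j).symm.app_mem_J hj h2
      rw [map_sub] at h3
      have h4 : (A.iso j).symm.app W.1 hj ((τ.app W.1 W.2).symm r) =
          ((A.iso i).app W.1 hi).symm r :=
        AlgEquiv.symm_apply_apply ((A.iso j).app W.1 hj) _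
      rw [h4] at h3
      have h5 : (S.quotHom 1).app W.1 (((A.iso j).app W.1 hj).symm r) =
          (S.quotHom 1).app W.1 (((A.iso i).app W.1 hi).symm r) :=
        (S.toQuot_eq_iff 1 _ _).2 h3
      have h6 : τ.app W.1 W.2 (projLift (A.iso j) σ hj r) = (A.iso i).app W.1 hi
          (σ.app W.1 ((S.quotHom 1).app W.1 (((A.iso j).app W.1 hj).symm r))) :=
        congrArg ((A.iso i).app W.1 hi) (AlgEquiv.symm_apply_apply ((A.iso j).app W.1 hj) _)
      rw [h6, h5]
      rfl
    have hJ := projLift_sub_mem_J (A.iso j) hσ hj f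
    have h7 := A.V.pr_two_app_of_mem_J_two τ hτ W.2 _ hJ y
    have h8 := A.V.app_add_two τ W.2 f.1 (projLift (A.iso j) σ hj f.1 - f.1) y
    rw [add_sub_cancel, h7] at h8
    rw [h1 f.1]
    refine h8.trans (congrArg _ ?_)
    change VecBundle.pr 2 ((projLift (A.iso j) σ hj f.1).1 y - f.1.1 y) = _
    rw [map_sub, VecBundle.pr_of_mem_ne (f.2 y) (by decide), sub_zero]
  have hcoh : PresheafOfGroups.OneCocycle.IsCohomologous 1 A.cocycle := ⟨_, hrel⟩
  exact hcoh.class_eq.symm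

end SuperSheaf

theorem mainTheorem9 {𝕜 : Type} [RCLike 𝕜] (n : WithTop ℕ∞) (m q : ℕ)
    {M M' : Type u}
    [TopologicalSpace M] [ChartedSpace (Std 𝕜 m) M] [IsManifold 𝓘(𝕜, Std 𝕜 m) n M]
    [TopologicalSpace M'] [ChartedSpace (Std 𝕜 m) M'] [IsManifold 𝓘(𝕜, Std 𝕜 m) n M']
    (S : SuperSheaf 𝕜 M) (hS : S.IsSupermanifold n m q)
    (S' : SuperSheaf 𝕜 M') (hS' : S'.IsSupermanifold n m q)
    (π : FiniteCovering n m S' S) :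
    ((S.IsSplit n m q → S'.IsSplit n m q) ∧
      (S.IsProjected → S'.IsProjected) ∧
      (∀ i : ℕ, S.IsSplitTrunc n m q i → S'.IsSplitTrunc n m q i) ∧
      (∀ i : ℕ, (S.trunc i).IsProjected → (S'.trunc i).IsProjected)) ∧
    ((S'.IsSplit n m q → S.IsSplit n m q) ∧
      (∀ i : ℕ, S'.IsSplitTrunc n m q i → S.IsSplitTrunc n m q i)) ∧
    ∀ A : GradedAtlas n m q S', A.omegaTwo ≠ 1 → ¬ S.IsProjected := by
  have hc := π.isCoveringMap
  have hf := hc.isLocalHomeomorph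
  let L := π.toLocIso
  have hproj : S.IsProjected → S'.IsProjected := SuperSheaf.IsProjected.pull L hf
  refine ⟨⟨?_, hproj, fun i => ?_, fun i => SuperSheaf.IsProjected.pull (L.quot hf (i + 1)) hf⟩,
    ⟨?_, fun i => ?_⟩, fun A hA h => hA ((hproj h).omegaTwo_eq_one A)⟩
  · rw [hS.isSplit_iff, hS'.isSplit_iff]
    exact fun ⟨E⟩ => SuperSheaf.Euler.nonempty_pull L hf E
  · rw [hS.isSplitTrunc_iff, hS'.isSplitTrunc_iff]
    exact fun ⟨E⟩ => SuperSheaf.Euler.nonempty_pull (L.quot hf (i + 1)) hf E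
  · rw [hS.isSplit_iff, hS'.isSplit_iff]
    exact fun ⟨E⟩ => ⟨SuperSheaf.Euler.average hc π.surjective π.finite_fiber L E⟩
  · rw [hS.isSplitTrunc_iff, hS'.isSplitTrunc_iff]
    exact fun ⟨E⟩ =>
      ⟨SuperSheaf.Euler.average hc π.surjective π.finite_fiber (L.quot hf (i + 1)) E⟩
end
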